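/- Let $[n]=\{1,\dots,n\}$, and encode graphs on $[n]$ as symmetric $\{0,1\}$-matrices. **Model.** A pair $(G,H)$ of random symmetric $n\times n$ matrices with entries in $\{0,1\}$ is $(\alpha,d,\delta)$-edge-correlated if the pairs $(G_{ij},H_{ij})$, $1\le i\le j\le n$, are mutually independent and there are deterministic symmetric arrays $p_{ij}\in[0,1-\alpha]$ and $\delta_{ij}\in[0,\delta]$ with $p_{ii}=\delta_{ii}=0$ such that, for $i\le j$, $$\mathbb P[G_{ij}=1]=\mathbb P[H_{ij}=1]=p_{ij},\qquad \mathbb P[G_{ij}=1,H_{ij}=0]=\mathbb P[G_{ij}=0,H_{ij}=1]=p_{ij}\delta_{ij},$$ and $\sum_{j=1}^n p_{ij}\ge d$ for every $i\in[n]$. **Algorithm $\mathcal A(G,H,L)$.** For $t\in[0,1)$ let $I_t=\bigcup_{m\in\mathbb Z}[t+m-\tfrac1L,\,t+m+\tfrac1L]$. Let $X_j=\sum_{\ell}G_{j\ell}$ and $Y_j=\sum_\ell H_{j\ell}$ be the degrees, and for $i,k\in[n]$ put $$D(i,k)=\int_0^1\Big|\sum_{j=1}^n\mathbf 1\{\sqrt{X_j}\in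 I_t\}\mathbf 1\{G_{ij}=1\}-\sum_{j=1}^n\mathbf 1\{\sqrt{Y_j}\in I_t\}\mathbf 1\{H_{kj}=1\}\Big|\,dt .$$ If for every $i$ the function $k\mapsto D(i,k)$ has a unique minimizer $\widehat\pi(i)$, and $\widehat\pi$ is a permutation of $[n]$, the output is $\widehat\pi$; otherwise the output is "error". **Theorem.** For every $\alpha\in(0,1)$ there exist positive constants $c_1,c_2,c_3,C$, depending only on $\alpha$, such that for every $n\ge2$, every real $L$ with $|L-c_3\log n|\le1$ (in particular $L=c_3\log n$, and $c_3\log n$ rounded up or down to an integer), and every $(\alpha,\,c_1\log^2n,\,c_2\log^{-2}n)$-edge-correlated pair $(G,H)$ on $[n]$, $$\mathbb P\Big[\mathcal A\big((G_{ij})_{i,j},\,(H_{\pi^{-1}(i),\pi^{-1}(j)})_{i,j},\,L\big)=\pi\ \text{ for all permutations }\pi\text{ of }[n]\Big]\ \ge\ 1-\frac Cn .$$ -/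

import Mathlib

open MeasureTheory ProbabilityTheory

namespace DegreeProfile

/-- A pair `(G, H)` of random graphs on the vertex set `Fin n`, encoded as random symmetric
`{0,1}`-matrices on the probability space `(Ω, P)`, has an `(α, d, δ)`-edge-correlated
distribution. `p i j` are the edge probabilities and `ε i j` the noise parameters
(so that `ε i j ≤ δ`); both are deterministic, but not known to the algorithm. -/
def EdgeCorrelated {n : ℕ} {Ω : Type*} [MeasurableSpace Ω] (P : Measure Ω)
    (G H : Ω → Matrix (Fin n) (Fin n) ℕ) (α d δ : ℝ) : Prop :=
  -- random symmetric matrices with entries in `{0, 1}`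
  (∀ i j, Measurable fun ω => G ω i j) ∧ (∀ i j, Measurable fun ω => H ω i j) ∧
  (∀ ω i j, G ω i j = 0 ∨ G ω i j = 1) ∧ (∀ ω i j, H ω i j = 0 ∨ H ω i j = 1) ∧
  (∀ ω, (G ω).IsSymm) ∧ (∀ ω, (H ω).IsSymm) ∧
  -- the pairs `(G i j, H i j)`, `i ≤ j`, are mutually independent
  iIndepFun (fun (e : {e : Fin n × Fin n // e.1 ≤ e.2}) ω =>
    (G ω e.1.1 e.1.2, H ω e.1.1 e.1.2)) P ∧
  ∃ p ε : Fin n → Fin n → ℝ,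
    -- inhomogeneous edge probabilities
    (∀ i j, 0 ≤ p i j ∧ p i j ≤ 1 - α) ∧ (∀ i j, p i j = p j i) ∧ (∀ i, p i i = 0) ∧
    (∀ i j, i ≤ j → P.real {ω | G ω i j = 1} = p i j ∧ P.real {ω | H ω i j = 1} = p i j) ∧
    -- edge correlations
    (∀ i j, 0 ≤ ε i j ∧ ε i j ≤ δ) ∧ (∀ i j, ε i j = ε j i) ∧ (∀ i, ε i i = 0) ∧
    (∀ i j, i ≤ j →
      P.real {ω | G ω i j = 1 ∧ H ω i j = 0} = p i j * ε i j ∧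
      P.real {ω | G ω i j = 0 ∧ H ω i j = 1} = p i j * ε i j) ∧
    -- minimal average degree
    (∀ i, d ≤ ∑ j, p i j)

/-- The bin `I_t = ⋃ₘ [t + m - 1/L, t + m + 1/L]`, the preimage in `ℝ` of the closed arc of
length `2/L` centred at `t` in `ℝ/ℤ`. -/
def bin (L t : ℝ) : Set ℝ :=
  ⋃ m : ℤ, Set.Icc (t + m - 1 / L) (t + m + 1 / L)

/-- The degree of the vertex `j` in the graph with adjacency matrix `G`. -/
def deg {n : ℕ} (G : Matrix (Fin n) (Fin n) ℕ) (j : Fin n) : ℕ := ∑ l, G j l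

open Classical in
/-- The indicator that `j` is a neighbour of `i` in `G` whose ball `√(deg j)` lies in `I_t`. -/
noncomputable def ball {n : ℕ} (L : ℝ) (G : Matrix (Fin n) (Fin n) ℕ) (i j : Fin n) (t : ℝ) : ℝ :=
  (if √(deg G j : ℝ) ∈ bin L t then 1 else 0) * (if G i j = 1 then 1 else 0)

/-- The `L¹` distance between the signature of the vertex `i` in `G` and that of `k` in `H`. -/
noncomputable def sigDist {n : ℕ} (L : ℝ) (G H : Matrix (Fin n) (Fin n) ℕ) (i k : Fin n) : ℝ :=
  ∫ t in (0 : ℝ)..1, |∑ j, ball L G i j t - ∑ j, ball L H k j t|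

open Classical in
/-- The matching algorithm. If for every `i` the function `k ↦ sigDist L G H i k` has exactly one
minimizer `piHat i` and `piHat` is a permutation, the output is `some piHat`; in all other cases
the output is `none`, which stands for "error". -/
noncomputable def graphMatching {n : ℕ} (L : ℝ) (G H : Matrix (Fin n) (Fin n) ℕ) :
    Option (Equiv.Perm (Fin n)) :=
  if h : ∀ i, ∃! k, ∀ l, sigDist L G H i k ≤ sigDist L G H i l then
    let piHat : Fin n → Fin n := fun i => (h i).choose
    if hb : Function.Bijective piHat then some (Equiv.ofBijective piHat hb) else none
  else none

end DegreeProfile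

/-! Fix the set `d` of vertex pairs on which the two graphs disagree. Given `d`, the edges of the
first graph are independent bits `z`, and the second graph is `switch d z`. Both kinds of
disagreement have the same probability, so a differing edge is a fair coin; the other edges have
success probabilities comparable with the original ones and bounded away from 1. For a typical `d`
(`Typical`) every estimate concerns a finite product of bits. Blocks of bits are resampled with the
others frozen: an L² bound controls the mean of an L¹ norm, and Bernstein's inequality controls the
deviation with failure probability `n⁻⁴`. The scale is `τ = thr s L (D i)`, a small multiple of `√(D
i / L)`, which is the order of the fluctuation of the number of neighbours of `i` in one bin.

A vertex and its own copy (`pr_univ_sigDiff_le`). The signature difference is averaged over the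
edges at `i` (giving `mism`), then over a `layer` of other edges (giving `drift`). A cut `side`
sends at least half of the weight at every vertex across. The crossing edges of distinct vertices on
one side are disjoint, so given the rest the degrees of these vertices contain independent parts,
common to both graphs. Averaging over them turns the rough bin indicator of `j` into a function of
the remaining degree with increments of order `1 / √(D j)` (`abs_ex_shift_le`). Negating the fair
coins exchanges the remaining degrees in the two graphs, so `drift` is centred; it is small because
few edges differ (`pr_drift_le`). The variances in the other two averaging steps are governed by the
probability that a degree falls into the bin in only one of the graphs, hence by the degree
discrepancies `discr`. Altogether the distance is below `10 τ`.

Different vertices (`pr_univ_crossDiff_le`). With all but the edges at `i` frozen, many neighbours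
of `i` enter the signature of `i` without disturbing that of `k`. They contribute a sum of
independent bits, which is not concentrated near any point (`le_ex_abs_cnt_sub`), so the expected
absolute difference at `t` is at least of order `√(clean t)`. The integral of `clean` is of order `D
i / L`, and `clean` rarely exceeds this order, so the integral of its square root is of order `√(D i
/ L)`. If `s` is small compared with `a ^ 2`, the distance exceeds `12 τ` up to a negligible error.

A union bound over pairs, `pr_not_fewDifferences_le` for the law of `d`, and the equivariance of the
algorithm under relabelling (`graphMatching_perm`) finish the proof. -/

namespace BitAvg

/-! ### Expectations over finitely many independent bits. -/

variable {ι : Type*} [Fintype ι] [DecidableEq ι]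

/-- The weight of a configuration of independent bits with success probabilities `q`. -/
noncomputable def wt (q : ι → ℝ) (y : ι → Bool) : ℝ := ∏ e, if y e then q e else 1 - q e

/-- The expectation of `f` over independent bits with success probabilities `q`. -/
noncomputable def ex (q : ι → ℝ) (f : (ι → Bool) → ℝ) : ℝ := ∑ y, wt q y * f y

/-- The family `q` consists of probabilities. -/
def IsProb (q : ι → ℝ) : Prop := ∀ e, 0 ≤ q e ∧ q e ≤ 1

lemma wt_nonneg {q : ι → ℝ} (hq : IsProb q) (y : ι → Bool) : 0 ≤ wt q y := by
  unfold wt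
  refine Finset.prod_nonneg fun e _ => ?_
  split_ifs
  · exact (hq e).1
  · linarith [(hq e).2]

lemma sum_wt_mul_prod (q : ι → ℝ) (φ : ι → Bool → ℝ) :
    ex q (fun y => ∏ e, φ e (y e)) = ∏ e, (q e * φ e true + (1 - q e) * φ e false) := by
  unfold ex wt
  have h := Finset.prod_univ_sum (fun _ : ι => (Finset.univ : Finset Bool))
    (fun e b => (if b = true then q e else 1 - q e) * φ e b)
  simp only [Fintype.univ_bool, Finset.mem_singleton, Bool.true_eq_false, not_false_eq_true,
    Finset.sum_insert, Finset.sum_singleton, if_true, Bool.false_eq_true, if_false] at h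
  rw [h, ← Fintype.univ_bool, Fintype.piFinset_univ]
  exact Finset.sum_congr rfl fun y _ => Finset.prod_mul_distrib.symm

lemma ex_bit (q : ι → ℝ) (e : ι) (F : Bool → ℝ) :
    ex q (fun y => F (y e)) = q e * F true + (1 - q e) * F false := by
  have h := sum_wt_mul_prod q (fun e' b => if e' = e then F b else 1)
  simp only [Finset.prod_ite_eq', Finset.mem_univ, if_true] at h
  rw [h, Finset.prod_eq_single e]
  · simp
  · intro b _ hb; simp [hb]
  · simp

lemma ex_const (q : ι → ℝ) (c : ℝ) : ex q (fun _ => c) = c := by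
  have h := sum_wt_mul_prod q (fun _ _ => 1)
  simp only [Finset.prod_const_one, mul_one, add_sub_cancel] at h
  unfold ex at h ⊢
  rw [← Finset.sum_mul]
  simp only [mul_one] at h
  rw [h, one_mul]

lemma ex_mono {q : ι → ℝ} (hq : IsProb q) {f g : (ι → Bool) → ℝ} (h : ∀ y, f y ≤ g y) :
    ex q f ≤ ex q g :=
  Finset.sum_le_sum fun y _ => mul_le_mul_of_nonneg_left (h y) (wt_nonneg hq y)

lemma ex_nonneg {q : ι → ℝ} (hq : IsProb q) {f : (ι → Bool) → ℝ} (h : ∀ y, 0 ≤ f y) :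
    0 ≤ ex q f :=
  Finset.sum_nonneg fun y _ => mul_nonneg (wt_nonneg hq y) (h y)

lemma ex_add (q : ι → ℝ) (f g : (ι → Bool) → ℝ) :
    ex q (fun y => f y + g y) = ex q f + ex q g := by
  simp [ex, mul_add, Finset.sum_add_distrib]

lemma ex_sub (q : ι → ℝ) (f g : (ι → Bool) → ℝ) :
    ex q (fun y => f y - g y) = ex q f - ex q g := by
  simp [ex, mul_sub, Finset.sum_sub_distrib]

lemma ex_const_mul (q : ι → ℝ) (c : ℝ) (f : (ι → Bool) → ℝ) :
    ex q (fun y => c * f y) = c * ex q f := by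
  simp only [ex, Finset.mul_sum]
  exact Finset.sum_congr rfl fun y _ => by ring

lemma ex_neg (q : ι → ℝ) (f : (ι → Bool) → ℝ) : ex q (fun y => - f y) = - ex q f := by
  simp [ex]

lemma ex_sum {J : Type*} (q : ι → ℝ) (A : Finset J) (f : J → (ι → Bool) → ℝ) :
    ex q (fun y => ∑ j ∈ A, f j y) = ∑ j ∈ A, ex q (f j) := by
  simp only [ex, Finset.mul_sum]
  exact Finset.sum_comm

lemma abs_ex_le {q : ι → ℝ} (hq : IsProb q) (f : (ι → Bool) → ℝ) :
    |ex q f| ≤ ex q (fun y => |f y|) := by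
  unfold ex
  refine (Finset.abs_sum_le_sum_abs _ _).trans_eq (Finset.sum_congr rfl fun y _ => ?_)
  rw [abs_mul, abs_of_nonneg (wt_nonneg hq y)]

lemma ex_le_of_le {q : ι → ℝ} (hq : IsProb q) {f : (ι → Bool) → ℝ} {c : ℝ} (h : ∀ y, f y ≤ c) :
    ex q f ≤ c := (ex_mono hq h).trans_eq (ex_const q c)

lemma le_ex_of_le {q : ι → ℝ} (hq : IsProb q) {f : (ι → Bool) → ℝ} {c : ℝ} (h : ∀ y, c ≤ f y) :
    c ≤ ex q f := (ex_const q c).symm.trans_le (ex_mono hq h)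

/-- The variance is at most the second moment about any point. -/
lemma ex_sub_sq_le {q : ι → ℝ} (hq : IsProb q) (f : (ι → Bool) → ℝ) (m : ℝ) :
    ex q (fun y => (f y - ex q f) ^ 2) ≤ ex q (fun y => (f y - m) ^ 2) := by
  set M := ex q f with hM
  have h : ∀ y, (f y - m) ^ 2 = (f y - M) ^ 2 + (2 * (M - m)) * (f y - M) + (M - m) ^ 2 :=
    fun y => by ring
  simp only [h]
  rw [ex_add, ex_add, ex_const_mul, ex_sub, ex_const, ex_const, ← hM]
  nlinarith [sq_nonneg (M - m)]

lemma sq_ex_le {q : ι → ℝ} (hq : IsProb q) (f : (ι → Bool) → ℝ) :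
    (ex q f) ^ 2 ≤ ex q (fun y => f y ^ 2) := by
  have h : ∀ y, f y ^ 2 = (f y - ex q f) ^ 2 + (2 * ex q f) * (f y - ex q f) + (ex q f) ^ 2 :=
    fun y => by ring
  have h2 : ex q (fun y => f y ^ 2) = ex q (fun y => (f y - ex q f) ^ 2) + (ex q f) ^ 2 := by
    simp only [h]
    rw [ex_add, ex_add, ex_const_mul, ex_sub, ex_const, ex_const]
    ring
  rw [h2]
  linarith [ex_nonneg hq (f := fun y => (f y - ex q f) ^ 2) (fun y => sq_nonneg _)]

/-- Exchanging the coordinates in `T` between two independent copies preserves their law. -/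
lemma ex_mix (q : ι → ℝ) (T : Finset ι) (F : (ι → Bool) → ℝ) :
    ex q (fun y => ex q (fun y' => F (T.piecewise y' y))) = ex q F := by
  -- Exchanging the `T`-coordinates of `y` and `y'` is an involution that preserves the product of
  -- the two weights.
  have key : ∀ G : (ι → Bool) → (ι → Bool) → ℝ,
      ex q (fun y => ex q (fun y' => G (T.piecewise y' y) (T.piecewise y y'))) =
      ex q (fun y => ex q (fun y' => G y y')) := by
    intro G
    simp only [ex, Finset.mul_sum, ← Finset.sum_product']
    refine Finset.sum_nbij' (fun p => (T.piecewise p.2 p.1, T.piecewise p.1 p.2))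
      (fun p => (T.piecewise p.2 p.1, T.piecewise p.1 p.2)) (by simp) (by simp) ?_ ?_ ?_
    · intro p _
      ext e <;> by_cases he : e ∈ T <;> simp [he]
    · intro p _
      ext e <;> by_cases he : e ∈ T <;> simp [he]
    · intro p _
      have : wt q p.1 * wt q p.2 = wt q (T.piecewise p.2 p.1) * wt q (T.piecewise p.1 p.2) := by
        simp only [wt, ← Finset.prod_mul_distrib]
        refine Finset.prod_congr rfl fun e _ => ?_
        by_cases he : e ∈ T <;> simp [he, mul_comm]
      simp only [← mul_assoc, this]
  rw [key (fun y _ => F y)]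
  simp only [ex_const]

/-- The average of `f` over the bits in `S`, the other bits being those of `x`. -/
noncomputable def av (q : ι → ℝ) (S : Finset ι) (f : (ι → Bool) → ℝ) (x : ι → Bool) : ℝ :=
  ex q (fun y => f (S.piecewise y x))

lemma av_av (q : ι → ℝ) (S T : Finset ι) (f : (ι → Bool) → ℝ) (x : ι → Bool) :
    av q S (av q T f) x = av q (S ∪ T) f x := by
  refine Eq.trans ?_ (ex_mix q T (fun y => f ((S ∪ T).piecewise y x)))
  unfold av
  congr 1; ext y; congr 1; ext y'; congr 1; ext e
  by_cases hT : e ∈ T <;> by_cases hS : e ∈ S <;> simp [hT, hS]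

lemma ex_av (q : ι → ℝ) (T : Finset ι) (f : (ι → Bool) → ℝ) : ex q (av q T f) = ex q f :=
  ex_mix q T f

lemma av_congr_off (q : ι → ℝ) (S : Finset ι) (f : (ι → Bool) → ℝ) {x x' : ι → Bool}
    (h : ∀ e, e ∉ S → x e = x' e) : av q S f x = av q S f x' := by
  unfold av
  congr 1; ext y; congr 1; ext e
  by_cases hS : e ∈ S
  · simp [hS]
  · simp [hS, h e hS]

lemma av_piecewise (q : ι → ℝ) (S R : Finset ι) (hRS : R ⊆ S) (f : (ι → Bool) → ℝ)
    (y x : ι → Bool) : av q S f (R.piecewise y x) = av q S f x :=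
  av_congr_off q S f fun e he => by simp [show e ∉ R from fun h => he (hRS h)]

lemma av_empty (q : ι → ℝ) (f : (ι → Bool) → ℝ) (x : ι → Bool) : av q ∅ f x = f x := by
  simp [av, ex_const]

lemma av_mono {q : ι → ℝ} (hq : IsProb q) (S : Finset ι) {f g : (ι → Bool) → ℝ}
    (x : ι → Bool) (h : ∀ y, f (S.piecewise y x) ≤ g (S.piecewise y x)) :
    av q S f x ≤ av q S g x := ex_mono hq h

/-! ### Deviation inequalities -/

/-- The function equals `m` except on an event of probability at most `ρ`, where it is off by at
most `c`; this gives the variance. The exponential moment follows from `exp u ≤ 1 + u + u ^ 2` for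
`|u| ≤ 1`, which applies because `φ` is within `2 * c` of its mean. -/
lemma ex_exp_centered_le {q : ι → ℝ} (hq : IsProb q) (φ χ : (ι → Bool) → ℝ) (m c ρ t : ℝ)
    (hc : 0 ≤ c) (hφ : ∀ y, |φ y - m| ≤ c * χ y) (hχ : ∀ y, χ y = 0 ∨ χ y = 1)
    (hρ : ex q χ ≤ ρ) (ht : |t| * (2 * c) ≤ 1) :
    ex q (fun y => (φ y - ex q φ) ^ 2) ≤ c ^ 2 * ρ ∧
    ex q (fun y => Real.exp (t * (φ y - ex q φ))) ≤ Real.exp (t ^ 2 * (c ^ 2 * ρ)) := by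
  have hvar : ex q (fun y => (φ y - ex q φ) ^ 2) ≤ c ^ 2 * ρ := by
    refine (ex_sub_sq_le hq φ m).trans ?_
    calc ex q (fun y => (φ y - m) ^ 2) ≤ ex q (fun y => c ^ 2 * χ y) := by
          refine ex_mono hq fun y => ?_
          have h1 := hφ y
          rw [← sq_abs]
          rcases hχ y with h | h <;> rw [h] at h1 ⊢
          · have : |φ y - m| = 0 := le_antisymm (by simpa using h1) (abs_nonneg _)
            rw [this]; simp
          · have := abs_nonneg (φ y - m)
            nlinarith
      _ = c ^ 2 * ex q χ := ex_const_mul _ _ _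
      _ ≤ c ^ 2 * ρ := by gcongr
  refine ⟨hvar, ?_⟩
  have hle : ∀ y, |φ y - m| ≤ c := fun y => by
    refine (hφ y).trans ?_
    rcases hχ y with h | h <;> rw [h] <;> simp [hc]
  have hEm : |ex q φ - m| ≤ c := by
    have : ex q φ - m = ex q (fun y => φ y - m) := by rw [ex_sub, ex_const]
    rw [this]
    exact (abs_ex_le hq _).trans (ex_le_of_le hq hle)
  have hdev : ∀ y, |t * (φ y - ex q φ)| ≤ 1 := fun y => by
    rw [abs_mul]
    have : |φ y - ex q φ| ≤ 2 * c := by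
      have h1 := abs_le.1 (hle y)
      have h2 := abs_le.1 hEm
      rw [abs_le]; constructor <;> linarith
    exact (mul_le_mul_of_nonneg_left this (abs_nonneg t)).trans ht
  calc ex q (fun y => Real.exp (t * (φ y - ex q φ)))
      ≤ ex q (fun y => 1 + t * (φ y - ex q φ) + t ^ 2 * (φ y - ex q φ) ^ 2) := by
        refine ex_mono hq fun y => ?_
        have := (abs_le.1 (Real.abs_exp_sub_one_sub_id_le (hdev y))).2
        nlinarith
    _ = 1 + t ^ 2 * ex q (fun y => (φ y - ex q φ) ^ 2) := by
        rw [ex_add, ex_add, ex_const, ex_const_mul, ex_const_mul, ex_sub, ex_const]; ring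
    _ ≤ 1 + t ^ 2 * (c ^ 2 * ρ) := by gcongr
    _ ≤ Real.exp (t ^ 2 * (c ^ 2 * ρ)) := by
        have := Real.add_one_le_exp (t ^ 2 * (c ^ 2 * ρ)); linarith

/-- Efron–Stein and Bernstein bounds for a function of independent blocks of bits. -/
theorem av_centered_le {J : Type*} [DecidableEq J] {q : ι → ℝ} (hq : IsProb q) (A : Finset J)
    (T : J → Finset ι) (hT : (A : Set J).PairwiseDisjoint T) (f : (ι → Bool) → ℝ)
    (m χ : J → (ι → Bool) → ℝ) (c ρ : J → ℝ) (t : ℝ) (hc : ∀ j ∈ A, 0 ≤ c j)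
    (hf : ∀ j ∈ A, ∀ x y, |f ((T j).piecewise y x) - m j x| ≤ c j * χ j y)
    (hχ : ∀ j ∈ A, ∀ y, χ j y = 0 ∨ χ j y = 1) (hρ : ∀ j ∈ A, ex q (χ j) ≤ ρ j)
    (ht : ∀ j ∈ A, |t| * (2 * c j) ≤ 1) (x : ι → Bool) :
    av q (A.biUnion T) (fun z => (f z - av q (A.biUnion T) f z) ^ 2) x
      ≤ ∑ j ∈ A, c j ^ 2 * ρ j ∧
    av q (A.biUnion T) (fun z => Real.exp (t * (f z - av q (A.biUnion T) f z))) x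
      ≤ Real.exp (t ^ 2 * ∑ j ∈ A, c j ^ 2 * ρ j) := by
  induction A using Finset.induction_on generalizing x with
  | empty => simp [av_empty]
  | insert j A hj ih =>
    have ih := ih (hT.subset (by simp)) (fun k hk => hc k (Finset.mem_insert_of_mem hk))
      (fun k hk => hf k (Finset.mem_insert_of_mem hk))
      (fun k hk => hχ k (Finset.mem_insert_of_mem hk))
      (fun k hk => hρ k (Finset.mem_insert_of_mem hk))
      (fun k hk => ht k (Finset.mem_insert_of_mem hk))
    set S := A.biUnion T with hS
    have hdis : Disjoint (T j) S := by
      rw [hS, Finset.disjoint_biUnion_right]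
      intro k hk
      exact hT (by simp) (by simp [hk]) (fun h => hj (h ▸ hk))
    set g := av q S f with hg
    have hgS : ∀ y z, g (S.piecewise y z) = g z := fun y z => av_piecewise q S S le_rfl f y z
    have hU : (insert j A).biUnion T = T j ∪ S := by rw [Finset.biUnion_insert]
    have hUav : ∀ h : (ι → Bool) → ℝ, av q (T j ∪ S) h = av q (T j) (av q S h) := by
      intro h; ext z; exact (av_av q (T j) S h z).symm
    -- Averaging over the other blocks preserves the hypothesis for block `j`, since the right-hand
    -- side depends only on the bits `y` of that block.
    have hgT : ∀ y z, |g ((T j).piecewise y z) - av q S (m j) z| ≤ c j * χ j y := by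
      intro y z
      have : g ((T j).piecewise y z) - av q S (m j) z =
          ex q (fun y' => f ((T j).piecewise y (S.piecewise y' z)) - m j (S.piecewise y' z)) := by
        rw [ex_sub]
        simp only [hg, av]
        congr 2; ext y'; congr 1; ext e
        by_cases hTe : e ∈ T j
        · have := Finset.disjoint_left.1 hdis hTe; simp [hTe, this]
        · simp [hTe, Finset.piecewise]
      rw [this]
      exact (abs_ex_le hq _).trans (ex_le_of_le hq fun y' => hf j (by simp) _ _)
    have hTT : ∀ y z, av q (T j) g ((T j).piecewise y z) = av q (T j) g z :=
      fun y z => av_piecewise q _ _ le_rfl g y z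
    have hone : ∀ z, av q (T j) (fun z => (g z - av q (T j) g z) ^ 2) z ≤ c j ^ 2 * ρ j ∧
        av q (T j) (fun z => Real.exp (t * (g z - av q (T j) g z))) z
          ≤ Real.exp (t ^ 2 * (c j ^ 2 * ρ j)) := by
      intro z
      have := ex_exp_centered_le hq (fun y => g ((T j).piecewise y z)) (χ j) (av q S (m j) z)
        (c j) (ρ j) t (hc j (by simp)) (fun y => hgT y z) (hχ j (by simp)) (hρ j (by simp))
        (ht j (by simp))
      simp only [av] at this hTT ⊢
      simpa only [hTT] using this
    have hfull : ∀ y z, av q (T j) g (S.piecewise y z) = av q (T j) g z := by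
      intro y z
      rw [← hUav f]
      exact av_piecewise q _ S Finset.subset_union_right f y z
    rw [hU, hUav f, Finset.sum_insert hj]
    refine ⟨?_, ?_⟩
    · rw [hUav]
      -- Pythagoras: given the bits outside `S`, the increment `f - g` has mean zero and the
      -- remaining increment is constant.
      have h1 : ∀ z, av q S (fun z => (f z - av q (T j) g z) ^ 2) z =
          av q S (fun z => (f z - g z) ^ 2) z + (g z - av q (T j) g z) ^ 2 := by
        intro z
        have h2 : ∀ y, (f (S.piecewise y z) - av q (T j) g z) ^ 2 =
            (f (S.piecewise y z) - g z) ^ 2 +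
              (2 * (g z - av q (T j) g z)) * (f (S.piecewise y z) - g z) +
              (g z - av q (T j) g z) ^ 2 := fun y => by ring
        have h3 : ex q (fun y => f (S.piecewise y z)) = g z := rfl
        simp only [av] at hfull hgS h2 ⊢
        simp only [hgS, hfull, h2]
        rw [ex_add, ex_add, ex_const_mul, ex_sub, ex_const, ex_const, h3]
        ring
      calc av q (T j) (av q S (fun z => (f z - av q (T j) g z) ^ 2)) x
          ≤ av q (T j) (fun z => (∑ j ∈ A, c j ^ 2 * ρ j) + (g z - av q (T j) g z) ^ 2) x := by
            refine av_mono hq _ _ fun y => ?_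
            rw [h1]
            linarith [(ih ((T j).piecewise y x)).1]
        _ = (∑ j ∈ A, c j ^ 2 * ρ j) + av q (T j) (fun z => (g z - av q (T j) g z) ^ 2) x := by
            simp only [av, ex_add, ex_const]
        _ ≤ _ := by linarith [(hone x).1]
    · rw [hUav]
      have h1 : ∀ z, av q S (fun z => Real.exp (t * (f z - av q (T j) g z))) z =
          av q S (fun z => Real.exp (t * (f z - g z))) z * 
            Real.exp (t * (g z - av q (T j) g z)) := by
        intro z
        have h2 : ∀ y, Real.exp (t * (f (S.piecewise y z) - av q (T j) g z)) =
            Real.exp (t * (g z - av q (T j) g z)) * Real.exp (t * (f (S.piecewise y z) - g z)) :=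
          fun y => by rw [← Real.exp_add]; congr 1; ring
        simp only [av] at hfull hgS h2 ⊢
        simp only [hgS, hfull, h2]
        rw [ex_const_mul, mul_comm]
      calc av q (T j) (av q S (fun z => Real.exp (t * (f z - av q (T j) g z)))) x
          ≤ av q (T j) (fun z => Real.exp (t ^ 2 * ∑ j ∈ A, c j ^ 2 * ρ j) *
              Real.exp (t * (g z - av q (T j) g z))) x := by
            refine av_mono hq _ _ fun y => ?_
            rw [h1]
            exact mul_le_mul_of_nonneg_right (ih _).2 (Real.exp_nonneg _)
        _ = Real.exp (t ^ 2 * ∑ j ∈ A, c j ^ 2 * ρ j) *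
              av q (T j) (fun z => Real.exp (t * (g z - av q (T j) g z))) x := by
            simp only [av, ex_const_mul]
        _ ≤ Real.exp (t ^ 2 * ∑ j ∈ A, c j ^ 2 * ρ j) * Real.exp (t ^ 2 * (c j ^ 2 * ρ j)) :=
            mul_le_mul_of_nonneg_left (hone x).2 (Real.exp_nonneg _)
        _ = _ := by rw [← Real.exp_add]; congr 1; ring

end BitAvg

/-! ### Conditional probabilities and Bernstein's inequality. -/

namespace BitAvg

variable {ι : Type*} [Fintype ι] [DecidableEq ι]

/-- The probability of `A` when the bits in `S` are resampled and the others are those of `x`. -/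
noncomputable def pr (q : ι → ℝ) (S : Finset ι) (A : Set (ι → Bool)) (x : ι → Bool) : ℝ :=
  av q S (A.indicator 1) x

lemma indicator_one_nonneg (A : Set (ι → Bool)) (y : ι → Bool) :
    (0 : ℝ) ≤ A.indicator 1 y := Set.indicator_nonneg (fun _ _ => zero_le_one) y

lemma indicator_one_le (A : Set (ι → Bool)) (y : ι → Bool) :
    A.indicator (1 : (ι → Bool) → ℝ) y ≤ 1 := Set.indicator_le_self' (fun _ _ => zero_le_one) y

lemma pr_le_one {q : ι → ℝ} (hq : IsProb q) (S : Finset ι) (A : Set (ι → Bool)) (x : ι → Bool) :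
    pr q S A x ≤ 1 := ex_le_of_le hq fun _ => indicator_one_le A _

lemma pr_mono {q : ι → ℝ} (hq : IsProb q) (S : Finset ι) {A B : Set (ι → Bool)} (x : ι → Bool)
    (h : ∀ y, S.piecewise y x ∈ A → S.piecewise y x ∈ B) : pr q S A x ≤ pr q S B x := by
  refine av_mono hq S x fun y => ?_
  by_cases hA : S.piecewise y x ∈ A
  · simp [hA, h y hA]
  · rw [Set.indicator_of_notMem hA]; exact indicator_one_nonneg B _

lemma pr_union_le {q : ι → ℝ} (hq : IsProb q) (S : Finset ι) (A B : Set (ι → Bool))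
    (x : ι → Bool) : pr q S (A ∪ B) x ≤ pr q S A x + pr q S B x := by
  unfold pr av
  rw [← ex_add]
  refine ex_mono hq fun y => ?_
  have hA := indicator_one_nonneg A (S.piecewise y x)
  have hB := indicator_one_nonneg B (S.piecewise y x)
  by_cases h : S.piecewise y x ∈ A
  · simp only [Set.indicator_of_mem h, Set.indicator_of_mem (Set.mem_union_left B h),
      Pi.one_apply]; linarith
  · by_cases h' : S.piecewise y x ∈ B
    · simp only [Set.indicator_of_mem h', Set.indicator_of_mem (Set.mem_union_right A h'),
        Pi.one_apply]; linarith
    · rw [Set.indicator_of_notMem (by simp [h, h'])]; linarith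

lemma pr_biUnion_le {J : Type*} {q : ι → ℝ} (hq : IsProb q) (S : Finset ι) (I : Finset J)
    (A : J → Set (ι → Bool)) (x : ι → Bool) :
    pr q S (⋃ j ∈ I, A j) x ≤ ∑ j ∈ I, pr q S (A j) x := by
  classical
  induction I using Finset.induction_on with
  | empty => simp [pr, av, ex_const]
  | insert j I hj ih =>
    rw [Finset.set_biUnion_insert, Finset.sum_insert hj]
    exact (pr_union_le hq S _ _ x).trans (by linarith)

/-- If `A` is conditionally unlikely given the bits outside `S`, apart from an unlikely set `N`
of such bits, then `A` is unlikely. -/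
lemma pr_univ_le_add {q : ι → ℝ} (hq : IsProb q) (S : Finset ι) (A N : Set (ι → Bool)) {ε : ℝ}
    (hε : 0 ≤ ε) (x₀ : ι → Bool) (h : ∀ x, x ∉ N → pr q S A x ≤ ε) :
    pr q Finset.univ A x₀ ≤ ε + pr q Finset.univ N x₀ := by
  unfold pr av
  simp only [Finset.piecewise_univ]
  rw [← ex_av q S (A.indicator 1), ← ex_const q ε, ← ex_add]
  refine ex_mono hq fun x => ?_
  by_cases hx : x ∈ N
  · rw [Set.indicator_of_mem hx]
    have := pr_le_one hq S A x
    unfold pr at this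
    simp only [Pi.one_apply]
    linarith
  · rw [Set.indicator_of_notMem hx, add_zero]
    exact h x hx

lemma pr_le_av_div {q : ι → ℝ} (hq : IsProb q) (S : Finset ι) (f : (ι → Bool) → ℝ) (x : ι → Bool)
    {u : ℝ} (hu : 0 < u) (hf : ∀ y, 0 ≤ f (S.piecewise y x)) :
    pr q S {z | u ≤ f z} x ≤ av q S f x / u := by
  rw [le_div_iff₀ hu, mul_comm]
  unfold pr av
  rw [← ex_const_mul]
  refine ex_mono hq fun y => ?_
  by_cases h : S.piecewise y x ∈ {z | u ≤ f z}
  · rw [Set.indicator_of_mem h]; simpa using h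
  · rw [Set.indicator_of_notMem h]; simpa using hf y

/-- Applying `av_centered_le` after freezing the bits outside the blocks at `x` means that the
bounded-influence hypothesis is needed only for configurations agreeing with `x` there. -/
lemma av_pw_centered_le {J : Type*} [DecidableEq J] {q : ι → ℝ} (hq : IsProb q) (A : Finset J)
    (T : J → Finset ι) (hT : (A : Set J).PairwiseDisjoint T) (x : ι → Bool) (f : (ι → Bool) → ℝ)
    (m χ : J → (ι → Bool) → ℝ) (c ρ : J → ℝ) (t : ℝ) (hc : ∀ j ∈ A, 0 ≤ c j)
    (hf : ∀ j ∈ A, ∀ z y,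
      |f ((A.biUnion T).piecewise ((T j).piecewise y z) x) - m j z| ≤ c j * χ j y)
    (hχ : ∀ j ∈ A, ∀ y, χ j y = 0 ∨ χ j y = 1) (hρ : ∀ j ∈ A, ex q (χ j) ≤ ρ j)
    (ht : ∀ j ∈ A, |t| * (2 * c j) ≤ 1) :
    av q (A.biUnion T) (fun z => (f z - av q (A.biUnion T) f x) ^ 2) x
      ≤ ∑ j ∈ A, c j ^ 2 * ρ j ∧
    av q (A.biUnion T) (fun z => Real.exp (t * (f z - av q (A.biUnion T) f x))) x
      ≤ Real.exp (t ^ 2 * ∑ j ∈ A, c j ^ 2 * ρ j) := by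
  have h := av_centered_le hq A T hT (fun z => f ((A.biUnion T).piecewise z x)) m χ c ρ t hc hf
    hχ hρ ht x
  set S := A.biUnion T
  have h1 : ∀ y z, S.piecewise (S.piecewise y z) x = S.piecewise y x := by
    intro y z; ext e; by_cases he : e ∈ S <;> simp [he]
  simpa only [av, h1] using h

theorem av_sq_centered_le {J : Type*} [DecidableEq J] {q : ι → ℝ} (hq : IsProb q) (A : Finset J)
    (T : J → Finset ι) (hT : (A : Set J).PairwiseDisjoint T) (x : ι → Bool) (f : (ι → Bool) → ℝ)
    (m χ : J → (ι → Bool) → ℝ) (c ρ : J → ℝ) (hc : ∀ j ∈ A, 0 ≤ c j)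
    (hf : ∀ j ∈ A, ∀ z y,
      |f ((A.biUnion T).piecewise ((T j).piecewise y z) x) - m j z| ≤ c j * χ j y)
    (hχ : ∀ j ∈ A, ∀ y, χ j y = 0 ∨ χ j y = 1) (hρ : ∀ j ∈ A, ex q (χ j) ≤ ρ j) :
    av q (A.biUnion T) (fun z => (f z - av q (A.biUnion T) f x) ^ 2) x
      ≤ ∑ j ∈ A, c j ^ 2 * ρ j :=
  (av_pw_centered_le hq A T hT x f m χ c ρ 0 hc hf hχ hρ (by simp)).1

/-- Bernstein's inequality for a function of independent blocks of bits. -/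
theorem pr_ge_av_add_le {J : Type*} [DecidableEq J] {q : ι → ℝ} (hq : IsProb q) (A : Finset J)
    (T : J → Finset ι) (hT : (A : Set J).PairwiseDisjoint T) (x : ι → Bool) (f : (ι → Bool) → ℝ)
    (m χ : J → (ι → Bool) → ℝ) (c ρ : J → ℝ) (hc : ∀ j ∈ A, 0 ≤ c j)
    (hf : ∀ j ∈ A, ∀ z y,
      |f ((A.biUnion T).piecewise ((T j).piecewise y z) x) - m j z| ≤ c j * χ j y)
    (hχ : ∀ j ∈ A, ∀ y, χ j y = 0 ∨ χ j y = 1) (hρ : ∀ j ∈ A, ex q (χ j) ≤ ρ j)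
    {cm V u K : ℝ} (hcm : ∀ j ∈ A, c j ≤ cm) (hV : ∑ j ∈ A, c j ^ 2 * ρ j ≤ V) (hu : 0 < u)
    (hK : 0 < K) (hKV : 4 * K * V ≤ u ^ 2) (hKc : 4 * K * cm ≤ u) :
    pr q (A.biUnion T) {z | av q (A.biUnion T) f x + u ≤ f z} x ≤ Real.exp (-K) := by
  set S := A.biUnion T
  -- With this `t` the Chernoff exponent is `-t * u + t ^ 2 * V ≤ -2 * K + K`; the factor 4 in `hKV`
  -- and `hKc` is what makes `t` admissible.
  set t : ℝ := 2 * K / u with ht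
  have ht0 : 0 < t := by positivity
  have htc : ∀ j ∈ A, |t| * (2 * c j) ≤ 1 := by
    intro j hj
    rw [abs_of_pos ht0, ht, div_mul_eq_mul_div, div_le_one hu]
    nlinarith [hcm j hj]
  have h := (av_pw_centered_le hq A T hT x f m χ c ρ t hc hf hχ hρ htc).2
  have h1 : pr q S {z | av q S f x + u ≤ f z} x ≤
      Real.exp (-(t * u)) * av q S (fun z => Real.exp (t * (f z - av q S f x))) x := by
    generalize av q S f x = M
    unfold pr
    rw [av, av, ← ex_const_mul]
    refine ex_mono hq fun y => ?_
    set z := S.piecewise y x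
    by_cases hz : z ∈ {z | M + u ≤ f z}
    · rw [Set.indicator_of_mem hz, ← Real.exp_add, Pi.one_apply]
      refine Real.one_le_exp ?_
      have : M + u ≤ f z := hz
      nlinarith
    · rw [Set.indicator_of_notMem hz]; positivity
  refine h1.trans ((mul_le_mul_of_nonneg_left h (Real.exp_nonneg _)).trans ?_)
  rw [← Real.exp_add, Real.exp_le_exp]
  have h2 : t * u = 2 * K := by rw [ht]; field_simp
  have h3 : t ^ 2 * ∑ j ∈ A, c j ^ 2 * ρ j ≤ K := by
    calc t ^ 2 * ∑ j ∈ A, c j ^ 2 * ρ j ≤ t ^ 2 * V := by gcongr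
      _ = K * (4 * K * V) / u ^ 2 := by rw [ht]; field_simp; ring
      _ ≤ K * u ^ 2 / u ^ 2 := by gcongr
      _ = K := by field_simp
  rw [h2]; linarith

/-- The bit `y e` as a real number. -/
def bit (y : ι → Bool) (e : ι) : ℝ := if y e then 1 else 0

lemma ex_bit_eq (q : ι → ℝ) (e : ι) : ex q (fun y => bit y e) = q e := by
  have := ex_bit q e (fun b => if b then (1 : ℝ) else 0)
  simpa [bit] using this

/-- For a single bit the centre is the value with the bit off and the exceptional event is that the
bit is on, so that its probability is `q e`. Variances are thus proportional to `q e`, which matters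
for sparse graphs. -/
lemma bit_hyp {S : Finset ι} {x : ι → Bool} {f : (ι → Bool) → ℝ} {c : ι → ℝ}
    (hf : ∀ e ∈ S, ∀ z, |f (S.piecewise (Function.update z e true) x) -
      f (S.piecewise (Function.update z e false) x)| ≤ c e) :
    ∀ e ∈ S, ∀ z y, |f ((S.biUnion fun e => {e}).piecewise (({e} : Finset ι).piecewise y z) x) -
      f (S.piecewise (Function.update z e false) x)| ≤ c e * bit y e := by
  intro e he z y
  rw [Finset.biUnion_singleton_eq_self, Finset.piecewise_singleton]
  unfold bit
  cases h : y e
  · simp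
  · simpa using hf e he z

/-- The Efron–Stein inequality for independent bits. -/
theorem av_sq_centered_le_of_bits {q : ι → ℝ} (hq : IsProb q) (S : Finset ι)
    (x : ι → Bool) (f : (ι → Bool) → ℝ) (c : ι → ℝ)
    (hf : ∀ e ∈ S, ∀ z, |f (S.piecewise (Function.update z e true) x) -
      f (S.piecewise (Function.update z e false) x)| ≤ c e) :
    av q S (fun z => (f z - av q S f x) ^ 2) x ≤ ∑ e ∈ S, c e ^ 2 * q e := by
  have h := av_sq_centered_le hq S (fun e => {e}) (fun _ _ _ _ h => by simpa using h) x f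
    (fun e z => f (S.piecewise (Function.update z e false) x)) (fun e y => bit y e) c q
    (fun e he => (abs_nonneg _).trans (hf e he x)) (bit_hyp hf)
    (fun e _ y => by unfold bit; split_ifs <;> simp) (fun e _ => (ex_bit_eq q e).le)
  simpa only [Finset.biUnion_singleton_eq_self] using h

/-- Bernstein's inequality for a function of independent bits. -/
theorem pr_ge_av_add_le_of_bits {q : ι → ℝ} (hq : IsProb q) (S : Finset ι)
    (x : ι → Bool) (f : (ι → Bool) → ℝ) (c : ι → ℝ)
    (hf : ∀ e ∈ S, ∀ z, |f (S.piecewise (Function.update z e true) x) -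
      f (S.piecewise (Function.update z e false) x)| ≤ c e)
    {cm V u K : ℝ} (hcm : ∀ e ∈ S, c e ≤ cm) (hV : ∑ e ∈ S, c e ^ 2 * q e ≤ V) (hu : 0 < u)
    (hK : 0 < K) (hKV : 4 * K * V ≤ u ^ 2) (hKc : 4 * K * cm ≤ u) :
    pr q S {z | av q S f x + u ≤ f z} x ≤ Real.exp (-K) := by
  have h := pr_ge_av_add_le hq S (fun e => {e}) (fun _ _ _ _ h => by simpa using h) x f
    (fun e z => f (S.piecewise (Function.update z e false) x)) (fun e y => bit y e) c q
    (fun e he => (abs_nonneg _).trans (hf e he x)) (bit_hyp hf)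
    (fun e _ y => by unfold bit; split_ifs <;> simp) (fun e _ => (ex_bit_eq q e).le) hcm hV hu hK
    hKV hKc
  simpa only [Finset.biUnion_singleton_eq_self] using h

theorem pr_le_av_sub_le_of_bits {q : ι → ℝ} (hq : IsProb q) (S : Finset ι)
    (x : ι → Bool) (f : (ι → Bool) → ℝ) (c : ι → ℝ)
    (hf : ∀ e ∈ S, ∀ z, |f (S.piecewise (Function.update z e true) x) -
      f (S.piecewise (Function.update z e false) x)| ≤ c e)
    {cm V u K : ℝ} (hcm : ∀ e ∈ S, c e ≤ cm) (hV : ∑ e ∈ S, c e ^ 2 * q e ≤ V) (hu : 0 < u)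
    (hK : 0 < K) (hKV : 4 * K * V ≤ u ^ 2) (hKc : 4 * K * cm ≤ u) :
    pr q S {z | f z ≤ av q S f x - u} x ≤ Real.exp (-K) := by
  have h := pr_ge_av_add_le_of_bits hq S x (fun z => - f z) c
    (fun e he z => by rw [← abs_neg]; convert hf e he z using 2; ring) hcm hV hu hK hKV hKc
  convert h using 3
  ext z
  have : av q S (fun z => -f z) x = - av q S f x := ex_neg _ _
  rw [this]
  constructor <;> intro h <;> linarith

/-! ### Sums of bits -/

/-- The number of ones in `T`. -/
def cnt (T : Finset ι) (y : ι → Bool) : ℕ := ∑ e ∈ T, if y e then 1 else 0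

lemma cnt_cast (T : Finset ι) (y : ι → Bool) : (cnt T y : ℝ) = ∑ e ∈ T, bit y e := by
  simp [cnt, bit]

lemma cnt_congr {T : Finset ι} {y z : ι → Bool} (h : ∀ e ∈ T, y e = z e) : cnt T y = cnt T z :=
  Finset.sum_congr rfl fun e he => by rw [h e he]

lemma cnt_update_of_mem {T : Finset ι} {e : ι} (he : e ∈ T) (y : ι → Bool) (b : Bool) :
    cnt T (Function.update y e b) = cnt (T.erase e) y + if b then 1 else 0 := by
  unfold cnt
  rw [← Finset.sum_erase_add _ _ he, Function.update_self]
  congr 1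
  exact Finset.sum_congr rfl fun e' he' => by
    rw [Function.update_of_ne (Finset.ne_of_mem_erase he')]

lemma ex_cnt (q : ι → ℝ) (T : Finset ι) : ex q (fun y => (cnt T y : ℝ)) = ∑ e ∈ T, q e := by
  simp only [cnt_cast]
  rw [ex_sum]
  exact Finset.sum_congr rfl fun e _ => ex_bit_eq q e

lemma av_singleton (q : ι → ℝ) (e : ι) (f : (ι → Bool) → ℝ) (x : ι → Bool) :
    av q {e} f x =
      q e * f (Function.update x e true) + (1 - q e) * f (Function.update x e false) := by
  unfold av
  simp only [Finset.piecewise_singleton]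
  exact ex_bit q e (fun b => f (Function.update x e b))

lemma ex_linear_sq_le {q : ι → ℝ} (hq : IsProb q) (T : Finset ι) (b : ι → ℝ) :
    ex q (fun y => (∑ e ∈ T, b e * (bit y e - q e)) ^ 2) ≤ ∑ e ∈ T, b e ^ 2 * q e := by
  classical
  have h := av_sq_centered_le_of_bits hq Finset.univ (fun _ => false)
    (fun y => ∑ e ∈ T, b e * (bit y e - q e)) (fun e => if e ∈ T then |b e| else 0) (by
      intro e _ z
      simp only [Finset.piecewise_univ]
      rw [← Finset.sum_sub_distrib]
      have : ∀ e' ∈ T, b e' * (bit (Function.update z e true) e' - q e') -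
          b e' * (bit (Function.update z e false) e' - q e') = if e' = e then b e else 0 := by
        intro e' _
        by_cases h : e' = e
        · subst h; simp [bit]; ring
        · simp [bit, h]
      rw [Finset.sum_congr rfl this, Finset.sum_ite_eq']
      split_ifs <;> simp)
  have h0 : ex q (fun y => ∑ e ∈ T, b e * (bit y e - q e)) = 0 := by
    rw [ex_sum]
    exact Finset.sum_eq_zero fun e _ => by
      rw [ex_const_mul, ex_sub, ex_bit_eq, ex_const]; ring
  simp only [av, Finset.piecewise_univ, h0, sub_zero] at h
  refine h.trans_eq ?_
  rw [← Finset.sum_filter_add_sum_filter_not Finset.univ (fun e => e ∈ T)]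
  rw [Finset.sum_eq_zero (s := Finset.univ.filter fun e => e ∉ T)]
  · simp only [Finset.filter_mem_eq_inter, Finset.univ_inter, add_zero]
    exact Finset.sum_congr rfl fun e he => by simp [he, sq_abs]
  · intro e he; simp [(Finset.mem_filter.1 he).2]

lemma ex_abs_le_sqrt {q : ι → ℝ} (hq : IsProb q) (f : (ι → Bool) → ℝ) {V : ℝ}
    (h : ex q (fun y => f y ^ 2) ≤ V) : ex q (fun y => |f y|) ≤ √V := by
  refine Real.le_sqrt_of_sq_le ((sq_ex_le hq _).trans ?_)
  simpa only [sq_abs] using h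

/-- Smoothness of the law of a sum of independent bits. -/
theorem abs_ex_shift_le {q : ι → ℝ} (hq : IsProb q) (T : Finset ι) {a B : ℝ} (ha : 0 < a)
    (hB : 0 ≤ B) (hqa : ∀ e ∈ T, a ≤ 1 - q e) (hμ : 0 < ∑ e ∈ T, q e) (h : ℕ → ℝ)
    (hh : ∀ k, |h k| ≤ B) :
    |ex q (fun y => h (cnt T y + 1)) - ex q (fun y => h (cnt T y))|
      ≤ 3 * B / (a * √(∑ e ∈ T, q e)) := by
  set μ := ∑ e ∈ T, q e with hμdef
  set D := ex q (fun y => h (cnt T y + 1)) - ex q (fun y => h (cnt T y)) with hD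
  have hD' : D = ex q (fun y => h (cnt T y + 1) - h (cnt T y)) := by rw [ex_sub]
  -- Integration by parts in the bit `e`. As `cnt T y` itself contains this bit, the term with `q e`
  -- corrects for it. Summing over `e` expresses the variance of the count times `D` through two
  -- centred linear sums, each of L¹ norm at most `√μ`.
  have hid : ∀ e ∈ T, q e * (1 - q e) * D = ex q (fun y => (bit y e - q e) *
      (h (cnt T y) + q e * (h (cnt T y + 1) - h (cnt T y)))) := by
    intro e he
    rw [hD', ← ex_const_mul]
    rw [← ex_av q {e} (fun y => q e * (1 - q e) * (h (cnt T y + 1) - h (cnt T y))),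
      ← ex_av q {e} (fun y => (bit y e - q e) * _)]
    congr 1; ext x
    simp only [av_singleton, cnt_update_of_mem he, bit, Function.update_self]
    simp only [if_true, Bool.false_eq_true, if_false, add_zero]
    ring
  have hsum : (∑ e ∈ T, q e * (1 - q e)) * D =
      ex q (fun y => h (cnt T y) * ∑ e ∈ T, 1 * (bit y e - q e)) +
      ex q (fun y => (h (cnt T y + 1) - h (cnt T y)) * ∑ e ∈ T, q e * (bit y e - q e)) := by
    rw [Finset.sum_mul, Finset.sum_congr rfl hid, ← ex_sum, ← ex_add]
    congr 1; ext y
    rw [Finset.mul_sum, Finset.mul_sum, ← Finset.sum_add_distrib]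
    exact Finset.sum_congr rfl fun e _ => by ring
  have hs1 : ex q (fun y => |∑ e ∈ T, 1 * (bit y e - q e)|) ≤ √μ :=
    ex_abs_le_sqrt hq _ ((ex_linear_sq_le hq T fun _ => 1).trans_eq (by simp [hμdef]))
  have hs2 : ex q (fun y => |∑ e ∈ T, q e * (bit y e - q e)|) ≤ √μ := by
    refine ex_abs_le_sqrt hq _ ((ex_linear_sq_le hq T q).trans ?_)
    refine Finset.sum_le_sum fun e _ => ?_
    have := hq e
    have h1 : q e ^ 2 ≤ 1 := by nlinarith
    nlinarith
  have hb1 : |ex q (fun y => h (cnt T y) * ∑ e ∈ T, 1 * (bit y e - q e))| ≤ B * √μ := by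
    refine (abs_ex_le hq _).trans ((ex_mono hq (g := fun y =>
      B * |∑ e ∈ T, 1 * (bit y e - q e)|) fun y => ?_).trans ?_)
    · rw [abs_mul]; exact mul_le_mul_of_nonneg_right (hh _) (abs_nonneg _)
    · rw [ex_const_mul]; exact mul_le_mul_of_nonneg_left hs1 hB
  have hb2 : |ex q (fun y => (h (cnt T y + 1) - h (cnt T y)) *
      ∑ e ∈ T, q e * (bit y e - q e))| ≤ 2 * B * √μ := by
    refine (abs_ex_le hq _).trans ((ex_mono hq (g := fun y =>
      2 * B * |∑ e ∈ T, q e * (bit y e - q e)|) fun y => ?_).trans ?_)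
    · rw [abs_mul]
      refine mul_le_mul_of_nonneg_right ?_ (abs_nonneg _)
      have h1 := abs_le.1 (hh (cnt T y))
      have h2 := abs_le.1 (hh (cnt T y + 1))
      rw [abs_le]; constructor <;> linarith
    · rw [ex_const_mul]; exact mul_le_mul_of_nonneg_left hs2 (by linarith)
  have hv : a * μ ≤ ∑ e ∈ T, q e * (1 - q e) := by
    rw [hμdef, Finset.mul_sum]
    exact Finset.sum_le_sum fun e he => by nlinarith [hqa e he, (hq e).1]
  have hfin : a * μ * |D| ≤ 3 * B * √μ := by
    calc a * μ * |D| ≤ (∑ e ∈ T, q e * (1 - q e)) * |D| :=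
          mul_le_mul_of_nonneg_right hv (abs_nonneg _)
      _ = |(∑ e ∈ T, q e * (1 - q e)) * D| := by
          rw [abs_mul, abs_of_nonneg ((by positivity : (0:ℝ) ≤ a * μ).trans hv)]
      _ ≤ B * √μ + 2 * B * √μ := by
          rw [hsum]; exact (abs_add_le _ _).trans (add_le_add hb1 hb2)
      _ = 3 * B * √μ := by ring
  have hsq : 0 < √μ := Real.sqrt_pos.2 hμ
  rw [le_div_iff₀ (by positivity)]
  have h2 : √μ * √μ = μ := Real.mul_self_sqrt hμ.le
  have h3 : (|D| * (a * √μ)) * √μ ≤ (3 * B) * √μ := by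
    calc (|D| * (a * √μ)) * √μ = a * (√μ * √μ) * |D| := by ring
      _ ≤ _ := by rw [h2]; exact hfin
  exact le_of_mul_le_mul_right h3 hsq

end BitAvg

/-! ### Anticoncentration and window averages of sums of bits. -/

namespace BitAvg

variable {ι : Type*} [Fintype ι] [DecidableEq ι]

/-- Anticoncentration of a sum of independent bits. -/
theorem le_ex_abs_cnt_sub {q : ι → ℝ} (hq : IsProb q) (T : Finset ι) {a : ℝ} (ha : 0 < a)
    (hqa : ∀ e ∈ T, a ≤ 1 - q e) (hμ : 12 ≤ a * √(∑ e ∈ T, q e)) (m : ℝ) :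
    a * √(∑ e ∈ T, q e) / 24 ≤ ex q (fun y => |(cnt T y : ℝ) - m|) := by
  have hμ0 : 0 < ∑ e ∈ T, q e := by
    by_contra h
    rw [Real.sqrt_eq_zero_of_nonpos (not_lt.1 h)] at hμ
    linarith
  set s := a * √(∑ e ∈ T, q e) with hs
  set r := s / 6 with hr
  have hr2 : 2 ≤ r := by rw [hr]; linarith
  -- A clamped linear function of slope `1 / r`: its increment at `k` is exactly `1 / r` when `|k -
  -- m| < r - 1`. Smoothness of the law bounds the mean increment by `3 / s = 1 / (2 * r)`, so the
  -- count is that close to `m` with probability at most `1 / 2`.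
  set h : ℕ → ℝ := fun k => max (-1) (min 1 ((k - m) / r)) with hh
  have hB : ∀ k, |h k| ≤ 1 := fun k => by
    rw [abs_le]
    exact ⟨le_max_left _ _, max_le (by norm_num) (min_le_left _ _)⟩
  have hshift := abs_ex_shift_le hq T ha zero_le_one hqa hμ0 h hB
  rw [← hs] at hshift
  have hmono : ∀ k : ℕ, h k ≤ h (k + 1) := fun k => by
    simp only [hh]
    push_cast
    gcongr
    linarith
  have hpt : ∀ k : ℕ, (r - 1) * (1 - r * (h (k + 1) - h k)) ≤ |(k : ℝ) - m| := by
    intro k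
    by_cases hk : |(k : ℝ) - m| < r - 1
    · have hk' := abs_lt.1 hk
      have e1 : h k = (k - m) / r := by
        simp only [hh]
        rw [min_eq_right, max_eq_right]
        · rw [le_div_iff₀ (by linarith)]; linarith
        · rw [div_le_one (by linarith)]; linarith
      have e2 : h (k + 1) = (k + 1 - m) / r := by
        simp only [hh]
        push_cast
        rw [min_eq_right, max_eq_right]
        · rw [le_div_iff₀ (by linarith)]; linarith
        · rw [div_le_one (by linarith)]; linarith
      have : r * (h (k + 1) - h k) = 1 := by
        rw [e1, e2]; field_simp; ring
      rw [this]; simp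
    · have := hmono k
      have h1 : 0 ≤ r * (h (k + 1) - h k) := mul_nonneg (by linarith) (by linarith)
      nlinarith
  have h1 : ex q (fun y => (r - 1) * (1 - r * (h (cnt T y + 1) - h (cnt T y)))) =
      (r - 1) * (1 - r * (ex q (fun y => h (cnt T y + 1)) - ex q (fun y => h (cnt T y)))) := by
    rw [ex_const_mul, ex_sub, ex_const, ex_const_mul, ex_sub]
  have h2 := ex_mono hq (fun y => hpt (cnt T y))
  rw [h1] at h2
  refine le_trans ?_ h2
  have h3 := (abs_le.1 hshift).2
  have h4 : r * (ex q (fun y => h (cnt T y + 1)) - ex q (fun y => h (cnt T y))) ≤ 1 / 2 := by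
    refine (mul_le_mul_of_nonneg_left h3 (by linarith)).trans_eq ?_
    rw [hr]; field_simp; norm_num
  rw [show s = 6 * r by rw [hr]; ring]
  nlinarith

/-- If `h` has small sums over all windows of length `N`, then a spread-out sum of bits gives it a
small expectation. -/
theorem ex_window_le {q : ι → ℝ} (hq : IsProb q) (T : Finset ι) {a B : ℝ} (ha : 0 < a)
    (hqa : ∀ e ∈ T, a ≤ 1 - q e) (hμ : 0 < ∑ e ∈ T, q e) (h : ℕ → ℝ)
    (h0 : ∀ k, 0 ≤ h k) {N : ℕ} (hN : 0 < N) (hB : ∀ k, ∑ r ∈ Finset.range N, h (k + r) ≤ B) :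
    ex q (fun y => h (cnt T y)) ≤ B / N + 3 * B / (a * √(∑ e ∈ T, q e)) := by
  have hB0 : 0 ≤ B := (Finset.sum_nonneg fun r _ => h0 (0 + r)).trans (hB 0)
  -- Smoothness is applied to partial window sums, whose increments telescope to `h (k + s) - h k`.
  -- Thus a shift by any `s < N` costs no more than a single step does, and averaging over all these
  -- shifts produces a full window.
  have hs : ∀ s ∈ Finset.range N, ex q (fun y => h (cnt T y)) ≤
      ex q (fun y => h (cnt T y + s)) + 3 * B / (a * √(∑ e ∈ T, q e)) := by
    intro s hsN
    have hH : ∀ k, |∑ r ∈ Finset.range s, h (k + r)| ≤ B := fun k => by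
      rw [abs_of_nonneg (Finset.sum_nonneg fun r _ => h0 _)]
      refine (Finset.sum_le_sum_of_subset_of_nonneg ?_ fun r _ _ => h0 _).trans (hB k)
      exact Finset.range_mono (Finset.mem_range.1 hsN).le
    have := (abs_le.1 (abs_ex_shift_le hq T ha hB0 hqa hμ
      (fun k => ∑ r ∈ Finset.range s, h (k + r)) hH)).1
    have htel : ∀ k, (∑ r ∈ Finset.range s, h (k + 1 + r)) - ∑ r ∈ Finset.range s, h (k + r) =
        h (k + s) - h k := by
      intro k
      have h1 := Finset.sum_range_succ (fun r => h (k + r)) s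
      have h2 := Finset.sum_range_succ' (fun r => h (k + r)) s
      rw [h1] at h2
      simp only [add_zero] at h2
      have h3 : ∀ r, h (k + 1 + r) = h (k + (r + 1)) := fun r => by congr 1; ring
      simp only [h3]
      linarith
    rw [← ex_sub] at this
    simp only [htel] at this
    rw [ex_sub] at this
    linarith
  have hsum := Finset.sum_le_sum hs
  rw [Finset.sum_const, Finset.sum_add_distrib, Finset.sum_const, ← ex_sum] at hsum
  have := ex_le_of_le hq (fun y => hB (cnt T y))
  simp only [Finset.card_range, nsmul_eq_mul] at hsum
  have hN' : (0 : ℝ) < N := by exact_mod_cast hN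
  rw [div_add' _ _ _ hN'.ne', le_div_iff₀ hN']
  nlinarith

end BitAvg

namespace DegreeProfile

/-! ### Bounded measurable functions on the circle -/

/-- Bounded measurable functions of a real variable. -/
def Nice (φ : ℝ → ℝ) : Prop := Measurable φ ∧ ∃ C, ∀ t, |φ t| ≤ C

lemma Nice.intervalIntegrable {φ : ℝ → ℝ} (h : Nice φ) (x y : ℝ) :
    IntervalIntegrable φ volume x y := by
  obtain ⟨hm, C, hC⟩ := h
  rw [intervalIntegrable_iff]
  exact Measure.integrableOn_of_bounded (M := C) (by simp) hm.aestronglyMeasurable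
    (Filter.Eventually.of_forall fun t => hC t)

lemma Nice.add {φ ψ : ℝ → ℝ} (h : Nice φ) (h' : Nice ψ) : Nice (fun t => φ t + ψ t) := by
  obtain ⟨hm, C, hC⟩ := h
  obtain ⟨hm', C', hC'⟩ := h'
  exact ⟨hm.add hm', C + C', fun t => (abs_add_le _ _).trans (add_le_add (hC t) (hC' t))⟩

lemma Nice.sub {φ ψ : ℝ → ℝ} (h : Nice φ) (h' : Nice ψ) : Nice (fun t => φ t - ψ t) := by
  obtain ⟨hm, C, hC⟩ := h
  obtain ⟨hm', C', hC'⟩ := h'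
  exact ⟨hm.sub hm', C + C', fun t => (abs_sub _ _).trans (add_le_add (hC t) (hC' t))⟩

lemma Nice.mul {φ ψ : ℝ → ℝ} (h : Nice φ) (h' : Nice ψ) : Nice (fun t => φ t * ψ t) := by
  obtain ⟨hm, C, hC⟩ := h
  obtain ⟨hm', C', hC'⟩ := h'
  refine ⟨hm.mul hm', C * C', fun t => ?_⟩
  rw [abs_mul]
  exact mul_le_mul (hC t) (hC' t) (abs_nonneg _) ((abs_nonneg _).trans (hC t))

lemma nice_const (c : ℝ) : Nice (fun _ => c) := ⟨measurable_const, |c|, fun _ => le_rfl⟩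

lemma Nice.abs {φ : ℝ → ℝ} (h : Nice φ) : Nice (fun t => |φ t|) := by
  obtain ⟨hm, C, hC⟩ := h
  exact ⟨hm.norm, C, fun t => by rw [abs_abs]; exact hC t⟩

lemma Nice.const_mul {φ : ℝ → ℝ} (c : ℝ) (h : Nice φ) : Nice (fun t => c * φ t) :=
  (nice_const c).mul h

lemma Nice.sq {φ : ℝ → ℝ} (h : Nice φ) : Nice (fun t => φ t ^ 2) := by
  simp only [pow_two]; exact h.mul h

lemma nice_sum {J : Type*} (A : Finset J) {φ : J → ℝ → ℝ} (h : ∀ j ∈ A, Nice (φ j)) :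
    Nice (fun t => ∑ j ∈ A, φ j t) := by
  classical
  induction A using Finset.induction_on with
  | empty => simpa using nice_const 0
  | insert j A hj ih =>
    simp only [Finset.sum_insert hj]
    exact (h j (by simp)).add (ih fun k hk => h k (by simp [hk]))

lemma nice_ex {ι : Type*} [Fintype ι] [DecidableEq ι] (q : ι → ℝ) {φ : (ι → Bool) → ℝ → ℝ}
    (h : ∀ y, Nice (φ y)) : Nice (fun t => BitAvg.ex q (fun y => φ y t)) :=
  nice_sum _ fun y _ => (h y).const_mul _

/-- The integral over one period. -/
noncomputable def circ (φ : ℝ → ℝ) : ℝ := ∫ t in (0 : ℝ)..1, φ t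

lemma circ_mono {φ ψ : ℝ → ℝ} (h : Nice φ) (h' : Nice ψ) (hle : ∀ t, φ t ≤ ψ t) :
    circ φ ≤ circ ψ :=
  intervalIntegral.integral_mono_on zero_le_one (h.intervalIntegrable _ _)
    (h'.intervalIntegrable _ _) fun t _ => hle t

lemma circ_add {φ ψ : ℝ → ℝ} (h : Nice φ) (h' : Nice ψ) :
    circ (fun t => φ t + ψ t) = circ φ + circ ψ :=
  intervalIntegral.integral_add (h.intervalIntegrable _ _) (h'.intervalIntegrable _ _)

lemma circ_sub {φ ψ : ℝ → ℝ} (h : Nice φ) (h' : Nice ψ) :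
    circ (fun t => φ t - ψ t) = circ φ - circ ψ :=
  intervalIntegral.integral_sub (h.intervalIntegrable _ _) (h'.intervalIntegrable _ _)

lemma circ_const (c : ℝ) : circ (fun _ => c) = c := by simp [circ]

lemma circ_const_mul (c : ℝ) (φ : ℝ → ℝ) : circ (fun t => c * φ t) = c * circ φ :=
  intervalIntegral.integral_const_mul _ _

lemma circ_sum {J : Type*} (A : Finset J) {φ : J → ℝ → ℝ} (h : ∀ j ∈ A, Nice (φ j)) :
    circ (fun t => ∑ j ∈ A, φ j t) = ∑ j ∈ A, circ (φ j) :=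
  intervalIntegral.integral_finsetSum fun j hj => (h j hj).intervalIntegrable _ _

lemma circ_nonneg {φ : ℝ → ℝ} (h : ∀ t, 0 ≤ φ t) : 0 ≤ circ φ :=
  intervalIntegral.integral_nonneg zero_le_one fun t _ => h t

lemma ex_circ {ι : Type*} [Fintype ι] [DecidableEq ι] (q : ι → ℝ) {φ : (ι → Bool) → ℝ → ℝ}
    (h : ∀ y, Nice (φ y)) :
    BitAvg.ex q (fun y => circ (φ y)) = circ (fun t => BitAvg.ex q (fun y => φ y t)) := by
  unfold BitAvg.ex
  rw [circ_sum _ fun y _ => (h y).const_mul _]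
  simp only [circ_const_mul]

lemma abs_circ_abs_sub_le {φ ψ : ℝ → ℝ} (h : Nice φ) (h' : Nice ψ) :
    |circ (fun t => |φ t|) - circ (fun t => |ψ t|)| ≤ circ (fun t => |φ t - ψ t|) := by
  rw [← circ_sub h.abs h'.abs, abs_le]
  constructor
  · rw [← neg_one_mul, ← circ_const_mul]
    refine circ_mono ((h.sub h').abs.const_mul _) (h.abs.sub h'.abs) fun t => ?_
    have := abs_sub_abs_le_abs_sub (ψ t) (φ t)
    rw [abs_sub_comm (ψ t)] at this
    linarith
  · exact circ_mono (h.abs.sub h'.abs) (h.sub h').abs fun t => abs_sub_abs_le_abs_sub _ _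

/-- The `L¹` norm is at most the `L²` norm. -/
lemma ex_circ_abs_le {ι : Type*} [Fintype ι] [DecidableEq ι] {q : ι → ℝ} (hq : BitAvg.IsProb q)
    {φ : (ι → Bool) → ℝ → ℝ} (h : ∀ y, Nice (φ y)) {τ : ℝ} (hτ : 0 < τ)
    (h2 : circ (fun t => BitAvg.ex q (fun y => φ y t ^ 2)) ≤ τ ^ 2) :
    BitAvg.ex q (fun y => circ (fun t => |φ y t|)) ≤ τ := by
  -- The inequality `|r| ≤ r ^ 2 / (2 * τ) + τ / 2` replaces Cauchy–Schwarz.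
  have h1 : ∀ y, circ (fun t => |φ y t|) ≤ (1 / (2 * τ)) * circ (fun t => φ y t ^ 2) + τ / 2 := by
    intro y
    rw [← circ_const_mul, ← circ_const (τ / 2), ← circ_add ((h y).sq.const_mul _) (nice_const _)]
    refine circ_mono (h y).abs (((h y).sq.const_mul _).add (nice_const _)) fun t => ?_
    rw [← sq_abs (φ y t)]
    have : (1 / (2 * τ)) * |φ y t| ^ 2 + τ / 2 - |φ y t| = (|φ y t| - τ) ^ 2 / (2 * τ) := by
      field_simp; ring
    have : 0 ≤ (|φ y t| - τ) ^ 2 / (2 * τ) := by positivity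
    linarith
  refine (BitAvg.ex_mono hq h1).trans ?_
  rw [BitAvg.ex_add, BitAvg.ex_const, BitAvg.ex_const_mul, ex_circ q fun y => (h y).sq]
  calc 1 / (2 * τ) * circ (fun t => BitAvg.ex q (fun y => φ y t ^ 2)) + τ / 2
      ≤ 1 / (2 * τ) * τ ^ 2 + τ / 2 := by gcongr
    _ = τ := by field_simp; ring

/-! ### Indicators of bins -/

open Classical in
/-- The indicator that `t` lies in the image of `[c, d]` in `ℝ/ℤ`. -/
noncomputable def arc (c d t : ℝ) : ℝ := if ∃ m : ℤ, c ≤ t + m ∧ t + m ≤ d then 1 else 0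

lemma arc_zero_or_one (c d t : ℝ) : arc c d t = 0 ∨ arc c d t = 1 := by
  unfold arc; split_ifs <;> simp

lemma measurableSet_arc (c d : ℝ) : MeasurableSet {t : ℝ | ∃ m : ℤ, c ≤ t + m ∧ t + m ≤ d} := by
  have : {t : ℝ | ∃ m : ℤ, c ≤ t + m ∧ t + m ≤ d} =
      ⋃ m : ℤ, (fun t : ℝ => t + m) ⁻¹' Set.Icc c d := by
    ext t
    simp only [Set.mem_iUnion, Set.mem_preimage, Set.mem_Icc]
    rfl
  rw [this]
  exact MeasurableSet.iUnion fun m => (measurable_id.add_const _) measurableSet_Icc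

lemma nice_arc (c d : ℝ) : Nice (arc c d) := by
  refine ⟨Measurable.ite (measurableSet_arc c d) measurable_const measurable_const, 1, fun t => ?_⟩
  rcases arc_zero_or_one c d t with h | h <;> rw [h] <;> simp

lemma arc_eq_indicator (c d : ℝ) :
    arc c d = Set.indicator {t : ℝ | ∃ m : ℤ, c ≤ t + m ∧ t + m ≤ d} (fun _ => 1) := by
  classical
  ext t
  rw [Set.indicator_apply]
  unfold arc
  by_cases h : ∃ m : ℤ, c ≤ t + m ∧ t + m ≤ d
  · rw [if_pos h, if_pos (show t ∈ {t : ℝ | ∃ m : ℤ, c ≤ t + m ∧ t + m ≤ d} from h)]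
  · rw [if_neg h, if_neg (show t ∉ {t : ℝ | ∃ m : ℤ, c ≤ t + m ∧ t + m ≤ d} from h)]

lemma circ_arc_eq (c d : ℝ) : circ (arc c d) =
    volume.real ({t : ℝ | ∃ m : ℤ, c ≤ t + m ∧ t + m ≤ d} ∩ Set.Ioc 0 1) := by
  rw [circ, intervalIntegral.integral_of_le zero_le_one, arc_eq_indicator,
    integral_indicator (measurableSet_arc c d), integral_const, smul_eq_mul, mul_one,
    measureReal_restrict_apply MeasurableSet.univ, Set.univ_inter,
    measureReal_restrict_apply (measurableSet_arc c d)]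

lemma circ_arc_le {c d : ℝ} (h : c ≤ d) : circ (arc c d) ≤ d - c := by
  rw [circ_arc_eq]
  refine ENNReal.toReal_le_of_le_ofReal (by linarith) ?_
  -- Translating the part with integer `m` back by `m` yields disjoint pieces of `[c, d]`, one for
  -- each unit interval.
  have h1 : {t : ℝ | ∃ m : ℤ, c ≤ t + m ∧ t + m ≤ d} ∩ Set.Ioc 0 1 =
      ⋃ m : ℤ, (fun t : ℝ => t + m) ⁻¹' (Set.Icc c d ∩ Set.Ioc (m : ℝ) (m + 1)) := by
    ext t
    simp only [Set.mem_inter_iff, Set.mem_ofPred_eq, Set.mem_Ioc, Set.mem_iUnion, Set.mem_preimage,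
      Set.mem_Icc]
    constructor
    · rintro ⟨⟨m, hm⟩, ht⟩
      exact ⟨m, hm, by linarith [ht.1], by linarith [ht.2]⟩
    · rintro ⟨m, hm, ht⟩
      exact ⟨⟨m, hm⟩, by linarith [ht.1], by linarith [ht.2]⟩
  rw [h1]
  refine (measure_iUnion_le _).trans ?_
  simp only [measure_preimage_add_right]
  rw [← measure_iUnion]
  · rw [← Set.inter_iUnion, iUnion_Ioc_intCast, Set.inter_univ, Real.volume_Icc]
  · intro m m' hmm'
    exact ((Set.pairwise_disjoint_Ioc_intCast ℝ) hmm').mono Set.inter_subset_right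
      Set.inter_subset_right
  · exact fun m => measurableSet_Icc.inter measurableSet_Ioc

open Classical in
/-- The indicator that `√k` lies in the bin `I_t`. -/
noncomputable def ind (L t : ℝ) (k : ℕ) : ℝ := if √(k : ℝ) ∈ bin L t then 1 else 0

lemma mem_bin_iff (L t u : ℝ) : u ∈ bin L t ↔ ∃ m : ℤ, u - 1 / L ≤ t + m ∧ t + m ≤ u + 1 / L := by
  unfold bin
  simp only [Set.mem_iUnion, Set.mem_Icc]
  constructor <;> rintro ⟨m, h1, h2⟩ <;> exact ⟨m, by linarith, by linarith⟩

lemma ind_eq_arc (L t : ℝ) (k : ℕ) : ind L t k = arc (√k - 1 / L) (√k + 1 / L) t := by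
  have h := mem_bin_iff L t √(k : ℝ)
  unfold ind arc
  by_cases h1 : √(k : ℝ) ∈ bin L t
  · rw [if_pos h1, if_pos (h.1 h1)]
  · rw [if_neg h1, if_neg fun h2 => h1 (h.2 h2)]

lemma ind_zero_or_one (L t : ℝ) (k : ℕ) : ind L t k = 0 ∨ ind L t k = 1 := by
  rw [ind_eq_arc]; exact arc_zero_or_one _ _ _

lemma ind_nonneg (L t : ℝ) (k : ℕ) : 0 ≤ ind L t k := by
  rcases ind_zero_or_one L t k with h | h <;> rw [h]; simp

lemma ind_le_one (L t : ℝ) (k : ℕ) : ind L t k ≤ 1 := by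
  rcases ind_zero_or_one L t k with h | h <;> rw [h]; simp

lemma nice_ind (L : ℝ) (k : ℕ) : Nice (fun t => ind L t k) := by
  simp only [ind_eq_arc]; exact nice_arc _ _

lemma circ_ind_le {L : ℝ} (hL : 0 < L) (k : ℕ) : circ (fun t => ind L t k) ≤ 2 / L := by
  simp only [ind_eq_arc]
  have h : 0 < 1 / L := by positivity
  refine (circ_arc_le (by linarith)).trans_eq ?_
  ring

/-- The bin has length `2 / L` but may wrap around the unit interval. Depending on whether the
fractional part of `√k` is below or above `1 / 2`, the right or the left half of the arc fits
without wrapping. -/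
lemma le_circ_ind {L : ℝ} (hL : 2 ≤ L) (k : ℕ) : 1 / L ≤ circ (fun t => ind L t k) := by
  simp only [ind_eq_arc]
  set u := √(k : ℝ)
  have hf0 := Int.fract_nonneg u
  have hf1 := Int.fract_lt_one u
  have hfu : Int.fract u = u - ⌊u⌋ := rfl
  have hL' : 1 / L ≤ 1 / 2 := one_div_le_one_div_of_le (by norm_num) hL
  have hL0 : 0 < 1 / L := by positivity
  have key : ∀ x y : ℝ, 0 ≤ x → y ≤ 1 → y - x = 1 / L → Int.fract u - 1 / L ≤ x →
      y ≤ Int.fract u + 1 / L → 1 / L ≤ circ (arc (u - 1 / L) (u + 1 / L)) := by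
    intro x y hx hy hxy h1 h2
    rw [circ_arc_eq]
    have hsub : Set.Ioc x y ⊆
        {t : ℝ | ∃ m : ℤ, u - 1 / L ≤ t + m ∧ t + m ≤ u + 1 / L} ∩ Set.Ioc 0 1 := by
      intro t ht
      exact ⟨⟨⌊u⌋, by linarith [ht.1], by linarith [ht.2]⟩, by linarith [ht.1], by linarith [ht.2]⟩
    have h3 := measureReal_mono (μ := volume) hsub
      (ne_top_of_le_ne_top (by simp) (measure_mono Set.inter_subset_right))
    rw [Real.volume_real_Ioc_of_le (by linarith), hxy] at h3
    exact h3
  by_cases h : Int.fract u ≤ 1 / 2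
  · exact key (Int.fract u) (Int.fract u + 1 / L) hf0 (by linarith) (by ring) (by linarith) le_rfl
  · exact key (Int.fract u - 1 / L) (Int.fract u) (by linarith) hf1.le (by ring) le_rfl
      (by linarith)

/-- The two arcs differ only between corresponding end points, and both gaps have length `|√j -
√k|`. -/
lemma circ_abs_ind_sub_le (L : ℝ) (j k : ℕ) :
    circ (fun t => |ind L t j - ind L t k|) ≤ 2 * |√(j : ℝ) - √(k : ℝ)| := by
  wlog h : √(j : ℝ) ≤ √(k : ℝ) generalizing j k
  · have := this k j (not_le.1 h).le
    simp only [abs_sub_comm (ind L _ k), abs_sub_comm √(k : ℝ)] at this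
    exact this
  set u := √(j : ℝ)
  set v := √(k : ℝ)
  have hpt : ∀ t, |ind L t j - ind L t k| ≤
      arc (u - 1 / L) (v - 1 / L) t + arc (u + 1 / L) (v + 1 / L) t := by
    intro t
    simp only [ind_eq_arc]
    by_cases h1 : ∃ m : ℤ, u - 1 / L ≤ t + m ∧ t + m ≤ u + 1 / L <;>
    by_cases h2 : ∃ m : ℤ, v - 1 / L ≤ t + m ∧ t + m ≤ v + 1 / L
    all_goals
      have e1 := arc_zero_or_one (u - 1 / L) (v - 1 / L) t
      have e2 := arc_zero_or_one (u + 1 / L) (v + 1 / L) t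
    · have : |arc (u - 1 / L) (u + 1 / L) t - arc (v - 1 / L) (v + 1 / L) t| = 0 := by
        simp only [arc, if_pos h1, if_pos h2]; simp
      change |arc (u - 1 / L) (u + 1 / L) t - arc (v - 1 / L) (v + 1 / L) t| ≤ _
      rw [this]
      rcases e1 with e1 | e1 <;> rcases e2 with e2 | e2 <;> rw [e1, e2] <;> norm_num
    · obtain ⟨m, hm⟩ := h1
      have h3 : arc (u - 1 / L) (v - 1 / L) t = 1 := by
        unfold arc
        refine if_pos ⟨m, hm.1, ?_⟩
        by_contra hc
        exact h2 ⟨m, by linarith, by linarith⟩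
      have : |arc (u - 1 / L) (u + 1 / L) t - arc (v - 1 / L) (v + 1 / L) t| = 1 := by
        simp only [arc, if_pos (⟨m, hm⟩ : ∃ m : ℤ, u - 1 / L ≤ t + m ∧ t + m ≤ u + 1 / L),
          if_neg h2]; simp
      change |arc (u - 1 / L) (u + 1 / L) t - arc (v - 1 / L) (v + 1 / L) t| ≤ _
      rw [this, h3]
      rcases e2 with e2 | e2 <;> rw [e2] <;> norm_num
    · obtain ⟨m, hm⟩ := h2
      have h3 : arc (u + 1 / L) (v + 1 / L) t = 1 := by
        unfold arc
        refine if_pos ⟨m, ?_, hm.2⟩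
        by_contra hc
        exact h1 ⟨m, by linarith, by linarith⟩
      have : |arc (u - 1 / L) (u + 1 / L) t - arc (v - 1 / L) (v + 1 / L) t| = 1 := by
        simp only [arc, if_pos (⟨m, hm⟩ : ∃ m : ℤ, v - 1 / L ≤ t + m ∧ t + m ≤ v + 1 / L),
          if_neg h1]; simp
      change |arc (u - 1 / L) (u + 1 / L) t - arc (v - 1 / L) (v + 1 / L) t| ≤ _
      rw [this, h3]
      rcases e1 with e1 | e1 <;> rw [e1] <;> norm_num
    · have : |arc (u - 1 / L) (u + 1 / L) t - arc (v - 1 / L) (v + 1 / L) t| = 0 := by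
        simp only [arc, if_neg h1, if_neg h2]; simp
      change |arc (u - 1 / L) (u + 1 / L) t - arc (v - 1 / L) (v + 1 / L) t| ≤ _
      rw [this]
      rcases e1 with e1 | e1 <;> rcases e2 with e2 | e2 <;> rw [e1, e2] <;> norm_num
  refine (circ_mono ((nice_ind L j).sub (nice_ind L k)).abs
    ((nice_arc _ _).add (nice_arc _ _)) hpt).trans ?_
  rw [circ_add (nice_arc _ _) (nice_arc _ _)]
  have h1 := circ_arc_le (c := u - 1 / L) (d := v - 1 / L) (by linarith)
  have h2 := circ_arc_le (c := u + 1 / L) (d := v + 1 / L) (by linarith)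
  rw [abs_sub_comm, abs_of_nonneg (by linarith : 0 ≤ v - u)]
  linarith

/-! ### Degrees in a bin -/

lemma card_le_of_sub_le {s : Finset ℕ} {w : ℝ} (hw : 0 ≤ w)
    (h : ∀ x ∈ s, ∀ y ∈ s, (x : ℝ) - y ≤ w) : (s.card : ℝ) ≤ w + 1 := by
  rcases s.eq_empty_or_nonempty with rfl | hs
  · simp; linarith
  · have hsub : s ⊆ Finset.Icc (s.min' hs) (s.min' hs + ⌊w⌋₊) := by
      intro x hx
      rw [Finset.mem_Icc]
      refine ⟨s.min'_le x hx, ?_⟩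
      have h1 := h x hx _ (s.min'_mem hs)
      have h2 := s.min'_le x hx
      have : x - s.min' hs ≤ ⌊w⌋₊ := Nat.le_floor (by push_cast [Nat.cast_sub h2]; exact h1)
      omega
    have h1 := Finset.card_le_card hsub
    rw [Nat.card_Icc] at h1
    have h2 : (s.card : ℝ) ≤ (⌊w⌋₊ : ℝ) + 1 := by
      have : s.card ≤ ⌊w⌋₊ + 1 := by omega
      exact_mod_cast this
    linarith [Nat.floor_le hw]

open Classical in
/-- The bin indicator restricted to degrees of order `D`. -/
noncomputable def tind (L D t : ℝ) (k : ℕ) : ℝ := if D / 16 ≤ k ∧ k ≤ 6 * D then ind L t k else 0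

lemma tind_zero_or_one (L D t : ℝ) (k : ℕ) : tind L D t k = 0 ∨ tind L D t k = 1 := by
  unfold tind; split_ifs
  · exact ind_zero_or_one L t k
  · simp

lemma nice_tind (L D : ℝ) (k : ℕ) : Nice (fun t => tind L D t k) := by
  unfold tind
  split_ifs
  · exact nice_ind L k
  · exact nice_const 0

/-- For degrees of order `D` the square root moves by at most `1 / 4` over a window of length `√D /
8`, too little to pass from one translate of the arc to the next. Within one translate the roots
differ by at most `2 / L`, hence the degrees by at most `10 * √D / L`. -/
lemma tind_window_le {L D t : ℝ} (hL : 4 ≤ L) (hD : L ^ 2 ≤ D) (k N : ℕ)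
    (hN : (N : ℝ) ≤ √D / 8) : ∑ r ∈ Finset.range N, tind L D t (k + r) ≤ 11 * √D / L := by
  classical
  have hLs : L ≤ √D := Real.le_sqrt_of_sq_le hD
  have hD0 : 0 < √D := by linarith
  have hDD : √D * √D = D := Real.mul_self_sqrt (by nlinarith)
  set s := (Finset.range N).filter fun r => tind L D t (k + r) = 1 with hs
  have h1 : ∑ r ∈ Finset.range N, tind L D t (k + r) = s.card := by
    rw [hs, Finset.card_filter]
    push_cast
    refine Finset.sum_congr rfl fun r _ => ?_
    rcases tind_zero_or_one L D t (k + r) with h | h <;> rw [h] <;> simp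
  rw [h1]
  have hmem : ∀ r ∈ s, r < N ∧ √D / 4 ≤ √((k + r : ℕ) : ℝ) ∧ √((k + r : ℕ) : ℝ) ≤ 5 / 2 * √D ∧
      ∃ m : ℤ, √((k + r : ℕ) : ℝ) - 1 / L ≤ t + m ∧ t + m ≤ √((k + r : ℕ) : ℝ) + 1 / L := by
    intro r hr
    obtain ⟨hrN, hr1⟩ := Finset.mem_filter.1 hr
    unfold tind at hr1
    split_ifs at hr1 with h
    · refine ⟨Finset.mem_range.1 hrN, ?_, ?_, ?_⟩
      · exact Real.le_sqrt_of_sq_le (by nlinarith [h.1])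
      · rw [Real.sqrt_le_left (by positivity)]; nlinarith [h.2]
      · rw [← mem_bin_iff]
        unfold ind at hr1
        by_contra hc
        rw [if_neg hc] at hr1
        norm_num at hr1
    · norm_num at hr1
  refine (card_le_of_sub_le (w := 10 * √D / L) (by positivity) ?_).trans ?_
  · intro x hx y hy
    obtain ⟨hxN, hx1, hx2, m, hm⟩ := hmem x hx
    obtain ⟨hyN, hy1, hy2, m', hm'⟩ := hmem y hy
    set u := √((k + x : ℕ) : ℝ) with hu
    set v := √((k + y : ℕ) : ℝ) with hv
    have huu : u * u = k + x := by rw [hu, Real.mul_self_sqrt (Nat.cast_nonneg _)]; push_cast; rfl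
    have hvv : v * v = k + y := by rw [hv, Real.mul_self_sqrt (Nat.cast_nonneg _)]; push_cast; rfl
    have hxN' : (x : ℝ) ≤ N := by exact_mod_cast hxN.le
    have hyN' : (y : ℝ) ≤ N := by exact_mod_cast hyN.le
    have hx0 : (0 : ℝ) ≤ x := Nat.cast_nonneg _
    have hy0 : (0 : ℝ) ≤ y := Nat.cast_nonneg _
    have hprod : (u - v) * (u + v) = x - y := by nlinarith
    have huv1 : u - v ≤ 1 / 4 := by
      by_contra hc
      push Not at hc
      nlinarith
    have huv2 : v - u ≤ 1 / 4 := by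
      by_contra hc
      push Not at hc
      nlinarith
    have hL1 : 1 / L ≤ 1 / 4 := one_div_le_one_div_of_le (by norm_num) hL
    -- The roots differ by at most `1 / 4` and each lies within `1 / 4` of `t + m` or `t + m'`, so
    -- the integers are less than 1 apart.
    have hmm : m = m' := by
      have a1 : (m : ℝ) - m' < 1 := by linarith
      have a2 : (m' : ℝ) - m < 1 := by linarith
      have a1' : m - m' < 1 := by exact_mod_cast a1
      have a2' : m' - m < 1 := by exact_mod_cast a2
      omega
    subst hmm
    have hd : u - v ≤ 2 / L := by
      have : 2 / L = 1 / L + 1 / L := by ring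
      linarith
    rw [← hprod]
    calc (u - v) * (u + v) ≤ (2 / L) * (u + v) := by gcongr
      _ ≤ (2 / L) * (5 * √D) := by gcongr; linarith
      _ = 10 * √D / L := by ring
  · have : 1 ≤ √D / L := by rw [le_div_iff₀ (by linarith)]; linarith
    have e : 11 * √D / L = 10 * √D / L + √D / L := by ring
    linarith

/-- A degree with a spread-out random part hits the bin with probability of the order of its share
`1 / L` of the circle. The count has standard deviation of order `√D`, the scale on which the square
root moves by a constant, so windows of length about `√D / 8` suffice. -/
theorem ex_tind_le {ι : Type*} [Fintype ι] [DecidableEq ι] {q : ι → ℝ} (hq : BitAvg.IsProb q)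
    (T : Finset ι) {a L D : ℝ} (ha : 0 < a) (ha' : a ≤ 1 / 2) (hqa : ∀ e ∈ T, a ≤ 1 - q e)
    (hμ : D / 8 ≤ ∑ e ∈ T, q e) (hL : 8 ≤ L) (hD : L ^ 2 ≤ D) (t : ℝ) (x : ℕ) :
    BitAvg.ex q (fun y => tind L D t (x + BitAvg.cnt T y)) ≤ 200 / (a * L) := by
  have hLs : L ≤ √D := Real.le_sqrt_of_sq_le hD
  have hDD : √D * √D = D := Real.mul_self_sqrt (by nlinarith)
  have hμ0 : 0 < ∑ e ∈ T, q e := by nlinarith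
  set N := ⌊√D / 8⌋₊ with hN
  have hN1 : (N : ℝ) ≤ √D / 8 := Nat.floor_le (by positivity)
  have hN2 : √D / 8 < N + 1 := Nat.lt_floor_add_one _
  have hN3 : 1 ≤ N := Nat.le_floor (by push_cast; linarith)
  have hN4 : (1 : ℝ) ≤ N := by exact_mod_cast hN3
  have hN5 : √D / 16 ≤ N := by linarith
  have hsμ : √D / 3 ≤ √(∑ e ∈ T, q e) := Real.le_sqrt_of_sq_le (by nlinarith)
  have h := BitAvg.ex_window_le hq T ha hqa hμ0 (fun k => tind L D t (x + k))
    (fun k => by rcases tind_zero_or_one L D t (x + k) with h | h <;> rw [h]; simp) hN3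
    (B := 11 * √D / L) (fun k => by
      simpa only [add_assoc] using tind_window_le (by linarith : 4 ≤ L) hD (x + k) N hN1)
  refine h.trans ?_
  have hD0 : 0 < √D := by linarith
  calc 11 * √D / L / N + 3 * (11 * √D / L) / (a * √(∑ e ∈ T, q e))
      ≤ 11 * √D / L / (√D / 16) + 3 * (11 * √D / L) / (a * (√D / 3)) := by gcongr
    _ = (176 * a + 99) / (a * L) := by field_simp; ring
    _ ≤ 200 / (a * L) := by gcongr; linarith

end DegreeProfile

/-! ### Edge sets, degrees and the passage to the second graph. -/

namespace DegreeProfile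

open BitAvg

variable {n : ℕ}

/-- The adjacency matrix of the graph whose edges are the ones of `z`. -/
def adj (z : Sym2 (Fin n) → Bool) : Matrix (Fin n) (Fin n) ℕ :=
  Matrix.of fun i j => if i ≠ j ∧ z s(i, j) = true then 1 else 0

/-- Switch the edges in `d`. -/
def switch (d z : Sym2 (Fin n) → Bool) : Sym2 (Fin n) → Bool := fun e => xor (z e) (d e)

/-- The edges at `j`, except the one to `i`. -/
def star (i j : Fin n) : Finset (Sym2 (Fin n)) :=
  (Finset.univ.filter fun l => l ≠ i ∧ l ≠ j).image fun l => s(j, l)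

/-- The edges at `j` across the partition `side` on which the two graphs agree, except the one
to `i`. -/
def cross (d : Sym2 (Fin n) → Bool) (side : Fin n → Bool) (i j : Fin n) : Finset (Sym2 (Fin n)) :=
  (Finset.univ.filter fun l => side l ≠ side j ∧ l ≠ i ∧ d s(j, l) = false).image fun l => s(j, l)

/-- The vertices other than `i` on the side `b`. -/
def part (side : Fin n → Bool) (b : Bool) (i : Fin n) : Finset (Fin n) :=
  Finset.univ.filter fun j => side j = b ∧ j ≠ i

/-- The edges in `cross` at the vertices in `part`. -/
def layer (d : Sym2 (Fin n) → Bool) (side : Fin n → Bool) (b : Bool) (i : Fin n) :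
    Finset (Sym2 (Fin n)) := (part side b i).biUnion (cross d side i)

/-- The edges not at `i` on which the two graphs differ. -/
def signs (d : Sym2 (Fin n) → Bool) (i : Fin n) : Finset (Sym2 (Fin n)) :=
  Finset.univ.filter fun e => d e = true ∧ i ∉ e ∧ ¬ e.IsDiag

/-- The edges at `i`. -/
def row (i : Fin n) : Finset (Sym2 (Fin n)) := (Finset.univ.erase i).image fun j => s(i, j)

/-- The number of edges at `j` on which the two graphs differ. -/
def diffDeg (d : Sym2 (Fin n) → Bool) (j : Fin n) : ℝ :=
  (((Finset.univ.erase j).filter fun l => d s(j, l) = true).card : ℝ)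

lemma diffDeg_nonneg (d : Sym2 (Fin n) → Bool) (j : Fin n) : 0 ≤ diffDeg d j := Nat.cast_nonneg _

lemma sym2_mk_injective (j : Fin n) : Function.Injective fun l => s(j, l) :=
  fun _ _ h => Sym2.congr_right.1 h

lemma mem_star {i j : Fin n} {e : Sym2 (Fin n)} :
    e ∈ star i j ↔ ∃ l, (l ≠ i ∧ l ≠ j) ∧ s(j, l) = e := by simp [star]

lemma mem_cross {d : Sym2 (Fin n) → Bool} {side : Fin n → Bool} {i j : Fin n}
    {e : Sym2 (Fin n)} : e ∈ cross d side i j ↔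
      ∃ l, (side l ≠ side j ∧ l ≠ i ∧ d s(j, l) = false) ∧ s(j, l) = e := by simp [cross]

lemma mem_row {i : Fin n} {e : Sym2 (Fin n)} : e ∈ row i ↔ ∃ j, j ≠ i ∧ s(i, j) = e := by
  simp [row]

lemma cross_subset_star (d : Sym2 (Fin n) → Bool) (side : Fin n → Bool) (i j : Fin n) :
    cross d side i j ⊆ star i j := by
  intro e he
  obtain ⟨l, ⟨h1, h2, -⟩, rfl⟩ := mem_cross.1 he
  exact mem_star.2 ⟨l, ⟨h2, fun h => h1 (h ▸ rfl)⟩, rfl⟩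

/-- A common edge would join `j` to `j'`, but these lie on the same side and the edge would have to
cross. This is the reason for introducing the cut: it decouples the degrees of vertices on one side.
-/
lemma disjoint_star_cross (d : Sym2 (Fin n) → Bool) {side : Fin n → Bool} (i : Fin n)
    {j j' : Fin n} (hs : side j = side j') (hj : j' ≠ j) :
    Disjoint (star i j') (cross d side i j) := by
  rw [Finset.disjoint_left]
  intro e he he'
  obtain ⟨l, -, rfl⟩ := mem_star.1 he
  obtain ⟨l', ⟨h, -⟩, he'⟩ := mem_cross.1 he'
  rcases Sym2.eq_iff.1 he' with ⟨h1, -⟩ | ⟨-, h2⟩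
  · exact hj h1.symm
  · exact h (by rw [h2, hs])

lemma pairwiseDisjoint_cross (d : Sym2 (Fin n) → Bool) (side : Fin n → Bool) (b : Bool)
    (i : Fin n) : ((part side b i : Finset (Fin n)) : Set (Fin n)).PairwiseDisjoint
      (cross d side i) := by
  intro j hj j' hj' hne
  have h1 := (Finset.mem_filter.1 hj).2.1
  have h2 := (Finset.mem_filter.1 hj').2.1
  exact (disjoint_star_cross d i (h2.trans h1.symm) hne).mono_left (cross_subset_star d side i j)

lemma mem_part {side : Fin n → Bool} {b : Bool} {i j : Fin n} :
    j ∈ part side b i ↔ side j = b ∧ j ≠ i := by simp [part]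

lemma cross_subset_layer (d : Sym2 (Fin n) → Bool) {side : Fin n → Bool} {b : Bool} {i j : Fin n}
    (hj : j ∈ part side b i) : cross d side i j ⊆ layer d side b i :=
  Finset.subset_biUnion_of_mem (cross d side i) hj

lemma disjoint_inner_layer (d : Sym2 (Fin n) → Bool) {side : Fin n → Bool} {b : Bool}
    {i j : Fin n} (hj : j ∈ part side b i) :
    Disjoint (star i j \ cross d side i j) (layer d side b i) := by
  unfold layer
  rw [Finset.disjoint_biUnion_right]
  intro k hk
  by_cases h : j = k
  · subst h; exact Finset.sdiff_disjoint
  · exact (disjoint_star_cross d i ((mem_part.1 hk).1.trans (mem_part.1 hj).1.symm) h).mono_left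
      Finset.sdiff_subset

lemma disjoint_star_row (i j : Fin n) (hj : j ≠ i) : Disjoint (star i j) (row i) := by
  rw [Finset.disjoint_left]
  intro e he he'
  obtain ⟨l, hl, rfl⟩ := mem_star.1 he
  obtain ⟨l', h, he'⟩ := mem_row.1 he'
  rcases Sym2.eq_iff.1 he' with ⟨h1, -⟩ | ⟨h2, -⟩
  · exact hj h1.symm
  · exact hl.1 h2.symm

/-- The degree of `j` without the edge to `i`. -/
def dOff (i : Fin n) (z : Sym2 (Fin n) → Bool) (j : Fin n) : ℕ := cnt (star i j) z

lemma sum_star {M : Type*} [AddCommMonoid M] (i j : Fin n) (φ : Sym2 (Fin n) → M) :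
    ∑ e ∈ star i j, φ e = ∑ l with l ≠ i ∧ l ≠ j, φ s(j, l) := by
  unfold star
  rw [Finset.sum_image fun _ _ _ _ h => sym2_mk_injective j h]

lemma sum_cross {M : Type*} [AddCommMonoid M] (d : Sym2 (Fin n) → Bool) (side : Fin n → Bool)
    (i j : Fin n) (φ : Sym2 (Fin n) → M) : ∑ e ∈ cross d side i j, φ e =
      ∑ l with side l ≠ side j ∧ l ≠ i ∧ d s(j, l) = false, φ s(j, l) := by
  unfold cross
  rw [Finset.sum_image fun _ _ _ _ h => sym2_mk_injective j h]

lemma sum_row {M : Type*} [AddCommMonoid M] (i : Fin n) (φ : Sym2 (Fin n) → M) :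
    ∑ e ∈ row i, φ e = ∑ j ∈ Finset.univ.erase i, φ s(i, j) := by
  unfold row
  rw [Finset.sum_image fun _ _ _ _ h => sym2_mk_injective i h]

lemma deg_adj (z : Sym2 (Fin n) → Bool) {i j : Fin n} (hij : i ≠ j) :
    deg (adj z) j = dOff i z j + if z s(i, j) then 1 else 0 := by
  unfold deg dOff cnt adj
  rw [sum_star, ← Finset.sum_erase_add _ _ (Finset.mem_univ i), Finset.sum_filter]
  congr 1
  · rw [← Finset.sum_erase_add _ _ (Finset.mem_univ i)]
    simp only [ne_eq, not_true_eq_false, false_and, if_false, add_zero]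
    refine Finset.sum_congr rfl fun l hl => ?_
    have hl' := Finset.ne_of_mem_erase hl
    by_cases h : l = j
    · subst h; simp
    · simp [hl', h, Ne.symm h]
  · simp [hij.symm, Sym2.eq_swap (a := i)]

lemma cnt_union_sdiff {T R : Finset (Sym2 (Fin n))} (h : R ⊆ T) (z : Sym2 (Fin n) → Bool) :
    cnt T z = cnt (T \ R) z + cnt R z := (Finset.sum_sdiff h).symm

lemma cnt_piecewise_of_disjoint {T S : Finset (Sym2 (Fin n))} (h : Disjoint T S)
    (y z : Sym2 (Fin n) → Bool) : cnt T (S.piecewise y z) = cnt T z :=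
  cnt_congr fun e he => by simp [Finset.disjoint_left.1 h he]

lemma cnt_piecewise_of_subset {T S : Finset (Sym2 (Fin n))} (h : T ⊆ S)
    (y z : Sym2 (Fin n) → Bool) : cnt T (S.piecewise y z) = cnt T y :=
  cnt_congr fun e he => by simp [h he]

lemma switch_piecewise (d : Sym2 (Fin n) → Bool) (S : Finset (Sym2 (Fin n)))
    (y z : Sym2 (Fin n) → Bool) :
    switch d (S.piecewise y z) = S.piecewise (switch d y) (switch d z) := by
  ext e; by_cases h : e ∈ S <;> simp [switch, h]

/-- `cross` avoids the differing edges, so resampling it moves the degree of `j` by the same amount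
in both graphs. -/
lemma cnt_cross_switch (d : Sym2 (Fin n) → Bool) (side : Fin n → Bool) (i j : Fin n)
    (y : Sym2 (Fin n) → Bool) :
    cnt (cross d side i j) (switch d y) = cnt (cross d side i j) y :=
  cnt_congr fun e he => by
    obtain ⟨l, h, rfl⟩ := mem_cross.1 he
    simp [switch, h.2.2]

/-- The degree of `j` without the edges to `i` and in `cross`. -/
def inner (d : Sym2 (Fin n) → Bool) (side : Fin n → Bool) (i : Fin n)
    (z : Sym2 (Fin n) → Bool) (j : Fin n) : ℕ := cnt (star i j \ cross d side i j) z

lemma dOff_eq (d : Sym2 (Fin n) → Bool) (side : Fin n → Bool) (i : Fin n)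
    (z : Sym2 (Fin n) → Bool) (j : Fin n) :
    dOff i z j = inner d side i z j + cnt (cross d side i j) z :=
  cnt_union_sdiff (cross_subset_star d side i j) z

/-- The layer meets the edges at `j` only in the block of `j` itself. With the other bits frozen,
the degrees on one side are therefore constants plus independent counts. -/
lemma dOff_layer {d : Sym2 (Fin n) → Bool} {side : Fin n → Bool} {b : Bool} {i j : Fin n}
    (hj : j ∈ part side b i) (y z : Sym2 (Fin n) → Bool) :
    dOff i ((layer d side b i).piecewise y z) j =
      inner d side i z j + cnt (cross d side i j) y := by
  rw [dOff_eq d side, inner, cnt_piecewise_of_disjoint (disjoint_inner_layer d hj),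
    cnt_piecewise_of_subset (cross_subset_layer d hj)]
  rfl

lemma dOff_switch_layer {d : Sym2 (Fin n) → Bool} {side : Fin n → Bool} {b : Bool} {i j : Fin n}
    (hj : j ∈ part side b i) (y z : Sym2 (Fin n) → Bool) :
    dOff i (switch d ((layer d side b i).piecewise y z)) j =
      inner d side i (switch d z) j + cnt (cross d side i j) y := by
  rw [switch_piecewise, dOff_layer hj, cnt_cross_switch]

lemma dOff_row {i j : Fin n} (hj : j ≠ i) (y z : Sym2 (Fin n) → Bool) :
    dOff i ((row i).piecewise y z) j = dOff i z j :=
  cnt_piecewise_of_disjoint (disjoint_star_row i j hj) y z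

lemma switch_update (d z : Sym2 (Fin n) → Bool) (e : Sym2 (Fin n)) (b : Bool) :
    switch d (Function.update z e b) = Function.update (switch d z) e (xor b (d e)) := by
  ext e'
  by_cases h : e' = e
  · subst h; simp [switch]
  · simp [switch, h]

lemma cnt_update_of_notMem {T : Finset (Sym2 (Fin n))} {e : Sym2 (Fin n)} (he : e ∉ T)
    (y : Sym2 (Fin n) → Bool) (b : Bool) : cnt T (Function.update y e b) = cnt T y :=
  cnt_congr fun e' he' => Function.update_of_ne (fun h => he (by rw [← h]; exact he')) _ _

lemma mem_of_mem_star {i j : Fin n} {e : Sym2 (Fin n)} (he : e ∈ star i j) : j ∈ e := by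
  obtain ⟨l, -, rfl⟩ := mem_star.1 he
  simp

/-- If a function of the number of edges in `T` at `j` varies slowly, then it varies slowly with
any single edge. -/
lemma abs_sub_le_of_cnt {T : Finset (Sym2 (Fin n))} {j : Fin n} (hT : ∀ e ∈ T, j ∈ e) {B : ℝ}
    (hB : 0 ≤ B) (φ : ℕ → ℝ) (hφ : ∀ k, |φ (k + 1) - φ k| ≤ B) (z : Sym2 (Fin n) → Bool)
    (e : Sym2 (Fin n)) (b b' : Bool) :
    |φ (cnt T (Function.update z e b)) - φ (cnt T (Function.update z e b'))| ≤
      if j ∈ e then B else 0 := by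
  by_cases he : e ∈ T
  · rw [if_pos (hT e he), cnt_update_of_mem he, cnt_update_of_mem he]
    cases b <;> cases b'
    · simpa using hB
    · simpa [abs_sub_comm] using hφ (cnt (T.erase e) z)
    · simpa using hφ (cnt (T.erase e) z)
    · simpa using hB
  · rw [cnt_update_of_notMem he, cnt_update_of_notMem he, sub_self, abs_zero]
    split_ifs <;> simp [hB]

lemma card_signs_filter_le (d : Sym2 (Fin n) → Bool) (i j : Fin n) :
    (((signs d i).filter fun e => j ∈ e).card : ℝ) ≤ diffDeg d j := by
  unfold diffDeg
  have hsub : (signs d i).filter (fun e => j ∈ e) ⊆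
      ((Finset.univ.erase j).filter fun l => d s(j, l) = true).image fun l => s(j, l) := by
    intro e he
    obtain ⟨he1, he2⟩ := Finset.mem_filter.1 he
    obtain ⟨-, h1, -, h3⟩ := Finset.mem_filter.1 he1
    obtain ⟨l, rfl⟩ := he2
    refine Finset.mem_image.2 ⟨l, ?_, rfl⟩
    simp only [Finset.mem_filter, Finset.mem_erase, Finset.mem_univ, and_true]
    exact ⟨fun h => h3 (by simp [h]), h1⟩
  exact_mod_cast (Finset.card_le_card hsub).trans Finset.card_image_le

lemma card_filter_mem_le (W : Finset (Fin n)) (e : Sym2 (Fin n)) :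
    (W.filter fun j => j ∈ e).card ≤ 2 := by
  induction e using Sym2.ind with
  | _ x y =>
    refine (Finset.card_le_card (t := {x, y}) fun j hj => ?_).trans Finset.card_le_two
    simpa using (Finset.mem_filter.1 hj).2

/-- An edge has at most two end points in `W`, so Cauchy–Schwarz costs a factor 2; then the edges
are counted at each vertex. -/
lemma sum_signs_sq_le (d : Sym2 (Fin n) → Bool) (i : Fin n) (W : Finset (Fin n)) (w : Fin n → ℝ) :
    ∑ e ∈ signs d i, (∑ j ∈ W, if j ∈ e then w j else 0) ^ 2 ≤
      2 * ∑ j ∈ W, w j ^ 2 * diffDeg d j := by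
  calc ∑ e ∈ signs d i, (∑ j ∈ W, if j ∈ e then w j else 0) ^ 2
      ≤ ∑ e ∈ signs d i, 2 * ∑ j ∈ W, if j ∈ e then w j ^ 2 else 0 := by
        refine Finset.sum_le_sum fun e _ => ?_
        rw [← Finset.sum_filter, ← Finset.sum_filter]
        refine sq_sum_le_card_mul_sum_sq.trans ?_
        refine mul_le_mul_of_nonneg_right ?_ (Finset.sum_nonneg fun j _ => sq_nonneg _)
        exact_mod_cast card_filter_mem_le W e
    _ = 2 * ∑ j ∈ W, w j ^ 2 * (((signs d i).filter fun e => j ∈ e).card : ℝ) := by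
        rw [← Finset.mul_sum, Finset.sum_comm]
        congr 1
        refine Finset.sum_congr rfl fun j _ => ?_
        rw [← Finset.sum_filter, Finset.sum_const, nsmul_eq_mul, mul_comm]
    _ ≤ _ := by
        gcongr with j
        exact card_signs_filter_le d i j

lemma sum_mem_le (W : Finset (Fin n)) (w : Fin n → ℝ) {B : ℝ} (hw : ∀ j ∈ W, w j ≤ B)
    (hB : 0 ≤ B) (e : Sym2 (Fin n)) : (∑ j ∈ W, if j ∈ e then w j else 0) ≤ 2 * B := by
  rw [← Finset.sum_filter]
  refine (Finset.sum_le_card_nsmul _ _ B fun j hj => hw j (Finset.mem_filter.1 hj).1).trans ?_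
  rw [nsmul_eq_mul]
  refine mul_le_mul_of_nonneg_right ?_ hB
  exact_mod_cast card_filter_mem_le W e

end DegreeProfile

namespace BitAvg

variable {ι : Type*} [Fintype ι] [DecidableEq ι]

/-- Negating fair bits preserves their law. -/
lemma ex_not {q : ι → ℝ} (S : Finset ι) (hS : ∀ e ∈ S, q e = 1 / 2) (F : (ι → Bool) → ℝ) :
    ex q (fun y => F (S.piecewise (fun e => !y e) y)) = ex q F := by
  unfold ex
  refine Finset.sum_nbij' (fun y => S.piecewise (fun e => !y e) y)
    (fun y => S.piecewise (fun e => !y e) y) (by simp) (by simp) ?_ ?_ ?_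
  · intro y _; ext e; by_cases h : e ∈ S <;> simp [h]
  · intro y _; ext e; by_cases h : e ∈ S <;> simp [h]
  · intro y _
    congr 1
    unfold wt
    refine Finset.prod_congr rfl fun e _ => ?_
    by_cases h : e ∈ S
    · simp [h, hS e h]; norm_num
    · simp [h]

lemma piecewise_update {S : Finset ι} {e : ι} (he : e ∈ S) (z x : ι → Bool) (b : Bool) :
    S.piecewise (Function.update z e b) x = Function.update (S.piecewise z x) e b := by
  ext e'
  by_cases h : e' = e
  · subst h; simp [he]
  · by_cases h' : e' ∈ S <;> simp [h, h']

end BitAvg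

/-! ### Typical difference sets and the fair coins on them. -/

namespace DegreeProfile

open BitAvg

variable {n : ℕ}

/-- The relations between the constants, the logarithm `ℓ` of the number of vertices, the
parameter `L` and the minimal average degree `D₀`. -/
structure Regime (a s θ ℓ L D₀ : ℝ) : Prop where
  a_pos : 0 < a
  a_le : a ≤ 1 / 2
  s_pos : 0 < s
  s_le : s ≤ 1
  θ_pos : 0 < θ
  θ_le : θ ≤ 1
  one_le_ℓ : 1 ≤ ℓ
  le_L : 8 ≤ L
  L_large : 1728 * ℓ ≤ s ^ 2 * L
  θ_sq_small : 5184 * θ ^ 2 * L ≤ s ^ 2 * a ^ 2 * ℓ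
  θ_small : 50 * θ * L ≤ s ^ 2 * ℓ
  le_D : 16384 ≤ D₀
  L_sq_le_D : 64 * L ^ 2 ≤ D₀
  ℓ_le_D : 512 * ℓ ≤ D₀
  ℓ_sq_le_D : 64 * ℓ ^ 2 ≤ θ * D₀
  ℓ_mul_L_le_D : 576 * ℓ * L ≤ a * s * D₀
  a_le_D : 145 * 16 * L ≤ a ^ 2 * D₀
  s_small : 250000 * s ≤ a ^ 2

/-- The properties of the random graph `d` of the edges on which the two graphs differ that make
matching possible. The remaining randomness consists of independent bits with success
probabilities `q`. -/
structure Typical (q : Sym2 (Fin n) → ℝ) (d : Sym2 (Fin n) → Bool) (D : Fin n → ℝ)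
    (side : Fin n → Bool) (a θ ℓ D₀ : ℝ) : Prop where
  q_nonneg : ∀ e, 0 ≤ q e
  q_le : ∀ e, a ≤ 1 - q e
  q_half : ∀ e, d e = true → q e = 1 / 2
  le_D : ∀ i, D₀ ≤ D i
  D_le : ∀ i, D i ≤ n
  sum_q_le : ∀ i, ∑ j ∈ Finset.univ.erase i, q s(i, j) ≤ 3 * D i
  le_sum_q : ∀ i, D i / 2 ≤ ∑ j ∈ Finset.univ.erase i, q s(i, j)
  cross_le : ∀ i j, D j / 8 ≤ ∑ e ∈ cross d side i j, q e
  diff_le : ∀ i, diffDeg d i ≤ θ ^ 2 * D i / ℓ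
  sum_diff_le : ∀ i, ∑ j ∈ Finset.univ.erase i, q s(i, j) * (diffDeg d j / D j) ≤
    θ ^ 2 * D i / ℓ ^ 2

section

variable {q : Sym2 (Fin n) → ℝ} {d : Sym2 (Fin n) → Bool} {D : Fin n → ℝ} {side : Fin n → Bool}
  {a s θ ℓ L D₀ : ℝ}

lemma Typical.isProb (hT : Typical q d D side a θ ℓ D₀) (ha : 0 < a) : IsProb q :=
  fun e => ⟨hT.q_nonneg e, by linarith [hT.q_le e]⟩

lemma Typical.D_pos (hT : Typical q d D side a θ ℓ D₀) (hR : Regime a s θ ℓ L D₀) (i : Fin n) :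
    0 < D i := by linarith [hT.le_D i, hR.le_D]

lemma Typical.one_le_sqrt (hT : Typical q d D side a θ ℓ D₀) (hR : Regime a s θ ℓ L D₀)
    (i : Fin n) : 1 ≤ √(D i) := Real.one_le_sqrt.2 (by linarith [hT.le_D i, hR.le_D])

/-- A symmetry: switching the edges on which the graphs differ preserves the law of the number of
edges in a set not involving `i`. -/
lemma av_signs_switch (hT : Typical q d D side a θ ℓ D₀) {i : Fin n} {T : Finset (Sym2 (Fin n))}
    (hTS : ∀ e ∈ T, d e = true → e ∈ signs d i) (φ : ℕ → ℝ) (x : Sym2 (Fin n) → Bool) :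
    av q (signs d i) (fun z => φ (cnt T (switch d z))) x =
      av q (signs d i) (fun z => φ (cnt T z)) x := by
  unfold av
  refine Eq.trans ?_ (ex_not (q := q) (signs d i)
    (fun e he => hT.q_half e (Finset.mem_filter.1 he).2.1)
    (fun y => φ (cnt T ((signs d i).piecewise y x))))
  refine congrArg (ex q) (funext fun y => congrArg φ (cnt_congr fun e he => ?_))
  by_cases h : e ∈ signs d i
  · simp [switch, h, (Finset.mem_filter.1 h).2.1]
  · have : d e = false := by
      by_contra hc
      exact h (hTS e he (by simpa using hc))
    simp [switch, h, this]

lemma mem_signs_of_mem_star {i j : Fin n} (hj : j ≠ i) {e : Sym2 (Fin n)} (he : e ∈ star i j)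
    (hd : d e = true) : e ∈ signs d i := by
  obtain ⟨l, hl, rfl⟩ := mem_star.1 he
  unfold signs
  rw [Finset.mem_filter]
  refine ⟨Finset.mem_univ _, hd, ?_, ?_⟩
  · simp only [Sym2.mem_iff, not_or]
    exact ⟨hj.symm, hl.1.symm⟩
  · simpa using hl.2.symm

/-- The success probability `1 / 2` of a differing edge cancels the factor 2 of `sum_signs_sq_le`.
-/
lemma sum_signs_le (hT : Typical q d D side a θ ℓ D₀) (i : Fin n)
    (W : Finset (Fin n)) (w : Fin n → ℝ) :
    ∑ e ∈ signs d i, (∑ j ∈ W, if j ∈ e then w j else 0) ^ 2 * q e ≤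
      ∑ j ∈ W, w j ^ 2 * diffDeg d j := by
  have h := sum_signs_sq_le d i W w
  have h1 : ∑ e ∈ signs d i, (∑ j ∈ W, if j ∈ e then w j else 0) ^ 2 * q e =
      (∑ e ∈ signs d i, (∑ j ∈ W, if j ∈ e then w j else 0) ^ 2) * (1 / 2) := by
    rw [Finset.sum_mul]
    exact Finset.sum_congr rfl fun e he => by rw [hT.q_half e (Finset.mem_filter.1 he).2.1]
  rw [h1]; linarith

/-- Variance of a slowly varying function of the signs. -/
lemma av_signs_sq_le (hT : Typical q d D side a θ ℓ D₀) (ha : 0 < a) (i : Fin n)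
    (W : Finset (Fin n)) (w : Fin n → ℝ) (F : (Sym2 (Fin n) → Bool) → ℝ)
    (hF : ∀ z e, |F (Function.update z e true) - F (Function.update z e false)| ≤
      ∑ j ∈ W, if j ∈ e then w j else 0) (x : Sym2 (Fin n) → Bool) :
    av q (signs d i) (fun z => (F z - av q (signs d i) F x) ^ 2) x ≤
      ∑ j ∈ W, w j ^ 2 * diffDeg d j := by
  refine (av_sq_centered_le_of_bits (hT.isProb ha) (signs d i) x F
    (fun e => ∑ j ∈ W, if j ∈ e then w j else 0) fun e he z => ?_).trans (sum_signs_le hT i W w)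
  rw [piecewise_update he, piecewise_update he]
  exact hF _ e

/-- Deviations of a slowly varying function of the signs. -/
lemma pr_signs_ge_le (hT : Typical q d D side a θ ℓ D₀) (ha : 0 < a) (i : Fin n)
    (W : Finset (Fin n)) (w : Fin n → ℝ) (F : (Sym2 (Fin n) → Bool) → ℝ)
    (hF : ∀ z e, |F (Function.update z e true) - F (Function.update z e false)| ≤
      ∑ j ∈ W, if j ∈ e then w j else 0) (x : Sym2 (Fin n) → Bool) {B V u K : ℝ}
    (hB : ∀ j ∈ W, w j ≤ B) (hB0 : 0 ≤ B) (hV : ∑ j ∈ W, w j ^ 2 * diffDeg d j ≤ V) (hu : 0 < u)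
    (hK : 0 < K) (hKV : 4 * K * V ≤ u ^ 2) (hKB : 8 * K * B ≤ u) :
    pr q (signs d i) {z | av q (signs d i) F x + u ≤ F z} x ≤ Real.exp (-K) := by
  refine pr_ge_av_add_le_of_bits (hT.isProb ha) (signs d i) x F
    (fun e => ∑ j ∈ W, if j ∈ e then w j else 0) (fun e he z => ?_)
    (fun e _ => sum_mem_le W w hB hB0 e) ((sum_signs_le hT i W w).trans hV) hu hK hKV (by linarith)
  rw [piecewise_update he, piecewise_update he]
  exact hF _ e

/-- Toggling a bit toggles that edge in both graphs, whence twice the bound for one graph. -/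
lemma abs_sub_le_of_cnt_switch {T : Finset (Sym2 (Fin n))} {j : Fin n} (hT : ∀ e ∈ T, j ∈ e) {B : ℝ}
    (hB : 0 ≤ B) (φ : ℕ → ℝ) (hφ : ∀ k, |φ (k + 1) - φ k| ≤ B) (z : Sym2 (Fin n) → Bool)
    (e : Sym2 (Fin n)) :
    |(φ (cnt T (Function.update z e true)) - φ (cnt T (switch d (Function.update z e true)))) -
     (φ (cnt T (Function.update z e false)) - φ (cnt T (switch d (Function.update z e false))))| ≤
      if j ∈ e then 2 * B else 0 := by
  have h1 := abs_sub_le_of_cnt hT hB φ hφ z e true false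
  have h2 := abs_sub_le_of_cnt hT hB φ hφ (switch d z) e (xor true (d e)) (xor false (d e))
  rw [← switch_update, ← switch_update] at h2
  have e1 : ∀ p q r t : ℝ, |(p - q) - (r - t)| ≤ |p - r| + |q - t| := fun p q r t => by
    rw [show (p - q) - (r - t) = (p - r) - (q - t) by ring]; exact abs_sub _ _
  refine (e1 _ _ _ _).trans ((add_le_add h1 h2).trans_eq ?_)
  split_ifs <;> ring

/-- The weighted sum of the degree discrepancies at the neighbours of `i`. -/
noncomputable def discr (q : Sym2 (Fin n) → ℝ) (d : Sym2 (Fin n) → Bool) (D : Fin n → ℝ)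
    (i : Fin n) (z : Sym2 (Fin n) → Bool) : ℝ :=
  ∑ j ∈ Finset.univ.erase i,
    q s(i, j) * (|(dOff i z j : ℝ) - dOff i (switch d z) j| / √(D j))

lemma q_le_one (hT : Typical q d D side a θ ℓ D₀) (ha : 0 < a) (e : Sym2 (Fin n)) : q e ≤ 1 :=
  (hT.isProb ha e).2

lemma q_sq_le (hT : Typical q d D side a θ ℓ D₀) (ha : 0 < a) (e : Sym2 (Fin n)) :
    q e ^ 2 ≤ q e := by nlinarith [hT.q_nonneg e, q_le_one hT ha e]

/-- The common variance bound for `discr` (with `b = 2`) and for `drift` (with `b = 18 / a`). -/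
lemma sum_q_sq_diff_le (hT : Typical q d D side a θ ℓ D₀) (hR : Regime a s θ ℓ L D₀) (i : Fin n)
    {W : Finset (Fin n)} (hW : W ⊆ Finset.univ.erase i) (b : ℝ) :
    ∑ j ∈ W, (b * (q s(i, j) / √(D j))) ^ 2 * diffDeg d j ≤ b ^ 2 * (θ ^ 2 * D i / ℓ ^ 2) := by
  calc ∑ j ∈ W, (b * (q s(i, j) / √(D j))) ^ 2 * diffDeg d j
      ≤ ∑ j ∈ W, b ^ 2 * (q s(i, j) * (diffDeg d j / D j)) := by
        refine Finset.sum_le_sum fun j _ => ?_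
        have hD := hT.D_pos hR j
        rw [mul_pow, div_pow, Real.sq_sqrt hD.le, mul_assoc]
        refine mul_le_mul_of_nonneg_left ?_ (sq_nonneg b)
        rw [div_mul_eq_mul_div, mul_div_assoc]
        exact mul_le_mul_of_nonneg_right (q_sq_le hT hR.a_pos _)
          (div_nonneg (diffDeg_nonneg d j) hD.le)
    _ = b ^ 2 * ∑ j ∈ W, q s(i, j) * (diffDeg d j / D j) := by rw [Finset.mul_sum]
    _ ≤ b ^ 2 * ∑ j ∈ Finset.univ.erase i, q s(i, j) * (diffDeg d j / D j) := by
        refine mul_le_mul_of_nonneg_left (Finset.sum_le_sum_of_subset_of_nonneg hW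
          fun j _ _ => ?_) (sq_nonneg b)
        exact mul_nonneg (hT.q_nonneg _) (div_nonneg (diffDeg_nonneg d j) (hT.D_pos hR j).le)
    _ ≤ _ := mul_le_mul_of_nonneg_left (hT.sum_diff_le i) (sq_nonneg b)

/-- Over the fair coins the discrepancy at `j` is centred, with variance of order `diffDeg d j`,
which is small on weighted average. The mean of `discr` is at most `7 / 2` units of `θ * D i / ℓ`
(namely `2` from the variances and `3 / 2` from the balancing term), and Bernstein adds one more. -/
theorem pr_discr_le (hT : Typical q d D side a θ ℓ D₀) (hR : Regime a s θ ℓ L D₀) (i : Fin n)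
    (x : Sym2 (Fin n) → Bool) :
    pr q (signs d i) {z | 5 * θ * D i / ℓ ≤ discr q d D i z} x ≤ Real.exp (-(4 * ℓ)) := by
  have hq := hT.isProb hR.a_pos
  have hℓ : 0 < ℓ := by linarith [hR.one_le_ℓ]
  have hθ := hR.θ_pos
  have hDi := hT.D_pos hR i
  have hmean : av q (signs d i) (discr q d D i) x ≤ 7 / 2 * θ * D i / ℓ := by
    have hj : ∀ j ∈ Finset.univ.erase i,
        av q (signs d i) (fun z => |(dOff i z j : ℝ) - dOff i (switch d z) j| / √(D j)) x ≤
          2 * (ℓ / θ) * (diffDeg d j / D j) + θ / (2 * ℓ) := by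
      intro j hj
      have hji := Finset.ne_of_mem_erase hj
      have hDj := hT.D_pos hR j
      have hs0 : 0 < √(D j) := Real.sqrt_pos.2 hDj
      have hzero : av q (signs d i) (fun z => (dOff i z j : ℝ) - dOff i (switch d z) j) x = 0 := by
        have := av_signs_switch hT (fun e he hd => mem_signs_of_mem_star (d := d) hji he hd)
          (fun k => (k : ℝ)) x
        unfold av at this ⊢
        unfold dOff
        rw [ex_sub, this, sub_self]
      have hvar := av_signs_sq_le hT hR.a_pos i {j} (fun _ => 2)
        (fun z => (dOff i z j : ℝ) - dOff i (switch d z) j) (fun z e => by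
          simpa [dOff] using abs_sub_le_of_cnt_switch (d := d)
            (fun e he => mem_of_mem_star (i := i) (j := j) he) zero_le_one (fun k => (k : ℝ))
            (fun k => by simp) z e) x
      rw [hzero] at hvar
      simp only [sub_zero, Finset.sum_singleton] at hvar
      calc av q (signs d i) (fun z => |(dOff i z j : ℝ) - dOff i (switch d z) j| / √(D j)) x
          ≤ av q (signs d i) (fun z => (ℓ / (2 * θ * D j)) *
              ((dOff i z j : ℝ) - dOff i (switch d z) j) ^ 2 + θ / (2 * ℓ)) x := by
            refine av_mono hq _ _ fun y => ?_
            generalize ((dOff i ((signs d i).piecewise y x) j : ℝ) -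
              dOff i (switch d ((signs d i).piecewise y x)) j) = r
            rw [← sq_abs r]
            set ρ := |r| / √(D j) with hρ
            have h1 : |r| ^ 2 = ρ ^ 2 * D j := by
              rw [hρ, div_pow, Real.sq_sqrt hDj.le]; field_simp
            rw [h1]
            -- The weight `ℓ / θ` balances the two terms: after summation over the neighbours both
            -- are of order `θ * D i / ℓ`.
            have h2 : ℓ / (2 * θ * D j) * (ρ ^ 2 * D j) + θ / (2 * ℓ) - ρ =
                (ℓ * ρ - θ) ^ 2 / (2 * θ * ℓ) := by field_simp; ring
            have h3 : 0 ≤ (ℓ * ρ - θ) ^ 2 / (2 * θ * ℓ) := by positivity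
            linarith
        _ = (ℓ / (2 * θ * D j)) * av q (signs d i) (fun z =>
              ((dOff i z j : ℝ) - dOff i (switch d z) j) ^ 2) x + θ / (2 * ℓ) := by
            simp only [av, ex_add, ex_const_mul, ex_const]
        _ ≤ (ℓ / (2 * θ * D j)) * (2 ^ 2 * diffDeg d j) + θ / (2 * ℓ) := by gcongr
        _ = _ := by field_simp
    calc av q (signs d i) (discr q d D i) x
        = ∑ j ∈ Finset.univ.erase i, q s(i, j) * av q (signs d i)
            (fun z => |(dOff i z j : ℝ) - dOff i (switch d z) j| / √(D j)) x := by
          simp only [av, discr, ex_sum, ex_const_mul]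
      _ ≤ ∑ j ∈ Finset.univ.erase i, q s(i, j) *
            (2 * (ℓ / θ) * (diffDeg d j / D j) + θ / (2 * ℓ)) :=
          Finset.sum_le_sum fun j hj' => mul_le_mul_of_nonneg_left (hj j hj') (hT.q_nonneg _)
      _ = 2 * (ℓ / θ) * ∑ j ∈ Finset.univ.erase i, q s(i, j) * (diffDeg d j / D j) +
            θ / (2 * ℓ) * ∑ j ∈ Finset.univ.erase i, q s(i, j) := by
          rw [Finset.mul_sum, Finset.mul_sum, ← Finset.sum_add_distrib]
          exact Finset.sum_congr rfl fun j _ => by ring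
      _ ≤ 2 * (ℓ / θ) * (θ ^ 2 * D i / ℓ ^ 2) + θ / (2 * ℓ) * (3 * D i) := by
          gcongr
          · exact hT.sum_diff_le i
          · exact hT.sum_q_le i
      _ = 7 / 2 * θ * D i / ℓ := by field_simp; ring
  have hsD : ∀ j, 1 ≤ √(D j) := hT.one_le_sqrt hR
  have hLip : ∀ z e, |discr q d D i (Function.update z e true) -
      discr q d D i (Function.update z e false)| ≤
      ∑ j ∈ Finset.univ.erase i, if j ∈ e then 2 * (q s(i, j) / √(D j)) else 0 := by
    intro z e
    unfold discr
    rw [← Finset.sum_sub_distrib]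
    refine (Finset.abs_sum_le_sum_abs _ _).trans (Finset.sum_le_sum fun j _ => ?_)
    rw [← mul_sub, abs_mul, abs_of_nonneg (hT.q_nonneg _), ← sub_div, abs_div,
      abs_of_pos (by linarith [hsD j] : 0 < √(D j))]
    have h := abs_sub_le_of_cnt_switch (d := d)
      (fun e he => mem_of_mem_star (i := i) (j := j) he) zero_le_one (fun k => (k : ℝ))
      (fun k => by simp) z e
    refine (mul_le_mul_of_nonneg_left (div_le_div_of_nonneg_right
      ((abs_abs_sub_abs_le _ _).trans h) (by positivity)) (hT.q_nonneg _)).trans_eq ?_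
    split_ifs <;> ring
  have hbern := pr_signs_ge_le hT hR.a_pos i (Finset.univ.erase i)
    (fun j => 2 * (q s(i, j) / √(D j))) (discr q d D i) hLip x (B := 2)
    (V := 2 ^ 2 * (θ ^ 2 * D i / ℓ ^ 2)) (u := θ * D i / ℓ) (K := 4 * ℓ)
    (fun j _ => by
      have : q s(i, j) / √(D j) ≤ 1 := by
        rw [div_le_one (by linarith [hsD j])]
        exact (q_le_one hT hR.a_pos _).trans (hsD j)
      linarith) (by norm_num)
    (sum_q_sq_diff_le hT hR i le_rfl 2) (by positivity) (by positivity)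
    (by
      have h1 : 64 * ℓ ≤ D i := by linarith [hR.ℓ_le_D, hT.le_D i]
      rw [div_pow, mul_pow]
      have : 4 * (4 * ℓ) * (2 ^ 2 * (θ ^ 2 * D i / ℓ ^ 2)) = θ ^ 2 * (64 * ℓ * D i) / ℓ ^ 2 := by
        ring
      rw [this]
      gcongr
      nlinarith)
    (by
      rw [le_div_iff₀ hℓ]
      have := hR.ℓ_sq_le_D
      have : θ * D₀ ≤ θ * D i := by gcongr; exact hT.le_D i
      nlinarith)
  refine (pr_mono hq _ x fun y hy => ?_).trans hbern
  have hy' : 5 * θ * D i / ℓ ≤ discr q d D i ((signs d i).piecewise y x) := hy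
  have : 5 * θ * D i / ℓ = 7 / 2 * θ * D i / ℓ + θ * D i / ℓ + 1 / 2 * θ * D i / ℓ := by ring
  have h0 : 0 ≤ 1 / 2 * θ * D i / ℓ := by positivity
  change av q (signs d i) (discr q d D i) x + θ * D i / ℓ ≤ discr q d D i _
  linarith

end

end DegreeProfile

namespace DegreeProfile

open BitAvg

variable {n : ℕ}

section

variable {q : Sym2 (Fin n) → ℝ} {d : Sym2 (Fin n) → Bool} {D : Fin n → ℝ} {side : Fin n → Bool}
  {a s θ ℓ L D₀ : ℝ}

/-! ### Lower and upper tails of degrees -/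

lemma cnt_update_sub_le (T : Finset (Sym2 (Fin n))) (z : Sym2 (Fin n) → Bool) (e : Sym2 (Fin n)) :
    |(cnt T (Function.update z e true) : ℝ) - cnt T (Function.update z e false)| ≤
      if e ∈ T then 1 else 0 := by
  by_cases he : e ∈ T
  · rw [cnt_update_of_mem he, cnt_update_of_mem he]; simp [he]
  · rw [cnt_update_of_notMem he, cnt_update_of_notMem he]; simp [he]

lemma sum_ite_mem_sq {T S : Finset (Sym2 (Fin n))} (h : T ⊆ S) (q : Sym2 (Fin n) → ℝ) :
    ∑ e ∈ S, (if e ∈ T then (1 : ℝ) else 0) ^ 2 * q e = ∑ e ∈ T, q e := by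
  rw [← Finset.sum_subset h (f := fun e => (if e ∈ T then (1 : ℝ) else 0) ^ 2 * q e)]
  · exact Finset.sum_congr rfl fun e he => by simp [he]
  · intro e _ he; simp [he]

lemma av_cnt {T S : Finset (Sym2 (Fin n))} (h : T ⊆ S) (q : Sym2 (Fin n) → ℝ)
    (x : Sym2 (Fin n) → Bool) : av q S (fun z => (cnt T z : ℝ)) x = ∑ e ∈ T, q e := by
  unfold av
  simp only [cnt_piecewise_of_subset h]
  exact ex_cnt q T

lemma pr_cnt_le (hq : IsProb q) {T S : Finset (Sym2 (Fin n))} (h : T ⊆ S)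
    (hμ : 0 < ∑ e ∈ T, q e) (x : Sym2 (Fin n) → Bool) :
    pr q S {z | (cnt T z : ℝ) ≤ (∑ e ∈ T, q e) / 2} x ≤ Real.exp (-((∑ e ∈ T, q e) / 16)) := by
  have := pr_le_av_sub_le_of_bits hq S x (fun z => (cnt T z : ℝ)) (fun e => if e ∈ T then 1 else 0)
    (fun e he z => by
      rw [piecewise_update he, piecewise_update he]; exact cnt_update_sub_le T _ e)
    (cm := 1) (V := ∑ e ∈ T, q e) (u := (∑ e ∈ T, q e) / 2) (K := (∑ e ∈ T, q e) / 16)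
    (fun e _ => by split_ifs <;> norm_num) (sum_ite_mem_sq h q).le (by linarith) (by linarith)
    (by nlinarith) (by linarith)
  rw [av_cnt h] at this
  convert this using 4
  ring_nf

lemma pr_cnt_ge (hq : IsProb q) {T S : Finset (Sym2 (Fin n))} (h : T ⊆ S) {M : ℝ}
    (hM : 0 < M) (hμ : ∑ e ∈ T, q e ≤ M) (x : Sym2 (Fin n) → Bool) :
    pr q S {z | 5 / 3 * M ≤ (cnt T z : ℝ)} x ≤ Real.exp (-(M / 9)) := by
  have := pr_ge_av_add_le_of_bits hq S x (fun z => (cnt T z : ℝ)) (fun e => if e ∈ T then 1 else 0)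
    (fun e he z => by
      rw [piecewise_update he, piecewise_update he]; exact cnt_update_sub_le T _ e)
    (cm := 1) (V := M) (u := 2 / 3 * M) (K := M / 9)
    (fun e _ => by split_ifs <;> norm_num) ((sum_ite_mem_sq h q).le.trans hμ) (by linarith)
    (by linarith) (by nlinarith) (by linarith)
  rw [av_cnt h] at this
  refine (pr_mono hq _ x fun y hy => ?_).trans this
  have hy' : 5 / 3 * M ≤ (cnt T (S.piecewise y x) : ℝ) := hy
  change (∑ e ∈ T, q e) + 2 / 3 * M ≤ (cnt T (S.piecewise y x) : ℝ)
  linarith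

lemma pr_cross_le (hT : Typical q d D side a θ ℓ D₀) (hR : Regime a s θ ℓ L D₀) (i j : Fin n)
    {S : Finset (Sym2 (Fin n))} (h : cross d side i j ⊆ S) (x : Sym2 (Fin n) → Bool) :
    pr q S {z | (cnt (cross d side i j) z : ℝ) < D j / 16} x ≤ Real.exp (-(D j / 128)) := by
  have hμ := hT.cross_le i j
  have hD := hT.D_pos hR j
  have hq := hT.isProb hR.a_pos
  refine (pr_mono hq _ x fun y hy => ?_).trans
    ((pr_cnt_le hq h (by linarith) x).trans (Real.exp_le_exp.2 (by linarith)))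
  have hy' : (cnt (cross d side i j) (S.piecewise y x) : ℝ) < D j / 16 := hy
  change (cnt (cross d side i j) (S.piecewise y x) : ℝ) ≤ _
  linarith

/-! ### The threshold -/

/-- The separation scale between the distances of matched and unmatched vertices. -/
noncomputable def thr (s L Di : ℝ) : ℝ := s * √(Di / L)

lemma thr_sq (hR : Regime a s θ ℓ L D₀) {Di : ℝ} (h : 0 < Di) :
    thr s L Di ^ 2 = s ^ 2 * Di / L := by
  have : 0 < L := by linarith [hR.le_L]
  unfold thr
  rw [mul_pow, Real.sq_sqrt (by positivity)]; ring

lemma thr_pos (hR : Regime a s θ ℓ L D₀) {Di : ℝ} (h : 0 < Di) : 0 < thr s L Di := by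
  have : 0 < L := by linarith [hR.le_L]
  have := hR.s_pos
  unfold thr
  positivity

/-- A lower bound uniform in the vertex, losing only `√L ≤ L`, for comparison with maximal
influences. -/
lemma le_thr (hR : Regime a s θ ℓ L D₀) {Di : ℝ} (h : D₀ ≤ Di) : s * √D₀ / L ≤ thr s L Di := by
  have hL : 8 ≤ L := hR.le_L
  have hs := hR.s_pos
  have hD := hR.le_D
  unfold thr
  rw [mul_div_assoc]
  refine mul_le_mul_of_nonneg_left ?_ hs.le
  rw [Real.le_sqrt (by positivity) (div_nonneg (by linarith) (by linarith)), div_pow,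
    Real.sq_sqrt (by linarith), div_le_div_iff₀ (by positivity) (by linarith)]
  have h1 : L ≤ L ^ 2 := by nlinarith
  exact mul_le_mul h h1 (by linarith) (by linarith)

lemma sqrt_D₀_bounds (hR : Regime a s θ ℓ L D₀) : 128 ≤ √D₀ ∧ 8 * L ≤ √D₀ :=
  ⟨Real.le_sqrt_of_sq_le (by linarith [hR.le_D]),
    Real.le_sqrt_of_sq_le (by nlinarith [hR.L_sq_le_D])⟩

/-- The variance condition of Bernstein's inequality at deviation `thr` and exponent `4 * ℓ`. The
largest case is `108 = 3 * 6 ^ 2`: total weight `3 * Di` and influences `6 / L`. -/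
lemma sq_thr_ge (hR : Regime a s θ ℓ L D₀) {Di c : ℝ} (h : D₀ ≤ Di) (hc : c ≤ 108) :
    4 * (4 * ℓ) * (c * Di / L ^ 2) ≤ thr s L Di ^ 2 := by
  have hL : 8 ≤ L := hR.le_L
  have hDi : 0 < Di := by linarith [hR.le_D]
  have hℓ := hR.one_le_ℓ
  rw [thr_sq hR hDi]
  have : s ^ 2 * Di / L = (s ^ 2 * L) * (Di / L ^ 2) := by field_simp
  rw [this]
  have h1 : 4 * (4 * ℓ) * (c * Di / L ^ 2) = (16 * ℓ * c) * (Di / L ^ 2) := by ring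
  rw [h1]
  have h2 : 0 ≤ Di / L ^ 2 := by positivity
  refine mul_le_mul_of_nonneg_right ?_ h2
  have := hR.L_large
  nlinarith

/-- The matching condition on the largest influence `c / L`. -/
lemma thr_ge (hR : Regime a s θ ℓ L D₀) {Di c : ℝ} (h : D₀ ≤ Di) (hc : c ≤ 6) :
    4 * (4 * ℓ) * (c / L) ≤ thr s L Di := by
  refine le_trans ?_ (le_thr hR h)
  have hL : 8 ≤ L := hR.le_L
  have hℓ := hR.one_le_ℓ
  have hs := hR.s_pos
  have hD := (sqrt_D₀_bounds hR).2
  rw [← mul_div_assoc]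
  refine div_le_div_of_nonneg_right ?_ (by linarith)
  have h1 := hR.L_large
  have h2 : s ^ 2 * L ≤ s * L := by
    have : s ^ 2 ≤ s := by nlinarith [hR.s_le]
    nlinarith
  nlinarith

/-! ### The conditional mean of the signature difference -/

/-- The conditional probability that the degree of `j` falls into the bin, given that `r` edges are
present outside `cross`. -/
noncomputable def binMean (q : Sym2 (Fin n) → ℝ) (d : Sym2 (Fin n) → Bool) (side : Fin n → Bool)
    (L : ℝ) (i j : Fin n) (t : ℝ) (r : ℕ) : ℝ :=
  ex q (fun y => ind L t (r + cnt (cross d side i j) y + 1))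

/-- The signature difference of `i` in the two graphs, averaged over the edges at `i`. -/
noncomputable def mism (q : Sym2 (Fin n) → ℝ) (d : Sym2 (Fin n) → Bool) (L : ℝ)
    (W : Finset (Fin n)) (i : Fin n) (z : Sym2 (Fin n) → Bool) (t : ℝ) : ℝ :=
  ∑ j ∈ W, q s(i, j) * (ind L t (dOff i z j + 1) - ind L t (dOff i (switch d z) j + 1))

/-- The average of `mism` over the edges in `layer`. -/
noncomputable def drift (q : Sym2 (Fin n) → ℝ) (d : Sym2 (Fin n) → Bool) (side : Fin n → Bool)
    (L : ℝ) (b : Bool) (i : Fin n) (z : Sym2 (Fin n) → Bool) (t : ℝ) : ℝ :=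
  ∑ j ∈ part side b i, q s(i, j) *
    (binMean q d side L i j t (inner d side i z j) -
      binMean q d side L i j t (inner d side i (switch d z) j))

lemma nice_binMean (q : Sym2 (Fin n) → ℝ) (d : Sym2 (Fin n) → Bool) (side : Fin n → Bool)
    (L : ℝ) (i j : Fin n) (r : ℕ) : Nice (fun t => binMean q d side L i j t r) :=
  nice_ex q fun _ => nice_ind L _

lemma nice_drift (q : Sym2 (Fin n) → ℝ) (d : Sym2 (Fin n) → Bool) (side : Fin n → Bool)
    (L : ℝ) (b : Bool) (i : Fin n) (z : Sym2 (Fin n) → Bool) :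
    Nice (drift q d side L b i z) :=
  nice_sum _ fun _ _ => ((nice_binMean q d side L _ _ _).sub
    (nice_binMean q d side L _ _ _)).const_mul _

lemma nice_mism (q : Sym2 (Fin n) → ℝ) (d : Sym2 (Fin n) → Bool)
    (L : ℝ) (W : Finset (Fin n)) (i : Fin n) (z : Sym2 (Fin n) → Bool) :
    Nice (mism q d L W i z) :=
  nice_sum _ fun _ _ => ((nice_ind L _).sub (nice_ind L _)).const_mul _

lemma av_mism (q : Sym2 (Fin n) → ℝ) (d : Sym2 (Fin n) → Bool) (side : Fin n → Bool)
    (L : ℝ) (b : Bool) (i : Fin n) (x : Sym2 (Fin n) → Bool) (t : ℝ) :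
    av q (layer d side b i) (fun z => mism q d L (part side b i) i z t) x =
      drift q d side L b i x t := by
  unfold av mism drift binMean
  rw [ex_sum]
  refine Finset.sum_congr rfl fun j hj => ?_
  rw [ex_const_mul, ex_sub]
  simp only [dOff_layer hj, dOff_switch_layer hj]

/-- One more edge outside `cross` is the same as shifting the count on `cross` by one, so smoothness
of the law of that count applies; its mean is at least `D j / 8`. -/
lemma abs_binMean_succ_sub_le (hT : Typical q d D side a θ ℓ D₀) (hR : Regime a s θ ℓ L D₀)
    (i j : Fin n) (t : ℝ) (r : ℕ) :
    |binMean q d side L i j t (r + 1) - binMean q d side L i j t r| ≤ 9 / (a * √(D j)) := by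
  have ha := hR.a_pos
  have hD := hT.D_pos hR j
  have hμ := hT.cross_le i j
  have h := abs_ex_shift_le (hT.isProb ha) (cross d side i j) ha zero_le_one
    (fun e _ => hT.q_le e) (by linarith) (fun k => ind L t (r + k + 1))
    (fun k => by rw [abs_of_nonneg (ind_nonneg _ _ _)]; exact ind_le_one _ _ _)
  unfold binMean
  have h1 : ∀ k, r + 1 + k + 1 = r + (k + 1) + 1 := fun k => by ring
  simp only [h1]
  refine h.trans ?_
  have hs : √(D j) / 3 ≤ √(∑ e ∈ cross d side i j, q e) :=
    Real.le_sqrt_of_sq_le (by rw [div_pow, Real.sq_sqrt hD.le]; linarith)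
  have hs0 : 0 < √(D j) := Real.sqrt_pos.2 hD
  calc 3 * 1 / (a * √(∑ e ∈ cross d side i j, q e)) ≤ 3 * 1 / (a * (√(D j) / 3)) := by gcongr
    _ = _ := by field_simp; norm_num

lemma abs_drift_update_le (hT : Typical q d D side a θ ℓ D₀) (hR : Regime a s θ ℓ L D₀)
    (b : Bool) (i : Fin n) (t : ℝ) (z : Sym2 (Fin n) → Bool) (e : Sym2 (Fin n)) :
    |drift q d side L b i (Function.update z e true) t -
      drift q d side L b i (Function.update z e false) t| ≤
      ∑ j ∈ part side b i, if j ∈ e then (18 / a) * (q s(i, j) / √(D j)) else 0 := by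
  unfold drift
  rw [← Finset.sum_sub_distrib]
  refine (Finset.abs_sum_le_sum_abs _ _).trans (Finset.sum_le_sum fun j _ => ?_)
  rw [← mul_sub, abs_mul, abs_of_nonneg (hT.q_nonneg _)]
  have ha := hR.a_pos
  have hs0 : 0 < √(D j) := by linarith [hT.one_le_sqrt hR j]
  have h := abs_sub_le_of_cnt_switch (d := d) (T := star i j \ cross d side i j) (j := j)
    (fun e he => mem_of_mem_star (Finset.sdiff_subset he)) (B := 9 / (a * √(D j))) (by positivity)
    (binMean q d side L i j t) (abs_binMean_succ_sub_le hT hR i j t) z e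
  refine (mul_le_mul_of_nonneg_left h (hT.q_nonneg _)).trans_eq ?_
  split_ifs
  · field_simp; ring
  · ring

lemma part_subset (side : Fin n → Bool) (b : Bool) (i : Fin n) :
    part side b i ⊆ Finset.univ.erase i := fun j hj => by simpa using (mem_part.1 hj).2

/-- Switching negates the fair coins, so the inner degrees of `j` in the two graphs have the same
law and `drift` has mean zero at each `t`. Its variance is at most `τ ^ 2` because few edges differ.
Hence the mean L¹ norm is at most `τ`, and the deviation uses another `τ`. -/
theorem pr_drift_le (hT : Typical q d D side a θ ℓ D₀) (hR : Regime a s θ ℓ L D₀)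
    (b : Bool) (i : Fin n) (x : Sym2 (Fin n) → Bool) :
    pr q (signs d i) {z | 2 * thr s L (D i) ≤ circ (fun t => |drift q d side L b i z t|)} x ≤
      Real.exp (-(4 * ℓ)) := by
  have hq := hT.isProb hR.a_pos
  have ha := hR.a_pos
  have hℓ := hR.one_le_ℓ
  have hL := hR.le_L
  have hDi := hT.D_pos hR i
  have hτ := thr_pos hR hDi
  set τ := thr s L (D i) with hτdef
  have hτ2 : τ ^ 2 = s ^ 2 * D i / L := thr_sq hR hDi
  set w : Fin n → ℝ := fun j => (18 / a) * (q s(i, j) / √(D j)) with hw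
  have hV : ∑ j ∈ part side b i, w j ^ 2 * diffDeg d j ≤ (18 / a) ^ 2 * (θ ^ 2 * D i / ℓ ^ 2) :=
    sum_q_sq_diff_le hT hR i (part_subset side b i) (18 / a)
  have hVτ : 4 * (4 * ℓ) * ((18 / a) ^ 2 * (θ ^ 2 * D i / ℓ ^ 2)) ≤ τ ^ 2 := by
    rw [hτ2]
    have h1 : 4 * (4 * ℓ) * ((18 / a) ^ 2 * (θ ^ 2 * D i / ℓ ^ 2)) =
        (5184 * θ ^ 2 * L) * (D i / (a ^ 2 * ℓ * L)) := by field_simp; ring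
    have h2 : s ^ 2 * D i / L = (s ^ 2 * a ^ 2 * ℓ) * (D i / (a ^ 2 * ℓ * L)) := by field_simp
    rw [h1, h2]
    exact mul_le_mul_of_nonneg_right hR.θ_sq_small (by positivity)
  have hmean : av q (signs d i) (fun z => circ (fun t => |drift q d side L b i z t|)) x ≤ τ := by
    refine ex_circ_abs_le hq (φ := fun y => drift q d side L b i ((signs d i).piecewise y x))
      (fun y => nice_drift q d side L b i _) hτ ?_
    have hpt : ∀ t, ex q (fun y => drift q d side L b i ((signs d i).piecewise y x) t ^ 2) ≤
        τ ^ 2 := by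
      intro t
      have hzero : av q (signs d i) (fun z => drift q d side L b i z t) x = 0 := by
        unfold av drift
        rw [ex_sum]
        refine Finset.sum_eq_zero fun j hj => ?_
        rw [ex_const_mul, ex_sub]
        have := av_signs_switch hT (T := star i j \ cross d side i j) (i := i)
          (fun e he hd => mem_signs_of_mem_star (mem_part.1 hj).2 (Finset.sdiff_subset he) hd)
          (binMean q d side L i j t) x
        unfold av at this
        unfold inner
        rw [this, sub_self, mul_zero]
      have := av_signs_sq_le hT ha i (part side b i) w (fun z => drift q d side L b i z t)
        (fun z e => abs_drift_update_le hT hR b i t z e) x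
      simp only [hzero, sub_zero] at this
      refine this.trans (hV.trans (le_trans ?_ hVτ))
      exact le_mul_of_one_le_left (by positivity) (by linarith)
    refine (circ_mono (nice_ex q fun y => (nice_drift q d side L b i _).sq) (nice_const (τ ^ 2))
      hpt).trans_eq (circ_const _)
  have hbern := pr_signs_ge_le hT ha i (part side b i) w
    (fun z => circ (fun t => |drift q d side L b i z t|)) (fun z e => by
      refine (abs_circ_abs_sub_le (nice_drift q d side L b i _)
        (nice_drift q d side L b i _)).trans ?_
      refine (circ_mono ((nice_drift q d side L b i _).sub (nice_drift q d side L b i _)).abs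
        (nice_const _) fun t => abs_drift_update_le hT hR b i t z e).trans_eq (circ_const _)) x
    (B := 18 / (a * √D₀)) (u := τ) (K := 4 * ℓ)
    (fun j _ => by
      have h1 : √D₀ ≤ √(D j) := Real.sqrt_le_sqrt (hT.le_D j)
      have h2 := (sqrt_D₀_bounds hR).1
      have h3 := q_le_one hT ha s(i, j)
      have h4 : q s(i, j) / √(D j) ≤ 1 / √D₀ := by
        have : 0 < √D₀ := by linarith
        gcongr
      calc w j ≤ (18 / a) * (1 / √D₀) := mul_le_mul_of_nonneg_left h4 (by positivity)
        _ = _ := by field_simp)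
    (by positivity) hV hτ (by linarith) hVτ
    (by
      refine le_trans ?_ (le_thr hR (hT.le_D i))
      have h2 := (sqrt_D₀_bounds hR).1
      have h3 : √D₀ * √D₀ = D₀ := Real.mul_self_sqrt (by linarith [hR.le_D])
      have h4 := hR.ℓ_mul_L_le_D
      rw [← mul_div_assoc, div_le_div_iff₀ (mul_pos ha (by linarith)) (by linarith)]
      calc 8 * (4 * ℓ) * 18 * L = 576 * ℓ * L := by ring
        _ ≤ a * s * D₀ := h4
        _ = s * √D₀ * (a * √D₀) := by linear_combination (-(a * s)) * h3)
  refine (pr_mono hq _ x fun y hy => ?_).trans hbern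
  have hy' : 2 * τ ≤ circ (fun t => |drift q d side L b i ((signs d i).piecewise y x) t|) := hy
  change av q (signs d i) _ x + τ ≤ circ (fun t => |drift q d side L b i _ t|)
  linarith

end

end DegreeProfile

/-! ### Fluctuation of the averaged signature difference over one layer. -/

namespace DegreeProfile

open BitAvg

variable {n : ℕ}

section

variable {q : Sym2 (Fin n) → ℝ} {d : Sym2 (Fin n) → Bool} {D : Fin n → ℝ} {side : Fin n → Bool}
  {a s θ ℓ L D₀ : ℝ}

/-- The `c + 1` edges common to both counts keep both roots at least `√(c + 1)`, and a difference of
roots is the difference of the numbers divided by the sum of the roots. -/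
lemma two_mul_abs_sqrt_sub_le (r r' c : ℕ) :
    2 * |√((r + c + 1 : ℕ) : ℝ) - √((r' + c + 1 : ℕ) : ℝ)| ≤ |(r : ℝ) - r'| / √((c : ℝ) + 1) := by
  set A := √((r + c + 1 : ℕ) : ℝ) with hA
  set B := √((r' + c + 1 : ℕ) : ℝ) with hB
  set C := √((c : ℝ) + 1) with hC
  have hC0 : 0 < C := Real.sqrt_pos.2 (by positivity)
  have hAC : C ≤ A := Real.sqrt_le_sqrt (by push_cast; linarith [Nat.cast_nonneg (α := ℝ) r])
  have hBC : C ≤ B := Real.sqrt_le_sqrt (by push_cast; linarith [Nat.cast_nonneg (α := ℝ) r'])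
  have hAA : A * A = r + c + 1 := by
    rw [hA, Real.mul_self_sqrt (Nat.cast_nonneg _)]; push_cast; ring
  have hBB : B * B = r' + c + 1 := by
    rw [hB, Real.mul_self_sqrt (Nat.cast_nonneg _)]; push_cast; ring
  have h1 : |(r : ℝ) - r'| = |A - B| * (A + B) := by
    rw [← abs_of_pos (by linarith : 0 < A + B), ← abs_mul]
    congr 1; nlinarith
  rw [le_div_iff₀ hC0, h1]
  nlinarith [abs_nonneg (A - B)]

/-- The constant is `4 + 1`: at least `D j / 16` common edges give `4 / √(D j)`, and the probability
of having fewer is exponentially small, hence at most `1 / √(D j)`. -/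
lemma ex_circ_abs_ind_sub_le (hT : Typical q d D side a θ ℓ D₀) (hR : Regime a s θ ℓ L D₀)
    (i j : Fin n) (r r' : ℕ) :
    ex q (fun y => circ (fun t => |ind L t (r + cnt (cross d side i j) y + 1) -
      ind L t (r' + cnt (cross d side i j) y + 1)|)) ≤ 5 * (|(r : ℝ) - r'| / √(D j)) := by
  have hq := hT.isProb hR.a_pos
  have hD := hT.D_pos hR j
  have hDD : √(D j) * √(D j) = D j := Real.mul_self_sqrt hD.le
  have hs : 128 ≤ √(D j) := (sqrt_D₀_bounds hR).1.trans (Real.sqrt_le_sqrt (hT.le_D j))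
  set N : Set (Sym2 (Fin n) → Bool) := {z | (cnt (cross d side i j) z : ℝ) < D j / 16} with hN
  have hpt : ∀ y, circ (fun t => |ind L t (r + cnt (cross d side i j) y + 1) -
      ind L t (r' + cnt (cross d side i j) y + 1)|) ≤
      |(r : ℝ) - r'| * (4 / √(D j) + N.indicator 1 y) := by
    intro y
    refine (circ_abs_ind_sub_le L _ _).trans ((two_mul_abs_sqrt_sub_le r r' _).trans ?_)
    rw [div_eq_mul_inv]
    refine mul_le_mul_of_nonneg_left ?_ (abs_nonneg _)
    by_cases hy : y ∈ N
    · rw [Set.indicator_of_mem hy]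
      have h1 : 1 ≤ √((cnt (cross d side i j) y : ℝ) + 1) :=
        Real.one_le_sqrt.2 (by linarith [Nat.cast_nonneg (α := ℝ) (cnt (cross d side i j) y)])
      have h2 : 0 ≤ 4 / √(D j) := by positivity
      have := inv_le_one_of_one_le₀ h1
      simp only [Pi.one_apply]
      linarith
    · rw [Set.indicator_of_notMem hy, add_zero]
      have hy' : D j / 16 ≤ (cnt (cross d side i j) y : ℝ) := not_lt.1 hy
      have h1 : √(D j) / 4 ≤ √((cnt (cross d side i j) y : ℝ) + 1) :=
        Real.le_sqrt_of_sq_le (by rw [div_pow, Real.sq_sqrt hD.le]; linarith)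
      rw [show 4 / √(D j) = (√(D j) / 4)⁻¹ by rw [inv_div]]
      exact inv_anti₀ (by positivity) h1
  refine (ex_mono hq hpt).trans ?_
  rw [ex_const_mul, ex_add, ex_const]
  have hprob := pr_cross_le hT hR i j (Finset.subset_univ _) (fun _ => false)
  unfold pr av at hprob
  simp only [Finset.piecewise_univ] at hprob
  have hexp : Real.exp (-(D j / 128)) ≤ 1 / √(D j) := by
    rw [Real.exp_neg, ← one_div]
    refine one_div_le_one_div_of_le (by linarith) ?_
    have := Real.add_one_le_exp (D j / 128)
    nlinarith
  have : 5 * (|(r : ℝ) - r'| / √(D j)) = |(r : ℝ) - r'| * (4 / √(D j) + 1 / √(D j)) := by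
    field_simp; ring
  rw [this]
  refine mul_le_mul_of_nonneg_left ?_ (abs_nonneg _)
  exact add_le_add le_rfl (hprob.trans hexp)

lemma abs_dOff_sub (d : Sym2 (Fin n) → Bool) (side : Fin n → Bool) (i j : Fin n)
    (z : Sym2 (Fin n) → Bool) : (dOff i z j : ℝ) - dOff i (switch d z) j =
      (inner d side i z j : ℝ) - inner d side i (switch d z) j := by
  rw [dOff_eq d side, dOff_eq d side, cnt_cross_switch]
  push_cast; ring

lemma circ_abs_ind_sub_le_div (hL : 0 < L) (j k : ℕ) :
    circ (fun t => |ind L t j - ind L t k|) ≤ 4 / L := by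
  have h : ∀ t, |ind L t j - ind L t k| ≤ ind L t j + ind L t k := fun t => by
    have h1 := ind_nonneg L t j
    have h2 := ind_nonneg L t k
    rw [abs_le]; constructor <;> linarith
  refine (circ_mono ((nice_ind L j).sub (nice_ind L k)).abs
    ((nice_ind L j).add (nice_ind L k)) h).trans ?_
  rw [circ_add (nice_ind L j) (nice_ind L k)]
  have := circ_ind_le hL j
  have := circ_ind_le hL k
  have : 4 / L = 2 / L + 2 / L := by ring
  linarith

lemma sum_part_q_le (hT : Typical q d D side a θ ℓ D₀) {W : Finset (Fin n)} {i : Fin n}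
    (hW : W ⊆ Finset.univ.erase i) : ∑ j ∈ W, q s(i, j) ≤ 3 * D i :=
  (Finset.sum_le_sum_of_subset_of_nonneg hW fun j _ _ => hT.q_nonneg _).trans (hT.sum_q_le i)

/-- Over the layer `mism` is a sum of independent terms with mean `drift`. The term of `j` varies
only when its degree lies in the bin in exactly one graph, so the integrated variance is at most `5
* discr`. Of the total `4 * τ`, the drift accounts for two, the standard deviation for one and
Bernstein for one. -/
theorem pr_mism_le (hT : Typical q d D side a θ ℓ D₀) (hR : Regime a s θ ℓ L D₀)
    (b : Bool) (i : Fin n) (x : Sym2 (Fin n) → Bool)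
    (hdrift : circ (fun t => |drift q d side L b i x t|) < 2 * thr s L (D i))
    (hdiscr : discr q d D i x < 5 * θ * D i / ℓ) :
    pr q (layer d side b i) {z | 4 * thr s L (D i) ≤
      circ (fun t => |mism q d L (part side b i) i z t|)} x ≤ Real.exp (-(4 * ℓ)) := by
  have hq := hT.isProb hR.a_pos
  have hℓ := hR.one_le_ℓ
  have hL : 0 < L := by linarith [hR.le_L]
  have hDi := hT.D_pos hR i
  have hτ := thr_pos hR hDi
  set τ := thr s L (D i) with hτdef
  set W := part side b i with hW
  set Δ : Fin n → ℕ → ℝ → ℝ := fun j c t => ind L t (inner d side i x j + c + 1) -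
    ind L t (inner d side i (switch d x) j + c + 1) with hΔ
  have hΔnice : ∀ j c, Nice (Δ j c) := fun j c => (nice_ind L _).sub (nice_ind L _)
  have hform : ∀ y t, mism q d L W i ((layer d side b i).piecewise y x) t =
      ∑ j ∈ W, q s(i, j) * Δ j (cnt (cross d side i j) y) t := by
    intro y t
    unfold mism
    refine Finset.sum_congr rfl fun j hj => ?_
    rw [dOff_layer hj, dOff_switch_layer hj]
  have hblock : ∀ j ∈ W, ∀ z y t,
      mism q d L W i ((layer d side b i).piecewise ((cross d side i j).piecewise y z) x) t -
        (∑ k ∈ W.erase j, q s(i, k) * Δ k (cnt (cross d side i k) z) t) =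
      q s(i, j) * Δ j (cnt (cross d side i j) y) t := by
    intro j hj z y t
    rw [hform, ← Finset.sum_erase_add _ _ hj, cnt_piecewise_of_subset le_rfl, sub_eq_iff_eq_add,
      add_comm]
    congr 1
    refine Finset.sum_congr rfl fun k hk => ?_
    rw [cnt_piecewise_of_disjoint]
    exact pairwiseDisjoint_cross d side b i (Finset.mem_of_mem_erase hk) hj
      (Finset.ne_of_mem_erase hk)
  have hΔabs : ∀ j c t, |Δ j c t| = 0 ∨ |Δ j c t| = 1 := by
    intro j c t
    simp only [hΔ]
    rcases ind_zero_or_one L t (inner d side i x j + c + 1) with h | h <;>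
    rcases ind_zero_or_one L t (inner d side i (switch d x) j + c + 1) with h' | h' <;>
    rw [h, h'] <;> norm_num
  -- the mean
  have hvar : ∀ t, av q (layer d side b i)
      (fun z => (mism q d L W i z t - drift q d side L b i x t) ^ 2) x ≤
      ∑ j ∈ W, q s(i, j) * ex q (fun y => |Δ j (cnt (cross d side i j) y) t|) := by
    intro t
    have h := av_sq_centered_le hq W (cross d side i) (pairwiseDisjoint_cross d side b i) x
      (fun z => mism q d L W i z t)
      (fun j z => ∑ k ∈ W.erase j, q s(i, k) * Δ k (cnt (cross d side i k) z) t)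
      (fun j y => |Δ j (cnt (cross d side i j) y) t|) (fun j => q s(i, j))
      (fun j => ex q (fun y => |Δ j (cnt (cross d side i j) y) t|))
      (fun j _ => hT.q_nonneg _) (fun j hj z y => by
        have := hblock j hj z y t
        rw [layer] at this
        rw [this, abs_mul, abs_of_nonneg (hT.q_nonneg _)])
      (fun j _ y => hΔabs _ _ _) (fun j _ => le_rfl)
    have h2 : av q (W.biUnion (cross d side i)) (fun z => mism q d L W i z t) x =
      drift q d side L b i x t := av_mism q d side L b i x t
    rw [h2] at h
    refine h.trans (Finset.sum_le_sum fun j _ => ?_)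
    exact mul_le_mul_of_nonneg_right (q_sq_le hT hR.a_pos _)
      (ex_nonneg hq fun _ => abs_nonneg _)
  have hint : circ (fun t => ex q (fun y =>
      (mism q d L W i ((layer d side b i).piecewise y x) t - drift q d side L b i x t) ^ 2)) ≤
      τ ^ 2 := by
    have hn1 : Nice (fun t => ex q (fun y =>
        (mism q d L W i ((layer d side b i).piecewise y x) t - drift q d side L b i x t) ^ 2)) :=
      nice_ex q fun y => ((nice_mism q d L W i _).sub (nice_drift q d side L b i x)).sq
    have hn2 : ∀ j, Nice (fun t => ex q (fun y => |Δ j (cnt (cross d side i j) y) t|)) :=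
      fun j => nice_ex q fun y => (hΔnice j _).abs
    refine (circ_mono hn1 (nice_sum W fun j _ => (hn2 j).const_mul (q s(i, j))) hvar).trans ?_
    rw [circ_sum W fun j _ => (hn2 j).const_mul _]
    calc ∑ j ∈ W, circ (fun t => q s(i, j) * ex q (fun y => |Δ j (cnt (cross d side i j) y) t|))
        ≤ ∑ j ∈ W, q s(i, j) * (5 * (|(dOff i x j : ℝ) - dOff i (switch d x) j| / √(D j))) := by
          refine Finset.sum_le_sum fun j _ => ?_
          rw [circ_const_mul, ← ex_circ q fun y => (hΔnice j _).abs, abs_dOff_sub d side]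
          exact mul_le_mul_of_nonneg_left (ex_circ_abs_ind_sub_le hT hR i j _ _) (hT.q_nonneg _)
      _ ≤ ∑ j ∈ Finset.univ.erase i,
            q s(i, j) * (5 * (|(dOff i x j : ℝ) - dOff i (switch d x) j| / √(D j))) :=
          Finset.sum_le_sum_of_subset_of_nonneg (part_subset side b i) fun j _ _ =>
            mul_nonneg (hT.q_nonneg _) (by positivity)
      _ = 5 * discr q d D i x := by
          rw [discr, Finset.mul_sum]
          exact Finset.sum_congr rfl fun j _ => by ring
      _ ≤ 5 * (5 * θ * D i / ℓ) := by linarith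
      _ ≤ τ ^ 2 := by
          rw [thr_sq hR hDi, ← mul_div_assoc, div_le_div_iff₀ (by linarith) hL]
          have := hR.θ_small
          have hθ := hR.θ_pos
          have h1 : 0 < θ * L := by positivity
          calc 5 * (5 * θ * D i) * L = (25 * θ * L) * D i := by ring
            _ ≤ (s ^ 2 * ℓ) * D i := mul_le_mul_of_nonneg_right (by linarith) hDi.le
            _ = _ := by ring
  have hmean : av q (layer d side b i)
      (fun z => circ (fun t => |mism q d L W i z t|)) x ≤ 3 * τ := by
    have h1 := ex_circ_abs_le hq (φ := fun y t =>
      mism q d L W i ((layer d side b i).piecewise y x) t - drift q d side L b i x t)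
      (fun y => (nice_mism q d L W i _).sub (nice_drift q d side L b i x)) hτ hint
    have h2 : ∀ y, circ (fun t => |mism q d L W i ((layer d side b i).piecewise y x) t|) ≤
        circ (fun t => |mism q d L W i ((layer d side b i).piecewise y x) t -
          drift q d side L b i x t|) + 2 * τ := by
      intro y
      have := (abs_le.1 (abs_circ_abs_sub_le (nice_mism q d L W i
        ((layer d side b i).piecewise y x)) (nice_drift q d side L b i x))).2
      linarith
    refine (ex_mono hq h2).trans ?_
    rw [ex_add, ex_const]
    linarith
  have hbern := pr_ge_av_add_le hq W (cross d side i) (pairwiseDisjoint_cross d side b i) x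
    (fun z => circ (fun t => |mism q d L W i z t|))
    (fun j z => circ (fun t =>
      |∑ k ∈ W.erase j, q s(i, k) * Δ k (cnt (cross d side i k) z) t|))
    (fun _ _ => 1) (fun j => q s(i, j) * (4 / L)) (fun _ => 1)
    (fun j _ => mul_nonneg (hT.q_nonneg _) (by positivity))
    (fun j hj z y => by
      refine (abs_circ_abs_sub_le (nice_mism q d L W i _) (nice_sum _ fun k _ =>
        (hΔnice k _).const_mul _)).trans ?_
      have := hblock j hj z y
      rw [layer] at this
      refine le_of_eq_of_le
        (b := circ (fun t => q s(i, j) * |Δ j (cnt (cross d side i j) y) t|))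
        (congrArg circ (funext fun t => ?_)) ?_
      · rw [this t, abs_mul, abs_of_nonneg (hT.q_nonneg _)]
      rw [circ_const_mul, mul_one]
      exact mul_le_mul_of_nonneg_left (circ_abs_ind_sub_le_div hL _ _) (hT.q_nonneg _))
    (fun _ _ _ => Or.inr rfl) (fun _ _ => (ex_const q 1).le) (cm := 4 / L)
    (V := 48 * D i / L ^ 2) (u := τ) (K := 4 * ℓ)
    (fun j _ => mul_le_of_le_one_left (by positivity) (q_le_one hT hR.a_pos _))
    (by
      calc ∑ j ∈ W, (q s(i, j) * (4 / L)) ^ 2 * 1 ≤ ∑ j ∈ W, q s(i, j) * (16 / L ^ 2) := by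
            refine Finset.sum_le_sum fun j _ => ?_
            rw [mul_one, mul_pow, div_pow]
            norm_num
            exact mul_le_mul_of_nonneg_right (q_sq_le hT hR.a_pos _) (by positivity)
        _ = (∑ j ∈ W, q s(i, j)) * (16 / L ^ 2) := by rw [Finset.sum_mul]
        _ ≤ (3 * D i) * (16 / L ^ 2) :=
            mul_le_mul_of_nonneg_right (sum_part_q_le hT (part_subset side b i)) (by positivity)
        _ = _ := by ring)
    hτ (by linarith) (sq_thr_ge hR (hT.le_D i) (by norm_num))
    (thr_ge hR (hT.le_D i) (by norm_num))
  refine (pr_mono hq _ x fun y hy => ?_).trans hbern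
  have hy' : 4 * τ ≤ circ (fun t => |mism q d L W i ((layer d side b i).piecewise y x) t|) := hy
  change av q (layer d side b i) _ x + τ ≤ circ (fun t => |mism q d L W i _ t|)
  linarith

/-! ### The distance of a vertex from itself -/

/-- The signature difference of `i` in the two graphs. -/
noncomputable def sigDiff (d : Sym2 (Fin n) → Bool) (L : ℝ) (i : Fin n)
    (z : Sym2 (Fin n) → Bool) (t : ℝ) : ℝ :=
  ∑ j ∈ Finset.univ.erase i, (ind L t (dOff i z j + 1) * bit z s(i, j) -
    ind L t (dOff i (switch d z) j + 1) * bit (switch d z) s(i, j))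

lemma nice_sigDiff (d : Sym2 (Fin n) → Bool) (L : ℝ) (i : Fin n) (z : Sym2 (Fin n) → Bool) :
    Nice (sigDiff d L i z) :=
  nice_sum _ fun _ _ => ((nice_ind L _).mul (nice_const _)).sub ((nice_ind L _).mul (nice_const _))

/-- A neighbour of `i` has degree one more than `dOff`, and a non-neighbour contributes nothing, so
the `+ 1` can be unconditional. The bin indicator then no longer depends on the edges at `i`. -/
lemma ball_adj {L : ℝ} (z : Sym2 (Fin n) → Bool) {i j : Fin n} (hij : i ≠ j) (t : ℝ) :
    ball L (adj z) i j t = ind L t (dOff i z j + 1) * bit z s(i, j) := by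
  unfold ball bit
  rw [deg_adj z hij]
  cases h : z s(i, j)
  · simp [adj, h]
  · simp [adj, h, hij, ind]

lemma ball_adj_self {L : ℝ} (z : Sym2 (Fin n) → Bool) (i : Fin n) (t : ℝ) :
    ball L (adj z) i i t = 0 := by simp [ball, adj]

lemma sigDist_self (d : Sym2 (Fin n) → Bool) (L : ℝ) (i : Fin n) (z : Sym2 (Fin n) → Bool) :
    sigDist L (adj z) (adj (switch d z)) i i = circ (fun t => |sigDiff d L i z t|) := by
  unfold sigDist circ
  congr 1; ext t; congr 1
  rw [← Finset.sum_sub_distrib, ← Finset.sum_erase_add _ _ (Finset.mem_univ i)]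
  simp only [ball_adj_self, sub_self, add_zero]
  unfold sigDiff
  refine Finset.sum_congr rfl fun j hj => ?_
  rw [ball_adj _ (Finset.ne_of_mem_erase hj).symm, ball_adj _ (Finset.ne_of_mem_erase hj).symm]

lemma mem_row_of_ne {i j : Fin n} (hj : j ≠ i) : s(i, j) ∈ row i := mem_row.2 ⟨j, hj, rfl⟩

lemma sigDiff_row (d : Sym2 (Fin n) → Bool) (L : ℝ) (i : Fin n) (y x : Sym2 (Fin n) → Bool)
    (t : ℝ) : sigDiff d L i ((row i).piecewise y x) t =
      ∑ j ∈ Finset.univ.erase i, (ind L t (dOff i x j + 1) * bit y s(i, j) -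
        ind L t (dOff i (switch d x) j + 1) * bit (switch d y) s(i, j)) := by
  unfold sigDiff
  refine Finset.sum_congr rfl fun j hj => ?_
  have hj' := Finset.ne_of_mem_erase hj
  rw [switch_piecewise, dOff_row hj', dOff_row hj']
  simp [bit, mem_row_of_ne hj']

/-- An edge has the same conditional probability in both graphs, on the differing edges because `1 /
2` is invariant under negation. Hence averaging over the edges at `i` leaves only differences of bin
indicators. -/
lemma ex_bit_switch (hT : Typical q d D side a θ ℓ D₀) (e : Sym2 (Fin n)) :
    ex q (fun y => bit (switch d y) e) = q e := by
  unfold bit switch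
  have h := ex_bit q e (fun b => if xor b (d e) then (1 : ℝ) else 0)
  rw [h]
  cases hd : d e
  · simp
  · simp [hT.q_half e hd]; norm_num

lemma av_sigDiff (hT : Typical q d D side a θ ℓ D₀) (L : ℝ) (i : Fin n)
    (x : Sym2 (Fin n) → Bool) (t : ℝ) :
    av q (row i) (fun z => sigDiff d L i z t) x = mism q d L (Finset.univ.erase i) i x t := by
  unfold av mism
  simp only [sigDiff_row]
  rw [ex_sum]
  refine Finset.sum_congr rfl fun j _ => ?_
  rw [ex_sub, ex_const_mul, ex_const_mul, ex_bit_eq, ex_bit_switch hT]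
  ring

lemma sum_row_update {i : Fin n} (F : Fin n → Bool → ℝ) (x : Sym2 (Fin n) → Bool)
    {e : Sym2 (Fin n)} (he : e ∈ row i) :
    ∃ j ∈ Finset.univ.erase i, s(i, j) = e ∧
      (∑ k ∈ Finset.univ.erase i, F k (Function.update x e true s(i, k))) -
      (∑ k ∈ Finset.univ.erase i, F k (Function.update x e false s(i, k))) =
        F j true - F j false := by
  obtain ⟨j, hj, rfl⟩ := mem_row.1 he
  refine ⟨j, by simp [hj], rfl, ?_⟩
  rw [← Finset.sum_sub_distrib, Finset.sum_eq_single j]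
  · simp
  · intro k _ hk
    have : s(i, k) ≠ s(i, j) := fun h => hk (sym2_mk_injective i h)
    rw [Function.update_of_ne this, Function.update_of_ne this, sub_self]
  · intro h; simp [hj] at h

/-- The influence of the edge `e` at `i` on the signature difference of `i`. -/
noncomputable def infl (d : Sym2 (Fin n) → Bool) (L : ℝ) (i : Fin n)
    (x : Sym2 (Fin n) → Bool) (j : Fin n) (t : ℝ) : ℝ :=
  if d s(i, j) then ind L t (dOff i x j + 1) + ind L t (dOff i (switch d x) j + 1)
  else |ind L t (dOff i x j + 1) - ind L t (dOff i (switch d x) j + 1)|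

lemma nice_infl (d : Sym2 (Fin n) → Bool) (L : ℝ) (i : Fin n)
    (x : Sym2 (Fin n) → Bool) (j : Fin n) : Nice (infl d L i x j) := by
  unfold infl
  by_cases h : d s(i, j)
  · simp only [h, if_true]; exact (nice_ind L _).add (nice_ind L _)
  · simp only [h, if_false]; exact ((nice_ind L _).sub (nice_ind L _)).abs

lemma circ_infl_le (d : Sym2 (Fin n) → Bool) (hL : 0 < L) (i : Fin n)
    (x : Sym2 (Fin n) → Bool) (j : Fin n) : circ (infl d L i x j) ≤ 4 / L := by
  unfold infl
  by_cases h : d s(i, j)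
  · simp only [h, if_true]
    rw [circ_add (nice_ind L _) (nice_ind L _)]
    have h1 := circ_ind_le hL (dOff i x j + 1)
    have h2 := circ_ind_le hL (dOff i (switch d x) j + 1)
    have : 4 / L = 2 / L + 2 / L := by ring
    linarith
  · simp only [h, if_false]; exact circ_abs_ind_sub_le_div hL _ _

lemma abs_sigDiff_update (d : Sym2 (Fin n) → Bool) (L : ℝ) (i : Fin n)
    (z x : Sym2 (Fin n) → Bool) {e : Sym2 (Fin n)} (he : e ∈ row i) :
    ∃ j ∈ Finset.univ.erase i, s(i, j) = e ∧ ∀ t,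
      |sigDiff d L i ((row i).piecewise (Function.update z e true) x) t -
        sigDiff d L i ((row i).piecewise (Function.update z e false) x) t| = infl d L i x j t := by
  obtain ⟨j, hj, rfl⟩ := mem_row.1 he
  refine ⟨j, by simp [hj], rfl, fun t => ?_⟩
  obtain ⟨k, -, hk, h⟩ := sum_row_update (fun k b => ind L t (dOff i x k + 1) *
    (if b then 1 else 0) - ind L t (dOff i (switch d x) k + 1) *
    (if xor b (d s(i, k)) then 1 else 0)) z he
  have hkj : k = j := sym2_mk_injective i hk
  subst hkj
  have e1 : ∀ b, sigDiff d L i ((row i).piecewise (Function.update z s(i, k) b) x) t =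
      ∑ k' ∈ Finset.univ.erase i, (ind L t (dOff i x k' + 1) *
        (if Function.update z s(i, k) b s(i, k') then 1 else 0) -
        ind L t (dOff i (switch d x) k' + 1) *
        (if xor (Function.update z s(i, k) b s(i, k')) (d s(i, k')) then 1 else 0)) := by
    intro b; rw [sigDiff_row]; rfl
  rw [e1, e1, h]
  unfold infl
  have h1 := ind_nonneg L t (dOff i x k + 1)
  have h2 := ind_nonneg L t (dOff i (switch d x) k + 1)
  cases hd : d s(i, k)
  · simp
  · simp; positivity

/-- The mean over the edges at `i` is `mism`, at most `4 * τ` on each side of the cut. The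
integrated variance is controlled by `discr`, through neighbours whose bins change, and by `diffDeg
d i`, through differing edges at `i` itself. It contributes one `τ`, and the deviation the tenth. -/
theorem pr_sigDiff_le (hT : Typical q d D side a θ ℓ D₀) (hR : Regime a s θ ℓ L D₀)
    (i : Fin n) (x : Sym2 (Fin n) → Bool)
    (hmism : ∀ b, circ (fun t => |mism q d L (part side b i) i x t|) < 4 * thr s L (D i))
    (hdiscr : discr q d D i x < 5 * θ * D i / ℓ)
    (hdeg : ∀ j, j ≠ i → D j / 16 ≤ cnt (cross d side i j) x) :
    pr q (row i) {z | 10 * thr s L (D i) ≤ circ (fun t => |sigDiff d L i z t|)} x ≤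
      Real.exp (-(4 * ℓ)) := by
  have hq := hT.isProb hR.a_pos
  have hℓ := hR.one_le_ℓ
  have hL : 0 < L := by linarith [hR.le_L]
  have hDi := hT.D_pos hR i
  have hτ := thr_pos hR hDi
  set τ := thr s L (D i) with hτdef
  set W := Finset.univ.erase i with hW
  have hM : circ (fun t => |mism q d L W i x t|) ≤ 8 * τ := by
    have hsplit : ∀ t, mism q d L W i x t =
        mism q d L (part side true i) i x t + mism q d L (part side false i) i x t := by
      intro t
      unfold mism
      rw [← Finset.sum_filter_add_sum_filter_not W (fun j => side j = true)]
      congr 1 <;> refine Finset.sum_congr ?_ fun _ _ => rfl <;> ext j <;> simp [hW, part, and_comm]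
    simp only [hsplit]
    have h1 := circ_mono ((nice_mism q d L (part side true i) i x).add
      (nice_mism q d L (part side false i) i x)).abs
      ((nice_mism q d L (part side true i) i x).abs.add
      (nice_mism q d L (part side false i) i x).abs) (fun t => abs_add_le _ _)
    rw [circ_add (nice_mism q d L (part side true i) i x).abs
      (nice_mism q d L (part side false i) i x).abs] at h1
    have h2 := hmism true
    have h3 := hmism false
    linarith
  have hvar : ∀ t, av q (row i)
      (fun z => (sigDiff d L i z t - mism q d L W i x t) ^ 2) x ≤
      ∑ j ∈ W, q s(i, j) * infl d L i x j t ^ 2 := by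
    intro t
    have h := av_sq_centered_le_of_bits hq (row i) x (fun z => sigDiff d L i z t)
      (fun e => |sigDiff d L i ((row i).piecewise (Function.update x e true) x) t -
        sigDiff d L i ((row i).piecewise (Function.update x e false) x) t|) (fun e he z => by
          obtain ⟨j, -, hj, h⟩ := abs_sigDiff_update d L i z x he
          obtain ⟨j', -, hj', h'⟩ := abs_sigDiff_update d L i x x he
          have : j = j' := sym2_mk_injective i (hj.trans hj'.symm)
          rw [h, h', this])
    rw [av_sigDiff hT, sum_row] at h
    refine h.trans_eq (Finset.sum_congr rfl fun j hj => ?_)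
    have hji := Finset.ne_of_mem_erase hj
    obtain ⟨j', -, hj', h'⟩ := abs_sigDiff_update d L i x x (mem_row_of_ne hji)
    rw [h', sym2_mk_injective i hj']
    ring
  -- The indicators are 0 or 1: the absolute difference is its own square, and the square of the sum
  -- is at most twice the sum.
  have hsq : ∀ j t, infl d L i x j t ^ 2 ≤
      |ind L t (dOff i x j + 1) - ind L t (dOff i (switch d x) j + 1)| +
      (if d s(i, j) then (1 : ℝ) else 0) *
        (2 * (ind L t (dOff i x j + 1) + ind L t (dOff i (switch d x) j + 1))) := by
    intro j t
    unfold infl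
    cases hd : d s(i, j) <;>
    rcases ind_zero_or_one L t (dOff i x j + 1) with h | h <;>
    rcases ind_zero_or_one L t (dOff i (switch d x) j + 1) with h' | h' <;>
    rw [h, h'] <;> norm_num
  have hcirc : ∀ j ∈ W, circ (fun t => infl d L i x j t ^ 2) ≤
      4 * (|(dOff i x j : ℝ) - dOff i (switch d x) j| / √(D j)) +
        (if d s(i, j) then (1 : ℝ) else 0) * (8 / L) := by
    intro j hj
    have hji := Finset.ne_of_mem_erase hj
    have hDj := hT.D_pos hR j
    have n1 := ((nice_ind L (dOff i x j + 1)).sub (nice_ind L (dOff i (switch d x) j + 1))).abs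
    have n2 := ((nice_ind L (dOff i x j + 1)).add (nice_ind L (dOff i (switch d x) j + 1)))
    refine (circ_mono (nice_infl d L i x j).sq (n1.add ((n2.const_mul 2).const_mul _))
      (hsq j)).trans ?_
    rw [circ_add n1 ((n2.const_mul 2).const_mul _), circ_const_mul, circ_const_mul,
      circ_add (nice_ind L _) (nice_ind L _)]
    refine add_le_add ?_ ?_
    · have h1 := circ_abs_ind_sub_le L (dOff i x j + 1) (dOff i (switch d x) j + 1)
      have h2 := two_mul_abs_sqrt_sub_le (inner d side i x j) (inner d side i (switch d x) j)
        (cnt (cross d side i j) x)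
      rw [dOff_eq d side i x, dOff_eq d side i (switch d x), cnt_cross_switch] at h1
      refine (show _ ≤ _ from ?_ : circ _ ≤ _)
      rw [abs_dOff_sub d side]
      rw [dOff_eq d side i x, dOff_eq d side i (switch d x), cnt_cross_switch]
      refine h1.trans (h2.trans ?_)
      rw [div_eq_mul_inv, div_eq_mul_inv, mul_left_comm]
      refine mul_le_mul_of_nonneg_left ?_ (abs_nonneg _)
      have hc := hdeg j hji
      have h3 : √(D j) / 4 ≤ √((cnt (cross d side i j) x : ℝ) + 1) :=
        Real.le_sqrt_of_sq_le (by rw [div_pow, Real.sq_sqrt hDj.le]; linarith)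
      have h4 : 0 < √(D j) := Real.sqrt_pos.2 hDj
      rw [show 4 * (√(D j))⁻¹ = (√(D j) / 4)⁻¹ by rw [inv_div]; ring]
      exact inv_anti₀ (by positivity) h3
    · have h1 := circ_ind_le hL (dOff i x j + 1)
      have h2 := circ_ind_le hL (dOff i (switch d x) j + 1)
      have h3 : 8 / L = 2 * (2 / L + 2 / L) := by ring
      refine mul_le_mul_of_nonneg_left ?_ (by split_ifs <;> norm_num)
      rw [h3]
      linarith
  have hint : circ (fun t => ex q (fun y =>
      (sigDiff d L i ((row i).piecewise y x) t - mism q d L W i x t) ^ 2)) ≤ τ ^ 2 := by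
    refine (circ_mono (nice_ex q fun y => ((nice_sigDiff d L i _).sub
      (nice_mism q d L W i x)).sq) (nice_sum W fun j _ =>
        ((nice_infl d L i x j).sq.const_mul (q s(i, j)))) hvar).trans ?_
    rw [circ_sum W fun j _ => (nice_infl d L i x j).sq.const_mul _]
    have hdd : ∑ j ∈ W, q s(i, j) * (if d s(i, j) then (1 : ℝ) else 0) ≤ diffDeg d i / 2 := by
      unfold diffDeg
      rw [Finset.card_filter, Nat.cast_sum, Finset.sum_div]
      refine Finset.sum_le_sum fun j _ => ?_
      by_cases h : d s(i, j) = true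
      · simp [h, hT.q_half _ h]
      · simp [h]
    calc ∑ j ∈ W, circ (fun t => q s(i, j) * infl d L i x j t ^ 2)
        ≤ ∑ j ∈ W, q s(i, j) * (4 * (|(dOff i x j : ℝ) - dOff i (switch d x) j| / √(D j)) +
            (if d s(i, j) then (1 : ℝ) else 0) * (8 / L)) := by
          refine Finset.sum_le_sum fun j hj => ?_
          rw [circ_const_mul]
          exact mul_le_mul_of_nonneg_left (hcirc j hj) (hT.q_nonneg _)
      _ = 4 * discr q d D i x +
            (∑ j ∈ W, q s(i, j) * (if d s(i, j) then (1 : ℝ) else 0)) * (8 / L) := by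
          rw [discr, Finset.mul_sum, Finset.sum_mul, ← Finset.sum_add_distrib]
          exact Finset.sum_congr rfl fun j _ => by ring
      _ ≤ 4 * (5 * θ * D i / ℓ) + (θ ^ 2 * D i / ℓ / 2) * (8 / L) := by
          have h1 := hT.diff_le i
          gcongr
          linarith
      _ ≤ τ ^ 2 := by
          rw [thr_sq hR hDi]
          have h1 := hR.θ_small
          have hθ := hR.θ_pos
          have hθ1 := hR.θ_le
          have h2 : 4 * (5 * θ * D i / ℓ) + (θ ^ 2 * D i / ℓ / 2) * (8 / L) =
            (20 * θ * L + 4 * θ ^ 2) * (D i / (ℓ * L)) := by field_simp; ring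
          have h3 : s ^ 2 * D i / L = (s ^ 2 * ℓ) * (D i / (ℓ * L)) := by field_simp
          rw [h2, h3]
          refine mul_le_mul_of_nonneg_right ?_ (by positivity)
          have h4 : θ ^ 2 ≤ θ * L := by nlinarith [hR.le_L]
          linarith [mul_pos hθ hL]
  have hmean : av q (row i) (fun z => circ (fun t => |sigDiff d L i z t|)) x ≤ 9 * τ := by
    have h1 := ex_circ_abs_le hq (φ := fun y t =>
      sigDiff d L i ((row i).piecewise y x) t - mism q d L W i x t)
      (fun y => (nice_sigDiff d L i _).sub (nice_mism q d L W i x)) hτ hint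
    have h2 : ∀ y, circ (fun t => |sigDiff d L i ((row i).piecewise y x) t|) ≤
        circ (fun t => |sigDiff d L i ((row i).piecewise y x) t - mism q d L W i x t|) +
          8 * τ := by
      intro y
      have := (abs_le.1 (abs_circ_abs_sub_le (nice_sigDiff d L i
        ((row i).piecewise y x)) (nice_mism q d L W i x))).2
      linarith
    refine (ex_mono hq h2).trans ?_
    rw [ex_add, ex_const]
    linarith
  have hbern := pr_ge_av_add_le_of_bits hq (row i) x
    (fun z => circ (fun t => |sigDiff d L i z t|)) (fun _ => 4 / L)
    (fun e he z => by
      refine (abs_circ_abs_sub_le (nice_sigDiff d L i _) (nice_sigDiff d L i _)).trans ?_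
      obtain ⟨j, -, -, h⟩ := abs_sigDiff_update d L i z x he
      simp only [h]
      exact circ_infl_le d hL i x j)
    (cm := 4 / L) (V := 48 * D i / L ^ 2) (u := τ) (K := 4 * ℓ) (fun _ _ => le_rfl)
    (by
      rw [sum_row, ← Finset.mul_sum]
      calc (4 / L) ^ 2 * ∑ j ∈ W, q s(i, j) ≤ (4 / L) ^ 2 * (3 * D i) := by
            gcongr; exact hT.sum_q_le i
        _ = _ := by ring)
    hτ (by linarith) (sq_thr_ge hR (hT.le_D i) (by norm_num))
    (thr_ge hR (hT.le_D i) (by norm_num))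
  refine (pr_mono hq _ x fun y hy => ?_).trans hbern
  have hy' : 10 * τ ≤ circ (fun t => |sigDiff d L i ((row i).piecewise y x) t|) := hy
  change av q (row i) _ x + τ ≤ circ (fun t => |sigDiff d L i _ t|)
  linarith

end

end DegreeProfile

namespace BitAvg

variable {ι : Type*} [Fintype ι] [DecidableEq ι]

lemma le_ex_abs_cnt_add {q : ι → ℝ} (hq : IsProb q) (T : Finset ι) {a : ℝ} (ha : 0 < a)
    (hqa : ∀ e ∈ T, a ≤ 1 - q e) (hμ : 12 ≤ a * √(∑ e ∈ T, q e)) (R : (ι → Bool) → ℝ)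
    (hR : ∀ y y', R (T.piecewise y' y) = R y) :
    a * √(∑ e ∈ T, q e) / 24 ≤ ex q (fun y => |(cnt T y : ℝ) + R y|) := by
  rw [← ex_av q T]
  refine le_ex_of_le hq fun y => ?_
  unfold av
  refine (le_ex_abs_cnt_sub hq T ha hqa hμ (-R y)).trans_eq ?_
  congr 1; ext y'
  change |(cnt T y' : ℝ) - -R y| = |(cnt T (T.piecewise y' y) : ℝ) + R (T.piecewise y' y)|
  rw [hR, sub_neg_eq_add]
  have : cnt T (T.piecewise y' y) = cnt T y' := cnt_congr fun e he => by simp [he]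
  rw [this]

lemma pr_empty (q : ι → ℝ) (S : Finset ι) (x : ι → Bool) : pr q S ∅ x = 0 := by
  simp [pr, av, ex_const]

end BitAvg

/-! ### Loads of bins. -/

namespace DegreeProfile

open BitAvg

variable {n : ℕ}

section

variable {q : Sym2 (Fin n) → ℝ} {d : Sym2 (Fin n) → Bool} {D : Fin n → ℝ} {side : Fin n → Bool}
  {a s θ ℓ L D₀ : ℝ}

/-- The expected number of neighbours of `i` in `W` in the bin, for degrees of the right order. -/
noncomputable def load (q : Sym2 (Fin n) → ℝ) (D : Fin n → ℝ) (L : ℝ)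
    (W : Finset (Fin n)) (i : Fin n) (z : Sym2 (Fin n) → Bool) (t : ℝ) : ℝ :=
  ∑ j ∈ W, q s(i, j) * tind L (D j) t (dOff i z j + 1)

lemma nice_load (q : Sym2 (Fin n) → ℝ) (D : Fin n → ℝ) (L : ℝ)
    (W : Finset (Fin n)) (i : Fin n) (z : Sym2 (Fin n) → Bool) : Nice (load q D L W i z) :=
  nice_sum _ fun _ _ => (nice_tind L _ _).const_mul _

/-- The mean is at most `M`: total weight `3 * D i` times hitting probability `200 / (a * L)`. Given
the rest, degrees on one side are independent, so Bernstein with variance bound and deviation both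
`M` rules out twice the mean. -/
theorem pr_load_layer_le (hT : Typical q d D side a θ ℓ D₀) (hR : Regime a s θ ℓ L D₀)
    (b : Bool) (i : Fin n) (x : Sym2 (Fin n) → Bool) (t : ℝ) :
    pr q (layer d side b i) {z | 1200 * D i / (a * L) ≤ load q D L (part side b i) i z t} x ≤
      Real.exp (-(4 * ℓ)) := by
  have hq := hT.isProb hR.a_pos
  have ha := hR.a_pos
  have hℓ := hR.one_le_ℓ
  have hL : 0 < L := by linarith [hR.le_L]
  have hDi := hT.D_pos hR i
  set W := part side b i with hW
  set M := 600 * D i / (a * L) with hM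
  have hMpos : 0 < M := by positivity
  have hMℓ : 16 * ℓ ≤ M := by
    rw [hM, le_div_iff₀ (by positivity)]
    have h1 := hR.ℓ_mul_L_le_D
    have h2 := hT.le_D i
    have h3 := hR.le_D
    have h4 : a * s * D₀ ≤ D i := by
      have : a * s ≤ 1 := by nlinarith [hR.a_le, hR.s_le, hR.s_pos]
      nlinarith
    have h5 : 0 < ℓ * L := by positivity
    nlinarith [hR.a_le]
  set Δ : Fin n → ℕ → ℝ := fun j c => tind L (D j) t (inner d side i x j + 1 + c) with hΔ
  have hform : ∀ y, load q D L W i ((layer d side b i).piecewise y x) t =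
      ∑ j ∈ W, q s(i, j) * Δ j (cnt (cross d side i j) y) := by
    intro y
    unfold load
    refine Finset.sum_congr rfl fun j hj => ?_
    rw [dOff_layer hj, add_right_comm]
  have hblock : ∀ j ∈ W, ∀ z y,
      load q D L W i ((layer d side b i).piecewise ((cross d side i j).piecewise y z) x) t -
        (∑ k ∈ W.erase j, q s(i, k) * Δ k (cnt (cross d side i k) z)) =
      q s(i, j) * Δ j (cnt (cross d side i j) y) := by
    intro j hj z y
    rw [hform, ← Finset.sum_erase_add _ _ hj, cnt_piecewise_of_subset le_rfl, sub_eq_iff_eq_add,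
      add_comm]
    congr 1
    refine Finset.sum_congr rfl fun k hk => ?_
    rw [cnt_piecewise_of_disjoint]
    exact pairwiseDisjoint_cross d side b i (Finset.mem_of_mem_erase hk) hj
      (Finset.ne_of_mem_erase hk)
  have hΔex : ∀ j, ex q (fun y => Δ j (cnt (cross d side i j) y)) ≤ 200 / (a * L) := fun j =>
    ex_tind_le hq _ ha hR.a_le (fun e _ => hT.q_le e) (hT.cross_le i j) hR.le_L
      (by nlinarith [hR.L_sq_le_D, hT.le_D j]) t _
  have hqsum : ∑ j ∈ W, q s(i, j) ≤ 3 * D i := sum_part_q_le hT (part_subset side b i)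
  have hΔ01 : ∀ j c, Δ j c = 0 ∨ Δ j c = 1 := fun j c => tind_zero_or_one _ _ _ _
  have hmean : av q (layer d side b i) (fun z => load q D L W i z t) x ≤ M := by
    unfold av
    simp only [hform]
    rw [ex_sum]
    calc ∑ j ∈ W, ex q (fun y => q s(i, j) * Δ j (cnt (cross d side i j) y))
        ≤ ∑ j ∈ W, q s(i, j) * (200 / (a * L)) := by
          refine Finset.sum_le_sum fun j _ => ?_
          rw [ex_const_mul]
          exact mul_le_mul_of_nonneg_left (hΔex j) (hT.q_nonneg _)
      _ = (∑ j ∈ W, q s(i, j)) * (200 / (a * L)) := by rw [Finset.sum_mul]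
      _ ≤ (3 * D i) * (200 / (a * L)) := by gcongr
      _ = M := by rw [hM]; ring
  have hbern := pr_ge_av_add_le hq W (cross d side i) (pairwiseDisjoint_cross d side b i) x
    (fun z => load q D L W i z t)
    (fun j z => ∑ k ∈ W.erase j, q s(i, k) * Δ k (cnt (cross d side i k) z))
    (fun j y => Δ j (cnt (cross d side i j) y)) (fun j => q s(i, j)) (fun _ => 200 / (a * L))
    (fun j _ => hT.q_nonneg _)
    (fun j hj z y => by
      have := hblock j hj z y
      rw [layer] at this
      rw [this, abs_mul, abs_of_nonneg (hT.q_nonneg _), abs_of_nonneg]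
      rcases hΔ01 j (cnt (cross d side i j) y) with h | h <;> rw [h]; norm_num)
    (fun j _ y => hΔ01 j _) (fun j _ => hΔex j) (cm := 1) (V := M) (u := M) (K := 4 * ℓ)
    (fun j _ => q_le_one hT ha _)
    (by
      calc ∑ j ∈ W, q s(i, j) ^ 2 * (200 / (a * L)) ≤ ∑ j ∈ W, q s(i, j) * (200 / (a * L)) := by
            refine Finset.sum_le_sum fun j _ => ?_
            exact mul_le_mul_of_nonneg_right (q_sq_le hT ha _) (by positivity)
        _ = (∑ j ∈ W, q s(i, j)) * (200 / (a * L)) := by rw [Finset.sum_mul]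
        _ ≤ (3 * D i) * (200 / (a * L)) := by gcongr
        _ = M := by rw [hM]; ring)
    hMpos (by linarith) (by nlinarith) (by linarith)
  refine (pr_mono hq _ x fun y hy => ?_).trans hbern
  have hy' : 1200 * D i / (a * L) ≤ load q D L W i ((layer d side b i).piecewise y x) t := hy
  change av q (layer d side b i) _ x + M ≤ load q D L W i _ t
  have : 1200 * D i / (a * L) = M + M := by rw [hM]; ring
  linarith

lemma sum_erase_eq_part (side : Fin n → Bool) (i : Fin n) (φ : Fin n → ℝ) :
    ∑ j ∈ Finset.univ.erase i, φ j =
      ∑ j ∈ part side true i, φ j + ∑ j ∈ part side false i, φ j := by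
  rw [← Finset.sum_filter_add_sum_filter_not _ (fun j => side j = true)]
  congr 1 <;> refine Finset.sum_congr ?_ fun _ _ => rfl <;> ext j <;> simp [part, and_comm]

lemma pr_load_le (hT : Typical q d D side a θ ℓ D₀) (hR : Regime a s θ ℓ L D₀)
    (i : Fin n) (x : Sym2 (Fin n) → Bool) (t : ℝ) :
    pr q Finset.univ {z | 2400 * D i / (a * L) ≤ load q D L (Finset.univ.erase i) i z t} x ≤
      2 * Real.exp (-(4 * ℓ)) := by
  have hq := hT.isProb hR.a_pos
  have hb : ∀ b, pr q Finset.univ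
      {z | 1200 * D i / (a * L) ≤ load q D L (part side b i) i z t} x ≤ Real.exp (-(4 * ℓ)) := by
    intro b
    have := pr_univ_le_add hq (layer d side b i)
      {z | 1200 * D i / (a * L) ≤ load q D L (part side b i) i z t} ∅ (Real.exp_nonneg _) x
      (fun x _ => pr_load_layer_le hT hR b i x t)
    rwa [pr_empty, add_zero] at this
  have hsub := pr_mono hq Finset.univ x
    (A := {z | 2400 * D i / (a * L) ≤ load q D L (Finset.univ.erase i) i z t})
    (B := {z | 1200 * D i / (a * L) ≤ load q D L (part side true i) i z t} ∪
      {z | 1200 * D i / (a * L) ≤ load q D L (part side false i) i z t}) (fun y hy => by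
      have hy' : 2400 * D i / (a * L) ≤ load q D L (Finset.univ.erase i) i
        (Finset.univ.piecewise y x) t := hy
      unfold load at hy'
      rw [sum_erase_eq_part side] at hy'
      change _ ≤ load q D L (part side true i) i _ t ∨ _ ≤ load q D L (part side false i) i _ t
      unfold load
      by_contra hc
      rw [not_or, not_le, not_le] at hc
      have : 2400 * D i / (a * L) = 1200 * D i / (a * L) + 1200 * D i / (a * L) := by ring
      linarith [hc.1, hc.2])
  refine hsub.trans ((pr_union_le hq _ _ _ x).trans ?_)
  linarith [hb true, hb false]

open Classical in
/-- The indicator that the bin is overloaded. -/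
noncomputable def overload (q : Sym2 (Fin n) → ℝ) (D : Fin n → ℝ) (a L : ℝ)
    (i : Fin n) (z : Sym2 (Fin n) → Bool) (t : ℝ) : ℝ :=
  if 2400 * D i / (a * L) ≤ load q D L (Finset.univ.erase i) i z t then 1 else 0

lemma overload_nonneg (q : Sym2 (Fin n) → ℝ) (D : Fin n → ℝ) (a L : ℝ)
    (i : Fin n) (z : Sym2 (Fin n) → Bool) (t : ℝ) : 0 ≤ overload q D a L i z t := by
  unfold overload; split_ifs <;> norm_num

lemma nice_overload (q : Sym2 (Fin n) → ℝ) (D : Fin n → ℝ) (a L : ℝ)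
    (i : Fin n) (z : Sym2 (Fin n) → Bool) : Nice (overload q D a L i z) := by
  refine ⟨Measurable.ite (measurableSet_le measurable_const (nice_load q D L _ i z).1)
    measurable_const measurable_const, 1, fun t => ?_⟩
  unfold overload
  split_ifs <;> norm_num

/-- Markov's inequality for the measure of the overloaded `t`. Only this measure matters later, so
no uniform control over `t` is required. -/
theorem pr_overload_le (hT : Typical q d D side a θ ℓ D₀) (hR : Regime a s θ ℓ L D₀)
    (i : Fin n) (x : Sym2 (Fin n) → Bool) :
    pr q Finset.univ {z | 1 ≤ 3 * D i * circ (overload q D a L i z)} x ≤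
      6 * D i * Real.exp (-(4 * ℓ)) := by
  have hq := hT.isProb hR.a_pos
  have hDi := hT.D_pos hR i
  refine (pr_le_av_div hq Finset.univ (fun z => 3 * D i * circ (overload q D a L i z)) x one_pos
    fun y => mul_nonneg (by linarith) (circ_nonneg (overload_nonneg q D a L i _))).trans ?_
  rw [div_one, av, ex_const_mul, ex_circ q fun y => nice_overload q D a L i _]
  have h : ∀ t, ex q (fun y => overload q D a L i (Finset.univ.piecewise y x) t) ≤
      2 * Real.exp (-(4 * ℓ)) := by
    intro t
    refine le_trans (le_of_eq ?_) (pr_load_le hT hR i x t)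
    unfold pr av overload
    refine congrArg (ex q) (funext fun y => ?_)
    by_cases hy : 2400 * D i / (a * L) ≤
      load q D L (Finset.univ.erase i) i (Finset.univ.piecewise y x) t
    · rw [if_pos hy, Set.indicator_of_mem (by exact hy)]; rfl
    · rw [if_neg hy, Set.indicator_of_notMem (by exact hy)]
  have h2 := circ_mono (nice_ex q fun y => nice_overload q D a L i _) (nice_const _) h
  rw [circ_const] at h2
  calc 3 * D i * circ (fun t => ex q (fun y => overload q D a L i (Finset.univ.piecewise y x) t))
      ≤ 3 * D i * (2 * Real.exp (-(4 * ℓ))) := by gcongr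
    _ = _ := by ring

/-! ### The distance between different vertices -/

/-- The difference between the signature of `i` in the first graph and that of `k` in the second,
without the contribution of `i` to the latter. -/
noncomputable def crossDiff (d : Sym2 (Fin n) → Bool) (L : ℝ) (i k : Fin n)
    (z : Sym2 (Fin n) → Bool) (t : ℝ) : ℝ :=
  ∑ j ∈ Finset.univ.erase i, (ind L t (dOff i z j + 1) * bit z s(i, j) -
    if j = k then 0 else ind L t (dOff i (switch d z) j + if switch d z s(i, j) then 1 else 0) *
      bit (switch d z) s(k, j))

lemma nice_crossDiff (d : Sym2 (Fin n) → Bool) (L : ℝ) (i k : Fin n)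
    (z : Sym2 (Fin n) → Bool) : Nice (crossDiff d L i k z) := by
  refine nice_sum _ fun j _ => ((nice_ind L _).mul (nice_const _)).sub ?_
  by_cases h : j = k
  · simp only [h, if_true]; exact nice_const 0
  · simp only [h, if_false]; exact (nice_ind L _).mul (nice_const _)

/-- `crossDiff` ignores `i` as a possible neighbour of `k`, since the degree of `i` depends on all
the edges to be resampled. This alters the signature on at most one bin, of length at most `2 / L`.
-/
lemma le_sigDist (d : Sym2 (Fin n) → Bool) {L : ℝ} (hL : 0 < L) {i k : Fin n} (hik : i ≠ k)
    (z : Sym2 (Fin n) → Bool) :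
    circ (fun t => |crossDiff d L i k z t|) - 2 / L ≤
      sigDist L (adj z) (adj (switch d z)) i k := by
  have hB : ∀ t, ∑ j, ball L (adj z) i j t - ∑ j, ball L (adj (switch d z)) k j t =
      crossDiff d L i k z t - ball L (adj (switch d z)) k i t := by
    intro t
    rw [← Finset.sum_sub_distrib, ← Finset.sum_erase_add _ _ (Finset.mem_univ i)]
    rw [ball_adj_self, zero_sub, ← sub_eq_add_neg]
    congr 1
    unfold crossDiff
    refine Finset.sum_congr rfl fun j hj => ?_
    have hji := Finset.ne_of_mem_erase hj
    rw [ball_adj _ hji.symm]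
    congr 1
    by_cases hjk : j = k
    · subst hjk; simp [ball_adj_self]
    · rw [if_neg hjk]
      unfold ball bit
      rw [deg_adj _ hji.symm]
      cases h : switch d z s(k, j)
      · simp [adj, h]
      · simp only [adj, ne_eq, Ne.symm hjk, not_false_eq_true, h, and_self, if_true, Matrix.of_apply,
          mul_one, ind]
  have hball : ∀ t, |ball L (adj (switch d z)) k i t| ≤ ind L t (deg (adj (switch d z)) i) := by
    intro t
    have h := ind_nonneg L t (deg (adj (switch d z)) i)
    have e : ball L (adj (switch d z)) k i t = ind L t (deg (adj (switch d z)) i) *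
      (if adj (switch d z) k i = 1 then 1 else 0) := rfl
    rw [e]
    split_ifs
    · rw [mul_one, abs_of_nonneg h]
    · simpa using h
  have hnb : Nice (fun t => ball L (adj (switch d z)) k i t) :=
    (nice_ind L (deg (adj (switch d z)) i)).mul (nice_const _)
  have e : sigDist L (adj z) (adj (switch d z)) i k =
      circ (fun t => |crossDiff d L i k z t - ball L (adj (switch d z)) k i t|) := by
    unfold sigDist circ
    simp only [hB]
  rw [e]
  have h1 := (abs_le.1 (abs_circ_abs_sub_le (nice_crossDiff d L i k z)
    ((nice_crossDiff d L i k z).sub hnb))).2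
  have h2 : circ (fun t => |crossDiff d L i k z t - (crossDiff d L i k z t -
      ball L (adj (switch d z)) k i t)|) ≤ 2 / L := by
    simp only [sub_sub_cancel]
    exact (circ_mono hnb.abs (nice_ind L _) hball).trans (circ_ind_le hL _)
  linarith

/-- The contribution of `j` to `crossDiff` as a function of the edge `ij`. -/
noncomputable def term (d : Sym2 (Fin n) → Bool) (L : ℝ) (i k : Fin n)
    (x : Sym2 (Fin n) → Bool) (j : Fin n) (t : ℝ) (b : Bool) : ℝ :=
  ind L t (dOff i x j + 1) * (if b then 1 else 0) -
    if j = k then 0 else ind L t (dOff i (switch d x) j + if xor b (d s(i, j)) then 1 else 0) *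
      bit (switch d x) s(k, j)

lemma crossDiff_row (d : Sym2 (Fin n) → Bool) (L : ℝ) {i k : Fin n} (hik : i ≠ k)
    (y x : Sym2 (Fin n) → Bool) (t : ℝ) : crossDiff d L i k ((row i).piecewise y x) t =
      ∑ j ∈ Finset.univ.erase i, term d L i k x j t (y s(i, j)) := by
  unfold crossDiff term
  refine Finset.sum_congr rfl fun j hj => ?_
  have hj' := Finset.ne_of_mem_erase hj
  have hnot : s(k, j) ∉ row i := by
    intro h
    obtain ⟨l, -, hl⟩ := mem_row.1 h
    have : i ∈ s(k, j) := by rw [← hl]; simp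
    rcases Sym2.mem_iff.1 this with h | h
    · exact hik h
    · exact hj' h.symm
  rw [switch_piecewise, dOff_row hj', dOff_row hj']
  simp only [bit, Finset.piecewise_eq_of_mem _ _ _ (mem_row_of_ne hj'),
    Finset.piecewise_eq_of_notMem _ _ _ hnot, switch]
  rfl

lemma abs_term_sub_le (d : Sym2 (Fin n) → Bool) (L : ℝ) (i k : Fin n)
    (x : Sym2 (Fin n) → Bool) (j : Fin n) (t : ℝ) :
    |term d L i k x j t true - term d L i k x j t false| ≤
      ind L t (dOff i x j + 1) + (ind L t (dOff i (switch d x) j + 1) +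
        ind L t (dOff i (switch d x) j)) := by
  have h1 := ind_nonneg L t (dOff i x j + 1)
  have h2 := ind_nonneg L t (dOff i (switch d x) j + 1)
  have h3 := ind_nonneg L t (dOff i (switch d x) j)
  unfold term bit
  rw [abs_le]
  cases d s(i, j) <;> cases switch d x s(k, j) <;> by_cases hjk : j = k <;>
    simp only [hjk, if_true, if_false, Bool.xor_false, Bool.xor_true, Bool.not_true, Bool.not_false,
      Bool.false_eq_true, add_zero, mul_one, mul_zero, sub_zero] at * <;>
    constructor <;> linarith

/-- The expected number of neighbours of `i` whose bins are unaffected by the second graph. -/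
noncomputable def clean (q : Sym2 (Fin n) → ℝ) (d : Sym2 (Fin n) → Bool) (L : ℝ) (i k : Fin n)
    (x : Sym2 (Fin n) → Bool) (t : ℝ) : ℝ :=
  ∑ j ∈ (Finset.univ.erase i).erase k, q s(i, j) * (ind L t (dOff i x j + 1) *
    (1 - |ind L t (dOff i (switch d x) j + 1) - ind L t (dOff i (switch d x) j)|))

lemma nice_clean (q : Sym2 (Fin n) → ℝ) (d : Sym2 (Fin n) → Bool) (L : ℝ) (i k : Fin n)
    (x : Sym2 (Fin n) → Bool) : Nice (clean q d L i k x) :=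
  nice_sum _ fun _ _ => ((nice_ind L _).mul ((nice_const 1).sub
    ((nice_ind L _).sub (nice_ind L _)).abs)).const_mul _

/-- Take the `j ≠ k` that lie in the bin once joined to `i` and whose position in the second graph
is not affected by the edge `ij`. Toggling such an edge changes `crossDiff` by exactly one, so
`crossDiff` is a count of independent bits plus a term independent of them. -/
lemma le_ex_abs_crossDiff (hT : Typical q d D side a θ ℓ D₀) (ha : 0 < a) {i k : Fin n}
    (hik : i ≠ k) (x : Sym2 (Fin n) → Bool) (t : ℝ) (hc : 12 ≤ a * √(clean q d L i k x t)) :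
    a * √(clean q d L i k x t) / 24 ≤
      ex q (fun y => |crossDiff d L i k ((row i).piecewise y x) t|) := by
  classical
  set J := ((Finset.univ.erase i).erase k).filter fun j => ind L t (dOff i x j + 1) = 1 ∧
    ind L t (dOff i (switch d x) j + 1) = ind L t (dOff i (switch d x) j) with hJ
  set T := J.image fun j => s(i, j) with hTdef
  have hsumT : ∀ φ : Sym2 (Fin n) → ℝ, ∑ e ∈ T, φ e = ∑ j ∈ J, φ s(i, j) := fun φ => by
    rw [hTdef, Finset.sum_image fun _ _ _ _ h => sym2_mk_injective i h]
  have hclean : clean q d L i k x t = ∑ e ∈ T, q e := by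
    rw [hsumT, hJ, Finset.sum_filter]
    refine Finset.sum_congr rfl fun j _ => ?_
    rcases ind_zero_or_one L t (dOff i x j + 1) with h | h <;>
    rcases ind_zero_or_one L t (dOff i (switch d x) j + 1) with h' | h' <;>
    rcases ind_zero_or_one L t (dOff i (switch d x) j) with h'' | h'' <;>
    rw [h, h', h''] <;> norm_num
  rw [hclean] at hc ⊢
  have hJsub : J ⊆ Finset.univ.erase i :=
    (Finset.filter_subset _ _).trans (Finset.erase_subset _ _)
  have hterm : ∀ j ∈ J, ∀ b, term d L i k x j t b =
      (if b then 1 else 0) + term d L i k x j t false := by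
    intro j hj b
    obtain ⟨hjm, h1, h2⟩ := Finset.mem_filter.1 hj
    have hjk : j ≠ k := Finset.ne_of_mem_erase hjm
    unfold term
    rw [if_neg hjk, if_neg hjk, h1]
    have e : ∀ c : Bool, ind L t (dOff i (switch d x) j + if c then 1 else 0) =
        ind L t (dOff i (switch d x) j) := by
      intro c; cases c
      · simp
      · simpa using h2
    rw [e, e]
    simp only [Bool.false_eq_true, if_false]
    ring
  set R : (Sym2 (Fin n) → Bool) → ℝ := fun y =>
    (∑ j ∈ J, term d L i k x j t false) +
      ∑ j ∈ Finset.univ.erase i \ J, term d L i k x j t (y s(i, j)) with hRdef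
  have hdec : ∀ y, crossDiff d L i k ((row i).piecewise y x) t = (cnt T y : ℝ) + R y := by
    intro y
    rw [crossDiff_row d L hik, ← Finset.sum_sdiff hJsub, cnt_cast, hsumT]
    rw [Finset.sum_congr rfl fun j hj => hterm j hj (y s(i, j)), Finset.sum_add_distrib]
    simp only [hRdef, bit]
    ring
  simp only [hdec]
  refine le_ex_abs_cnt_add (hT.isProb ha) T ha (fun e _ => hT.q_le e) hc R fun y y' => ?_
  simp only [hRdef]
  congr 1
  refine Finset.sum_congr rfl fun j hj => ?_
  rw [Finset.piecewise_eq_of_notMem]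
  intro hmem
  obtain ⟨j', hj', he⟩ := Finset.mem_image.1 hmem
  have := sym2_mk_injective i he
  subst this
  exact (Finset.mem_sdiff.1 hj).2 hj'

/-- The bin of `j` has measure at least `1 / L`. One edge more or less moves the root of a degree of
order `D j` so little that at most half of this is lost, and removing `k` still leaves weight `D i /
4`. -/
lemma le_circ_clean (hT : Typical q d D side a θ ℓ D₀) (hR : Regime a s θ ℓ L D₀)
    {i k : Fin n} (hik : i ≠ k) (x : Sym2 (Fin n) → Bool)
    (hdeg : ∀ j, j ≠ i → D j / 16 ≤ cnt (cross d side i j) x) :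
    D i / (8 * L) ≤ circ (clean q d L i k x) := by
  have hL8 := hR.le_L
  have hL : 0 < L := by linarith
  set W := (Finset.univ.erase i).erase k with hW
  have hsum : D i / 4 ≤ ∑ j ∈ W, q s(i, j) := by
    have h1 := hT.le_sum_q i
    have h2 : k ∈ Finset.univ.erase i := by simp [hik.symm]
    rw [← Finset.sum_erase_add _ _ h2] at h1
    have h3 := q_le_one hT hR.a_pos s(i, k)
    have h4 := hT.le_D i
    have h5 := hR.le_D
    linarith
  have hj : ∀ j ∈ W, 1 / (2 * L) ≤ circ (fun t => ind L t (dOff i x j + 1) *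
      (1 - |ind L t (dOff i (switch d x) j + 1) - ind L t (dOff i (switch d x) j)|)) := by
    intro j hj
    have hji : j ≠ i := Finset.ne_of_mem_erase (Finset.mem_of_mem_erase hj)
    have hDj := hT.D_pos hR j
    have n1 := nice_ind L (dOff i x j + 1)
    have n2 := ((nice_ind L (dOff i (switch d x) j + 1)).sub
      (nice_ind L (dOff i (switch d x) j))).abs
    have hle : ∀ t, ind L t (dOff i x j + 1) -
        |ind L t (dOff i (switch d x) j + 1) - ind L t (dOff i (switch d x) j)| ≤
        ind L t (dOff i x j + 1) *
      (1 - |ind L t (dOff i (switch d x) j + 1) - ind L t (dOff i (switch d x) j)|) := by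
      intro t
      have h1 := ind_le_one L t (dOff i x j + 1)
      have h2 := abs_nonneg (ind L t (dOff i (switch d x) j + 1) - ind L t (dOff i (switch d x) j))
      nlinarith
    refine le_trans ?_ (circ_mono (n1.sub n2) (n1.mul ((nice_const 1).sub n2)) hle)
    rw [circ_sub n1 n2]
    have h1 := le_circ_ind (by linarith : 2 ≤ L) (dOff i x j + 1)
    have h2 := circ_abs_ind_sub_le L (dOff i (switch d x) j + 1) (dOff i (switch d x) j)
    have hc := hdeg j hji
    have hcpos : 0 < cnt (cross d side i j) x := by
      have : (0 : ℝ) < cnt (cross d side i j) x := by linarith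
      exact_mod_cast this
    -- One cross edge is set aside to supply the `+ 1` in `two_mul_abs_sqrt_sub_le`.
    obtain ⟨c, hceq⟩ : ∃ c, cnt (cross d side i j) x = c + 1 := ⟨_, (Nat.succ_pred_eq_of_pos hcpos).symm⟩
    have h3 := two_mul_abs_sqrt_sub_le (inner d side i (switch d x) j + 1)
      (inner d side i (switch d x) j) c
    have e1 : dOff i (switch d x) j = inner d side i (switch d x) j + c + 1 := by
      rw [dOff_eq d side, cnt_cross_switch, hceq]; ring
    have e2 : dOff i (switch d x) j + 1 = inner d side i (switch d x) j + 1 + c + 1 := by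
      rw [e1]; ring
    rw [← e1, ← e2] at h3
    have h4 : |((inner d side i (switch d x) j + 1 : ℕ) : ℝ) - inner d side i (switch d x) j| = 1 := by
      push_cast; simp
    rw [h4] at h3
    have h5 : 2 * L ≤ √((c : ℝ) + 1) := by
      refine Real.le_sqrt_of_sq_le ?_
      have : (c : ℝ) + 1 = cnt (cross d side i j) x := by rw [hceq]; push_cast; ring
      rw [this]
      nlinarith [hR.L_sq_le_D, hT.le_D j]
    have h6 : 1 / √((c : ℝ) + 1) ≤ 1 / (2 * L) := one_div_le_one_div_of_le (by positivity) h5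
    have h7 : 1 / L = 1 / (2 * L) + 1 / (2 * L) := by field_simp; ring
    linarith
  unfold clean
  rw [circ_sum W fun j _ => ((nice_ind L _).mul ((nice_const 1).sub
    ((nice_ind L _).sub (nice_ind L _)).abs)).const_mul _]
  calc D i / (8 * L) = D i / 4 * (1 / (2 * L)) := by field_simp; ring
    _ ≤ (∑ j ∈ W, q s(i, j)) * (1 / (2 * L)) := by gcongr
    _ = ∑ j ∈ W, q s(i, j) * (1 / (2 * L)) := by rw [Finset.sum_mul]
    _ ≤ _ := by
        refine Finset.sum_le_sum fun j hj' => ?_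
        rw [circ_const_mul]
        exact mul_le_mul_of_nonneg_left (hj j hj') (hT.q_nonneg _)

/-- Where `clean ≤ T₀` one has `√clean ≥ clean / √T₀`, so the pointwise bound becomes linear in
`clean` and can be integrated. As `T₀` and the integral of `clean` are both of order `D i / L`, the
mean is of order `√(D i / L)`, at least `13 * τ`; the lower tail loses one `τ`. -/
theorem pr_crossDiff_le (hT : Typical q d D side a θ ℓ D₀) (hR : Regime a s θ ℓ L D₀)
    {i k : Fin n} (hik : i ≠ k) (x : Sym2 (Fin n) → Bool)
    (hdeg : ∀ j, j ≠ i → D j / 16 ≤ cnt (cross d side i j) x)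
    (hdeg' : ∀ j, j ≠ i → (dOff i x j : ℝ) < 5 * D j)
    (hover : 3 * D i * circ (overload q D a L i x) < 1) :
    pr q (row i) {z | circ (fun t => |crossDiff d L i k z t|) ≤ 12 * thr s L (D i)} x ≤
      Real.exp (-(4 * ℓ)) := by
  have hq := hT.isProb hR.a_pos
  have ha := hR.a_pos
  have hℓ := hR.one_le_ℓ
  have hL : 0 < L := by linarith [hR.le_L]
  have hDi := hT.D_pos hR i
  have hτ := thr_pos hR hDi
  set τ := thr s L (D i) with hτdef
  set T₀ := 2400 * D i / (a * L) with hT₀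
  have hT₀pos : 0 < T₀ := by positivity
  have hsT : 0 < √T₀ := Real.sqrt_pos.2 hT₀pos
  have hcle : ∀ t, clean q d L i k x t ≤ load q D L (Finset.univ.erase i) i x t := by
    intro t
    unfold clean load
    refine (Finset.sum_le_sum fun j hj => ?_).trans
      (Finset.sum_le_sum_of_subset_of_nonneg (Finset.erase_subset _ _) fun j _ _ =>
        mul_nonneg (hT.q_nonneg _) ?_)
    · have hji : j ≠ i := Finset.ne_of_mem_erase (Finset.mem_of_mem_erase hj)
      refine mul_le_mul_of_nonneg_left ?_ (hT.q_nonneg _)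
      have h1 : tind L (D j) t (dOff i x j + 1) = ind L t (dOff i x j + 1) := by
        unfold tind
        rw [if_pos]
        have h1 := hdeg j hji
        have h2 := hdeg' j hji
        have h3 : cnt (cross d side i j) x ≤ dOff i x j := by
          rw [dOff_eq d side]; exact Nat.le_add_left _ _
        have h4 : (cnt (cross d side i j) x : ℝ) ≤ dOff i x j := by exact_mod_cast h3
        push_cast
        constructor
        · linarith
        · linarith [hT.le_D j, hR.le_D]
      rw [h1]
      refine mul_le_of_le_one_right (ind_nonneg _ _ _) ?_
      linarith [abs_nonneg (ind L t (dOff i (switch d x) j + 1) - ind L t (dOff i (switch d x) j))]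
    · rcases tind_zero_or_one L (D j) t (dOff i x j + 1) with h | h <;> rw [h]; norm_num
  have hload : ∀ t, load q D L (Finset.univ.erase i) i x t ≤ 3 * D i := by
    intro t
    refine le_trans (Finset.sum_le_sum fun j _ => ?_) (hT.sum_q_le i)
    refine mul_le_of_le_one_right (hT.q_nonneg _) ?_
    rcases tind_zero_or_one L (D j) t (dOff i x j + 1) with h | h <;> rw [h]; norm_num
  -- The two subtracted terms make the left side nonpositive where `clean` is too small for
  -- anticoncentration, and where the bin is overloaded, since `clean` never exceeds `3 * D i`.
  have hpt : ∀ t, (a / (24 * √T₀)) *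
      (clean q d L i k x t - (144 / a ^ 2 + 3 * D i * overload q D a L i x t)) ≤
      ex q (fun y => |crossDiff d L i k ((row i).piecewise y x) t|) := by
    intro t
    have hnn : 0 ≤ ex q (fun y => |crossDiff d L i k ((row i).piecewise y x) t|) :=
      ex_nonneg hq fun _ => abs_nonneg _
    have hpos : 0 < a / (24 * √T₀) := by positivity
    have hov := overload_nonneg q D a L i x t
    have h144 : 0 ≤ 144 / a ^ 2 := by positivity
    by_cases ho : T₀ ≤ load q D L (Finset.univ.erase i) i x t
    · have e : overload q D a L i x t = 1 := if_pos ho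
      rw [e]
      refine le_trans (mul_nonpos_of_nonneg_of_nonpos hpos.le ?_) hnn
      linarith [hcle t, hload t]
    · by_cases hc : clean q d L i k x t < 144 / a ^ 2
      · refine le_trans (mul_nonpos_of_nonneg_of_nonpos hpos.le ?_) hnn
        have : 0 ≤ 3 * D i * overload q D a L i x t := by positivity
        linarith
      · rw [not_lt] at hc
        have hs : 12 / a ≤ √(clean q d L i k x t) := Real.le_sqrt_of_sq_le (by
          rw [div_pow]; norm_num; exact hc)
        have h12 : 12 ≤ a * √(clean q d L i k x t) := by
          rw [div_le_iff₀ ha] at hs; linarith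
        refine le_trans ?_ (le_ex_abs_crossDiff hT ha hik x t h12)
        have h1 : √(clean q d L i k x t) ≤ √T₀ :=
          Real.sqrt_le_sqrt ((hcle t).trans (not_le.1 ho).le)
        have h2 : √(clean q d L i k x t) * √(clean q d L i k x t) = clean q d L i k x t :=
          Real.mul_self_sqrt (h144.trans hc)
        have h3 : 0 ≤ 3 * D i * overload q D a L i x t := by positivity
        calc a / (24 * √T₀) * (clean q d L i k x t - (144 / a ^ 2 + 3 * D i * overload q D a L i x t))
            ≤ a / (24 * √T₀) * (√T₀ * √(clean q d L i k x t)) := by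
              refine mul_le_mul_of_nonneg_left ?_ hpos.le
              nlinarith [Real.sqrt_nonneg (clean q d L i k x t)]
          _ = _ := by field_simp
  have hmean : 13 * τ ≤ av q (row i) (fun z => circ (fun t => |crossDiff d L i k z t|)) x := by
    unfold av
    rw [ex_circ q fun y => (nice_crossDiff d L i k _).abs]
    have nov := (nice_overload q D a L i x).const_mul (3 * D i)
    refine le_trans ?_ (circ_mono (((nice_clean q d L i k x).sub
      ((nice_const (144 / a ^ 2)).add nov)).const_mul _)
      (nice_ex q fun y => (nice_crossDiff d L i k _).abs) hpt)
    rw [circ_const_mul, circ_sub (nice_clean q d L i k x) ((nice_const (144 / a ^ 2)).add nov),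
      circ_add (nice_const (144 / a ^ 2)) nov, circ_const, circ_const_mul]
    have h1 := le_circ_clean hT hR hik x hdeg
    have h2 : 144 / a ^ 2 + 1 ≤ D i / (16 * L) := by
      have e1 : 144 / a ^ 2 + 1 ≤ 145 / a ^ 2 := by
        have : 1 ≤ 1 / a ^ 2 := by
          rw [le_div_iff₀ (by positivity)]; nlinarith [hR.a_le]
        have e : 145 / a ^ 2 = 144 / a ^ 2 + 1 / a ^ 2 := by ring
        linarith
      refine e1.trans ?_
      rw [div_le_div_iff₀ (by positivity) (by positivity)]
      have := hR.a_le_D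
      have h3 : a ^ 2 * D₀ ≤ a ^ 2 * D i := by gcongr; exact hT.le_D i
      linarith
    have h3 : D i / (8 * L) = D i / (16 * L) + D i / (16 * L) := by field_simp; ring
    have h4 : D i / (16 * L) ≤ circ (clean q d L i k x) -
        (144 / a ^ 2 + 3 * D i * circ (overload q D a L i x)) := by linarith
    -- The resulting factor is `a ^ 2 / (24 * 50 * 16) = a ^ 2 / 19200`, and `13 * 19200 < 250000`
    -- explains the bound `s_small`.
    have hsq : √T₀ ≤ 50 / a * √(D i / L) := by
      rw [Real.sqrt_le_left (by positivity), mul_pow, Real.sq_sqrt (by positivity), hT₀]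
      rw [show (50 / a) ^ 2 * (D i / L) = (2500 * D i / (a * L)) * (1 / a) by field_simp; ring]
      have : 1 ≤ 1 / a := by rw [le_div_iff₀ ha]; linarith [hR.a_le]
      have h5 : 2400 * D i / (a * L) ≤ 2500 * D i / (a * L) := by gcongr; norm_num
      refine h5.trans (le_mul_of_one_le_right (by positivity) this)
    have hr : 0 < √(D i / L) := Real.sqrt_pos.2 (by positivity)
    have hrr : √(D i / L) * √(D i / L) = D i / L := Real.mul_self_sqrt (by positivity)
    calc 13 * τ = 13 * s * √(D i / L) := by rw [hτdef, thr]; ring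
      _ ≤ a ^ 2 / 19200 * √(D i / L) := by
          refine mul_le_mul_of_nonneg_right ?_ hr.le
          have := hR.s_small
          linarith [sq_nonneg a]
      _ = a / (24 * (50 / a * √(D i / L))) * (√(D i / L) * √(D i / L) / 16) := by
          field_simp; ring
      _ = a / (24 * (50 / a * √(D i / L))) * (D i / (16 * L)) := by rw [hrr]; field_simp
      _ ≤ a / (24 * √T₀) * (D i / (16 * L)) := by gcongr
      _ ≤ _ := by gcongr
  have hbern := pr_le_av_sub_le_of_bits hq (row i) x
    (fun z => circ (fun t => |crossDiff d L i k z t|)) (fun _ => 6 / L)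
    (fun e he z => by
      refine (abs_circ_abs_sub_le (nice_crossDiff d L i k _) (nice_crossDiff d L i k _)).trans ?_
      have hpt : ∃ j, ∀ t, |crossDiff d L i k ((row i).piecewise (Function.update z e true) x) t -
          crossDiff d L i k ((row i).piecewise (Function.update z e false) x) t| ≤
          ind L t (dOff i x j + 1) + (ind L t (dOff i (switch d x) j + 1) +
            ind L t (dOff i (switch d x) j)) := by
        obtain ⟨j, hj, rfl⟩ := mem_row.1 he
        refine ⟨j, fun t => ?_⟩
        obtain ⟨j', -, hj', h⟩ := sum_row_update (fun j b => term d L i k x j t b) z he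
        have := sym2_mk_injective i hj'
        subst this
        rw [crossDiff_row d L hik, crossDiff_row d L hik, h]
        exact abs_term_sub_le d L i k x j' t
      obtain ⟨j, hj⟩ := hpt
      refine (circ_mono ((nice_crossDiff d L i k _).sub (nice_crossDiff d L i k _)).abs
        ((nice_ind L _).add ((nice_ind L _).add (nice_ind L _))) hj).trans ?_
      rw [circ_add (nice_ind L _) ((nice_ind L _).add (nice_ind L _)),
        circ_add (nice_ind L _) (nice_ind L _)]
      have h1 := circ_ind_le hL (dOff i x j + 1)
      have h2 := circ_ind_le hL (dOff i (switch d x) j + 1)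
      have h3 := circ_ind_le hL (dOff i (switch d x) j)
      have : 6 / L = 2 / L + (2 / L + 2 / L) := by ring
      linarith)
    (cm := 6 / L) (V := 108 * D i / L ^ 2) (u := τ) (K := 4 * ℓ) (fun _ _ => le_rfl)
    (by
      rw [sum_row, ← Finset.mul_sum]
      calc (6 / L) ^ 2 * ∑ j ∈ Finset.univ.erase i, q s(i, j) ≤ (6 / L) ^ 2 * (3 * D i) := by
            gcongr; exact hT.sum_q_le i
        _ = _ := by ring)
    hτ (by linarith) (sq_thr_ge hR (hT.le_D i) le_rfl)
    (thr_ge hR (hT.le_D i) le_rfl)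
  refine (pr_mono hq _ x fun y hy => ?_).trans hbern
  have hy' : circ (fun t => |crossDiff d L i k ((row i).piecewise y x) t|) ≤ 12 * τ := hy
  change circ (fun t => |crossDiff d L i k _ t|) ≤ av q (row i) _ x - τ
  linarith

end

end DegreeProfile

/-! ### Union bounds for a fixed typical difference set. -/

namespace DegreeProfile

open BitAvg

variable {n : ℕ}

section

variable {q : Sym2 (Fin n) → ℝ} {d : Sym2 (Fin n) → Bool} {D : Fin n → ℝ} {side : Fin n → Bool}
  {a s θ ℓ L D₀ : ℝ}

lemma pr_univ_le_of_forall {ι : Type*} [Fintype ι] [DecidableEq ι] {q : ι → ℝ} (hq : IsProb q)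
    (S : Finset ι) (A : Set (ι → Bool)) {ε : ℝ} (hε : 0 ≤ ε) (x₀ : ι → Bool)
    (h : ∀ x, pr q S A x ≤ ε) : pr q Finset.univ A x₀ ≤ ε := by
  have := pr_univ_le_add hq S A ∅ hε x₀ fun x _ => h x
  rwa [pr_empty, add_zero] at this

/-- Some vertex has few neighbours across the partition. -/
def sparse (d : Sym2 (Fin n) → Bool) (side : Fin n → Bool) (D : Fin n → ℝ) (i : Fin n) :
    Set (Sym2 (Fin n) → Bool) :=
  ⋃ j ∈ Finset.univ.erase i, {z | (cnt (cross d side i j) z : ℝ) < D j / 16}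

/-- Some vertex has a large degree. -/
def dense (D : Fin n → ℝ) (i : Fin n) : Set (Sym2 (Fin n) → Bool) :=
  ⋃ j ∈ Finset.univ.erase i, {z | 5 * D j ≤ (dOff i z j : ℝ)}

lemma sum_erase_const_le (i : Fin n) {c : ℝ} (hc : 0 ≤ c) :
    ∑ _j ∈ Finset.univ.erase i, c ≤ n * c := by
  refine (Finset.sum_le_sum_of_subset_of_nonneg (Finset.subset_univ _) fun _ _ _ => hc).trans ?_
  simp

lemma pr_sparse_le (hT : Typical q d D side a θ ℓ D₀) (hR : Regime a s θ ℓ L D₀) (i : Fin n)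
    (x : Sym2 (Fin n) → Bool) :
    pr q Finset.univ (sparse d side D i) x ≤ n * Real.exp (-(4 * ℓ)) := by
  refine (pr_biUnion_le (hT.isProb hR.a_pos) _ _ _ x).trans
    ((Finset.sum_le_sum fun j _ => ?_).trans (sum_erase_const_le i (Real.exp_nonneg _)))
  refine (pr_cross_le hT hR i j (Finset.subset_univ _) x).trans (Real.exp_le_exp.2 ?_)
  linarith [hT.le_D j, hR.ℓ_le_D]

lemma pr_dense_le (hT : Typical q d D side a θ ℓ D₀) (hR : Regime a s θ ℓ L D₀) (i : Fin n)
    (x : Sym2 (Fin n) → Bool) :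
    pr q Finset.univ (dense D i) x ≤ n * Real.exp (-(4 * ℓ)) := by
  refine (pr_biUnion_le (hT.isProb hR.a_pos) _ _ _ x).trans
    ((Finset.sum_le_sum fun j _ => ?_).trans (sum_erase_const_le i (Real.exp_nonneg _)))
  have hDj := hT.D_pos hR j
  have hμ : ∑ e ∈ star i j, q e ≤ 3 * D j := by
    rw [sum_star]
    refine (Finset.sum_le_sum_of_subset_of_nonneg (fun l hl => ?_)
      fun l _ _ => hT.q_nonneg _).trans (hT.sum_q_le j)
    simpa using (Finset.mem_filter.1 hl).2.2
  refine (pr_mono (hT.isProb hR.a_pos) _ x fun y hy => ?_).trans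
    ((pr_cnt_ge (hT.isProb hR.a_pos) (Finset.subset_univ (star i j)) (by linarith) hμ x).trans
      (Real.exp_le_exp.2 ?_))
  · have hy' : 5 * D j ≤ (cnt (star i j) (Finset.univ.piecewise y x) : ℝ) := hy
    change _ ≤ (cnt (star i j) (Finset.univ.piecewise y x) : ℝ)
    linarith
  · linarith [hT.le_D j, hR.ℓ_le_D, hR.one_le_ℓ]

lemma pr_univ_mism_le (hT : Typical q d D side a θ ℓ D₀) (hR : Regime a s θ ℓ L D₀) (b : Bool)
    (i : Fin n) (x : Sym2 (Fin n) → Bool) :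
    pr q Finset.univ {z | 4 * thr s L (D i) ≤
      circ (fun t => |mism q d L (part side b i) i z t|)} x ≤ 3 * Real.exp (-(4 * ℓ)) := by
  have hq := hT.isProb hR.a_pos
  have he := Real.exp_nonneg (-(4 * ℓ))
  have h1 := pr_univ_le_of_forall hq (signs d i) _ he x (pr_discr_le hT hR i)
  have h2 := pr_univ_le_of_forall hq (signs d i) _ he x (pr_drift_le hT hR b i)
  have h := pr_univ_le_add hq (layer d side b i)
    {z | 4 * thr s L (D i) ≤ circ (fun t => |mism q d L (part side b i) i z t|)}
    ({z | 2 * thr s L (D i) ≤ circ (fun t => |drift q d side L b i z t|)} ∪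
      {z | 5 * θ * D i / ℓ ≤ discr q d D i z}) he x (fun y hy => by
      have hy' : ¬(2 * thr s L (D i) ≤ circ (fun t => |drift q d side L b i y t|) ∨
        5 * θ * D i / ℓ ≤ discr q d D i y) := hy
      rw [not_or, not_le, not_le] at hy'
      exact pr_mism_le hT hR b i y hy'.1 hy'.2)
  have h3 := pr_union_le hq Finset.univ
    {z | 2 * thr s L (D i) ≤ circ (fun t => |drift q d side L b i z t|)}
    {z | 5 * θ * D i / ℓ ≤ discr q d D i z} x
  linarith

lemma le_cnt_of_notMem_sparse {i : Fin n} {x : Sym2 (Fin n) → Bool} (h : x ∉ sparse d side D i)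
    (j : Fin n) (hj : j ≠ i) : D j / 16 ≤ cnt (cross d side i j) x := by
  by_contra hc
  exact h (Set.mem_biUnion (Finset.mem_coe.2 (Finset.mem_erase.2 ⟨hj, Finset.mem_univ _⟩))
    (not_le.1 hc))

lemma dOff_lt_of_notMem_dense {i : Fin n} {x : Sym2 (Fin n) → Bool} (h : x ∉ dense D i)
    (j : Fin n) (hj : j ≠ i) : (dOff i x j : ℝ) < 5 * D j := by
  by_contra hc
  exact h (Set.mem_biUnion (Finset.mem_coe.2 (Finset.mem_erase.2 ⟨hj, Finset.mem_univ _⟩))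
    (not_lt.1 hc))

/-- The two signatures of one vertex are close to each other. -/
theorem pr_univ_sigDiff_le (hT : Typical q d D side a θ ℓ D₀) (hR : Regime a s θ ℓ L D₀)
    (i : Fin n) (x : Sym2 (Fin n) → Bool) :
    pr q Finset.univ {z | 10 * thr s L (D i) ≤ circ (fun t => |sigDiff d L i z t|)} x ≤
      (8 + n) * Real.exp (-(4 * ℓ)) := by
  have hq := hT.isProb hR.a_pos
  have he := Real.exp_nonneg (-(4 * ℓ))
  set A : Bool → Set (Sym2 (Fin n) → Bool) := fun b => {z | 4 * thr s L (D i) ≤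
      circ (fun t => |mism q d L (part side b i) i z t|)} with hA
  set B : Set (Sym2 (Fin n) → Bool) := {z | 5 * θ * D i / ℓ ≤ discr q d D i z} with hB
  have h := pr_univ_le_add hq (row i)
    {z | 10 * thr s L (D i) ≤ circ (fun t => |sigDiff d L i z t|)}
    (((A true ∪ A false) ∪ B) ∪ sparse d side D i) he x (fun y hy => by
      have hy1 := fun h => hy (Or.inl (Or.inl h))
      have hy2 : y ∉ B := fun h => hy (Or.inl (Or.inr h))
      have hy3 : y ∉ sparse d side D i := fun h => hy (Or.inr h)
      refine pr_sigDiff_le hT hR i y (fun b => ?_) (not_le.1 hy2) (le_cnt_of_notMem_sparse hy3)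
      cases b
      · exact not_le.1 fun h => hy1 (Or.inr h)
      · exact not_le.1 fun h => hy1 (Or.inl h))
  have h1 := pr_univ_mism_le hT hR true i x
  have h2 := pr_univ_mism_le hT hR false i x
  have h3 := pr_univ_le_of_forall hq (signs d i) B he x (pr_discr_le hT hR i)
  have h4 := pr_sparse_le hT hR i x
  have h5 := pr_union_le hq Finset.univ ((A true ∪ A false) ∪ B) (sparse d side D i) x
  have h6 := pr_union_le hq Finset.univ (A true ∪ A false) B x
  have h7 := pr_union_le hq Finset.univ (A true) (A false) x
  linarith

/-- The signatures of different vertices are far from each other. -/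
theorem pr_univ_crossDiff_le (hT : Typical q d D side a θ ℓ D₀) (hR : Regime a s θ ℓ L D₀)
    {i k : Fin n} (hik : i ≠ k) (x : Sym2 (Fin n) → Bool) :
    pr q Finset.univ {z | circ (fun t => |crossDiff d L i k z t|) ≤ 12 * thr s L (D i)} x ≤
      (1 + 8 * n) * Real.exp (-(4 * ℓ)) := by
  have hq := hT.isProb hR.a_pos
  have he := Real.exp_nonneg (-(4 * ℓ))
  set B : Set (Sym2 (Fin n) → Bool) := {z | 1 ≤ 3 * D i * circ (overload q D a L i z)} with hB
  have h := pr_univ_le_add hq (row i)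
    {z | circ (fun t => |crossDiff d L i k z t|) ≤ 12 * thr s L (D i)}
    ((sparse d side D i ∪ dense D i) ∪ B) he x (fun y hy => by
      have hy1 : y ∉ sparse d side D i := fun h => hy (Or.inl (Or.inl h))
      have hy2 : y ∉ dense D i := fun h => hy (Or.inl (Or.inr h))
      have hy3 : y ∉ B := fun h => hy (Or.inr h)
      exact pr_crossDiff_le hT hR hik y (le_cnt_of_notMem_sparse hy1)
        (dOff_lt_of_notMem_dense hy2) (not_le.1 hy3))
  have h1 := pr_sparse_le hT hR i x
  have h2 := pr_dense_le hT hR i x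
  have h3 := pr_overload_le hT hR i x
  have h4 := pr_union_le hq Finset.univ (sparse d side D i ∪ dense D i) B x
  have h5 := pr_union_le hq Finset.univ (sparse d side D i) (dense D i) x
  have h6 : 6 * D i * Real.exp (-(4 * ℓ)) ≤ 6 * n * Real.exp (-(4 * ℓ)) := by
    gcongr; exact hT.D_le i
  linarith

/-- Some vertex is not matched to itself. -/
def mismatch (L : ℝ) (G H : Matrix (Fin n) (Fin n) ℕ) : Prop :=
  ∃ i k, k ≠ i ∧ sigDist L G H i k ≤ sigDist L G H i i

/-- The gap between `10 * τ` and `12 * τ` absorbs the `2 / L` lost in `le_sigDist`. Each vertex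
fails with probability at most `18 * n ^ 2 * n⁻⁴`, one factor `n` coming from the possible partners
`k` and one from the degree events. -/
theorem pr_mismatch_le (hT : Typical q d D side a θ ℓ D₀) (hR : Regime a s θ ℓ L D₀)
    (hn : 1 ≤ n) (hℓ : ℓ = Real.log n) (x : Sym2 (Fin n) → Bool) :
    pr q Finset.univ {z | mismatch L (adj z) (adj (switch d z))} x ≤ 18 / n := by
  have hq := hT.isProb hR.a_pos
  have he := Real.exp_nonneg (-(4 * ℓ))
  have hn' : (1 : ℝ) ≤ n := by exact_mod_cast hn
  have hL : 0 < L := by linarith [hR.le_L]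
  set A : Fin n → Set (Sym2 (Fin n) → Bool) := fun i =>
    {z | 10 * thr s L (D i) ≤ circ (fun t => |sigDiff d L i z t|)} with hA
  set B : Fin n → Set (Sym2 (Fin n) → Bool) := fun i => ⋃ k ∈ Finset.univ.erase i,
    {z | circ (fun t => |crossDiff d L i k z t|) ≤ 12 * thr s L (D i)} with hB
  have hsub : pr q Finset.univ {z | mismatch L (adj z) (adj (switch d z))} x ≤
      pr q Finset.univ (⋃ i ∈ Finset.univ, (A i ∪ B i)) x := by
    refine pr_mono hq _ x fun y hy => ?_
    generalize Finset.univ.piecewise y x = z at *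
    obtain ⟨i, k, hki, h⟩ := hy
    refine Set.mem_biUnion (Finset.mem_coe.2 (Finset.mem_univ i)) ?_
    by_contra hc
    have h1 : z ∉ A i := fun h => hc (Or.inl h)
    have h2 : z ∉ B i := fun h => hc (Or.inr h)
    have h3 : ¬ circ (fun t => |crossDiff d L i k z t|) ≤ 12 * thr s L (D i) := fun hh => h2
      (Set.mem_biUnion (Finset.mem_coe.2 (Finset.mem_erase.2 ⟨hki, Finset.mem_univ _⟩)) hh)
    have h4 := not_le.1 (show ¬ 10 * thr s L (D i) ≤ circ (fun t => |sigDiff d L i z t|) from h1)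
    have h5 := le_sigDist d hL hki.symm z
    rw [sigDist_self] at h
    have h6 := thr_ge hR (hT.le_D i) (show (2 : ℝ) ≤ 6 by norm_num)
    have h7 : 2 / L ≤ 4 * (4 * ℓ) * (2 / L) :=
      le_mul_of_one_le_left (by positivity) (by linarith [hR.one_le_ℓ])
    have h8 := thr_pos hR (hT.D_pos hR i)
    linarith [not_le.1 h3]
  refine hsub.trans ((pr_biUnion_le hq _ _ _ x).trans ?_)
  have hi : ∀ i, pr q Finset.univ (A i ∪ B i) x ≤ 18 * n ^ 2 * Real.exp (-(4 * ℓ)) := by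
    intro i
    have h1 := pr_univ_sigDiff_le hT hR i x
    have h2 : pr q Finset.univ (B i) x ≤ n * ((1 + 8 * n) * Real.exp (-(4 * ℓ))) := by
      refine (pr_biUnion_le hq _ _ _ x).trans
        ((Finset.sum_le_sum fun k hk => ?_).trans (sum_erase_const_le i (by positivity)))
      exact pr_univ_crossDiff_le hT hR (Finset.ne_of_mem_erase hk).symm x
    refine (pr_union_le hq _ _ _ x).trans ((add_le_add h1 h2).trans ?_)
    rw [← mul_assoc, ← add_mul]
    exact mul_le_mul_of_nonneg_right (by nlinarith) he
  refine (Finset.sum_le_sum fun i _ => hi i).trans ?_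
  rw [Finset.sum_const, Finset.card_univ, Fintype.card_fin, nsmul_eq_mul]
  have hexp : Real.exp (-(4 * ℓ)) = ((n : ℝ) ^ 4)⁻¹ := by
    rw [Real.exp_neg, hℓ, show 4 * Real.log n = Real.log (n ^ 4) by rw [Real.log_pow]; norm_num,
      Real.exp_log (by positivity)]
  rw [hexp]
  refine le_of_eq ?_
  field_simp

end

end DegreeProfile

/-! ### The cut and the typicality of the set of differing edges. -/

namespace DegreeProfile

open BitAvg

variable {n : ℕ}

section

/-- A locally optimal cut: at every vertex at least half of the weight goes across. -/
lemma exists_cut (p : Fin n → Fin n → ℝ) (hs : ∀ i j, p i j = p j i) (h0 : ∀ i, p i i = 0) :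
    ∃ side : Fin n → Bool, ∀ j, (∑ l, p j l) / 2 ≤ ∑ l with side l ≠ side j, p j l := by
  set sg : Bool → ℝ := fun b => if b then 1 else -1 with hsg
  -- With sides as signs `±1` this is an Ising energy. At a minimizer no single flip helps, so the
  -- signed weight at `j` towards its own side is at most zero.
  obtain ⟨side, hmin⟩ := Finite.exists_min
    (fun σ : Fin n → Bool => ∑ i, ∑ k, p i k * (sg (σ i) * sg (σ k)))
  refine ⟨side, fun j => ?_⟩
  have hupd : ∀ i, sg (Function.update side j (!side j) i) =
      sg (side i) + (-2 * sg (side j)) * (if i = j then 1 else 0) := by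
    intro i
    by_cases h : i = j
    · subst h; simp only [Function.update_self, hsg, if_true]
      cases side i <;> simp <;> norm_num
    · simp [h]
  have h := hmin (Function.update side j (!side j))
  simp only [hupd] at h
  set c := -2 * sg (side j) with hc
  have hexp : ∑ i, ∑ k, p i k * ((sg (side i) + c * (if i = j then 1 else 0)) *
      (sg (side k) + c * (if k = j then 1 else 0))) =
      ∑ i, ∑ k, p i k * (sg (side i) * sg (side k)) + 2 * c * ∑ l, p j l * sg (side l) := by
    have e1 : ∀ i k, p i k * ((sg (side i) + c * (if i = j then 1 else 0)) *
        (sg (side k) + c * (if k = j then 1 else 0))) =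
        p i k * (sg (side i) * sg (side k)) + (if i = j then c * (p i k * sg (side k)) else 0) +
          (if k = j then c * (p i k * sg (side i)) else 0) +
          (if i = j then if k = j then c ^ 2 * p i k else 0 else 0) := by
      intro i k; split_ifs <;> ring
    simp only [e1, Finset.sum_add_distrib, Finset.sum_ite_eq', Finset.mem_univ, if_true]
    have e2 : ∑ i, ∑ k, (if i = j then c * (p i k * sg (side k)) else 0) =
        c * ∑ l, p j l * sg (side l) := by
      rw [Finset.sum_comm]
      simp [Finset.mul_sum]
    have e3 : ∑ i, ∑ k, (if i = j then if k = j then c ^ 2 * p i k else 0 else 0) = 0 := by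
      rw [Finset.sum_comm]
      simp [h0]
    have e4 : ∑ i, c * (p i j * sg (side i)) = c * ∑ l, p j l * sg (side l) := by
      rw [Finset.mul_sum]
      exact Finset.sum_congr rfl fun i _ => by rw [hs]
    rw [e2, e3, e4]; ring
  rw [hexp] at h
  have h1 : sg (side j) * ∑ l, p j l * sg (side l) ≤ 0 := by rw [hc] at h; linarith
  have h2 : sg (side j) * ∑ l, p j l * sg (side l) =
      ∑ l, p j l - 2 * ∑ l with side l ≠ side j, p j l := by
    rw [Finset.sum_filter, Finset.mul_sum, Finset.mul_sum, ← Finset.sum_sub_distrib]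
    refine Finset.sum_congr rfl fun l _ => ?_
    simp only [hsg]
    cases side j <;> cases side l <;> simp <;> ring
  linarith

lemma diffDeg_eq (d : Sym2 (Fin n) → Bool) (j : Fin n) : diffDeg d j = cnt (row j) d := by
  unfold diffDeg cnt
  rw [sum_row, Finset.card_filter]

/-- The differing edges at a vertex, as a function of the differing edges, are few and well
distributed. -/
structure FewDifferences (p : Sym2 (Fin n) → ℝ) (D : Fin n → ℝ) (η ℓ : ℝ) (d : Sym2 (Fin n) → Bool) :
    Prop where
  diff_lt : ∀ i, diffDeg d i < η * D i / ℓ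
  sum_diff_lt : ∀ i, ∑ j ∈ Finset.univ.erase i, p s(i, j) / D j * diffDeg d j < η * D i / ℓ ^ 2

/-- A pair differs with probability at most `2 * δ * p e`, so both statistics have mean at most `2 *
δ * D i ≤ η * D i / (2 * ℓ ^ 2)`. Bernstein at exponent `2 * ℓ` and a union bound over two events
per vertex give `2 / n`. -/
theorem pr_not_fewDifferences_le {p w : Sym2 (Fin n) → ℝ} {D : Fin n → ℝ} {η ℓ δ D₀ : ℝ}
    (hw : IsProb w) (hp : ∀ e, 0 ≤ p e) (hp1 : ∀ e, p e ≤ 1)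
    (hwp : ∀ e, w e ≤ 2 * δ * p e) (hη : 0 < η) (hη1 : η ≤ 1)
    (hℓ : 1 ≤ ℓ) (hδ : 0 < δ) (hδη : 4 * δ * ℓ ^ 2 ≤ η) (hD₀ : 64 * ℓ ^ 2 ≤ η * D₀)
    (hD : ∀ i, D i = ∑ j ∈ Finset.univ.erase i, p s(i, j)) (hDD : ∀ i, D₀ ≤ D i)
    (hn : 1 ≤ n) (hℓn : ℓ = Real.log n) (x : Sym2 (Fin n) → Bool) :
    pr w Finset.univ {d | ¬ FewDifferences p D η ℓ d} x ≤ 2 / n := by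
  have hD₀pos : 0 < D₀ := by
    by_contra hc
    have : η * D₀ ≤ 0 := mul_nonpos_of_nonneg_of_nonpos hη.le (not_lt.1 hc)
    nlinarith
  have hDpos : ∀ i, 0 < D i := fun i => hD₀pos.trans_le (hDD i)
  have hrow : ∀ i, ∑ e ∈ row i, w e ≤ 2 * δ * D i := by
    intro i
    rw [sum_row, hD, Finset.mul_sum]
    exact Finset.sum_le_sum fun j _ => hwp _
  have hn' : (1 : ℝ) ≤ n := by exact_mod_cast hn
  have hexp : Real.exp (-(2 * ℓ)) = ((n : ℝ) ^ 2)⁻¹ := by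
    rw [Real.exp_neg, hℓn, show 2 * Real.log n = Real.log (n ^ 2) by rw [Real.log_pow]; norm_num,
      Real.exp_log (by positivity)]
  have hA : ∀ i, pr w Finset.univ {d | η * D i / ℓ ≤ diffDeg d i} x ≤ Real.exp (-(2 * ℓ)) := by
    intro i
    have hDi := hDpos i
    -- The factor `3 / 5` cancels the `5 / 3` of `pr_cnt_ge`.
    have hM : 0 < 3 / 5 * (η * D i / ℓ) := by positivity
    have hμ : ∑ e ∈ row i, w e ≤ 3 / 5 * (η * D i / ℓ) := by
      refine (hrow i).trans ?_
      rw [← mul_div_assoc, le_div_iff₀ (by linarith)]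
      have h1 : 4 * δ * ℓ ≤ η := by nlinarith
      nlinarith
    refine (pr_mono hw _ x fun y hy => ?_).trans
      ((pr_cnt_ge hw (Finset.subset_univ (row i)) hM hμ x).trans (Real.exp_le_exp.2 ?_))
    · have hy' : η * D i / ℓ ≤ diffDeg (Finset.univ.piecewise y x) i := hy
      rw [diffDeg_eq] at hy'
      change _ ≤ (cnt (row i) (Finset.univ.piecewise y x) : ℝ)
      linarith
    · have h1 : 64 * ℓ ≤ η * D i / ℓ := by
        rw [le_div_iff₀ (by linarith)]
        have : η * D₀ ≤ η * D i := mul_le_mul_of_nonneg_left (hDD i) hη.le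
        nlinarith
      linarith
  have hB : ∀ i, pr w Finset.univ {d | η * D i / ℓ ^ 2 ≤
      ∑ j ∈ Finset.univ.erase i, p s(i, j) / D j * diffDeg d j} x ≤ Real.exp (-(2 * ℓ)) := by
    intro i
    have hDi := hDpos i
    set f : (Sym2 (Fin n) → Bool) → ℝ := fun d =>
      ∑ j ∈ Finset.univ.erase i, p s(i, j) / D j * diffDeg d j with hf
    set c : Sym2 (Fin n) → ℝ := fun e =>
      ∑ j ∈ Finset.univ.erase i, p s(i, j) / D j * (if e ∈ row j then 1 else 0) with hc
    have hcoef : ∀ j, 0 ≤ p s(i, j) / D j := fun j => div_nonneg (hp _) (hDpos j).le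
    have hc0 : ∀ e, 0 ≤ c e := fun e => Finset.sum_nonneg fun j _ =>
      mul_nonneg (hcoef j) (by split_ifs <;> norm_num)
    -- An edge enters only through its two end points, each with coefficient at most `1 / D₀`.
    have hcm : ∀ e, c e ≤ 2 / D₀ := by
      intro e
      calc c e ≤ ∑ j ∈ Finset.univ.erase i, (if j ∈ e then 1 / D₀ else 0) := by
            refine Finset.sum_le_sum fun j _ => ?_
            by_cases h : e ∈ row j
            · have hj : j ∈ e := by
                obtain ⟨l, -, rfl⟩ := mem_row.1 h; simp
              rw [if_pos h, if_pos hj, mul_one]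
              exact div_le_div₀ zero_le_one (hp1 _) hD₀pos (hDD j)
            · rw [if_neg h, mul_zero]
              split_ifs <;> positivity
        _ ≤ 2 / D₀ := by
            rw [← Finset.sum_filter, Finset.sum_const, nsmul_eq_mul, mul_one_div]
            refine div_le_div_of_nonneg_right ?_ hD₀pos.le
            exact_mod_cast card_filter_mem_le _ e
    have hcw : ∑ e, c e * w e ≤ 2 * δ * D i := by
      calc ∑ e, c e * w e = ∑ j ∈ Finset.univ.erase i, p s(i, j) / D j * ∑ e ∈ row j, w e := by
            simp only [hc, Finset.sum_mul]
            rw [Finset.sum_comm]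
            refine Finset.sum_congr rfl fun j _ => ?_
            simp only [mul_assoc, ← Finset.mul_sum, ite_mul, one_mul, zero_mul]
            rw [Finset.sum_ite_mem, Finset.univ_inter]
        _ ≤ ∑ j ∈ Finset.univ.erase i, p s(i, j) / D j * (2 * δ * D j) :=
            Finset.sum_le_sum fun j _ => mul_le_mul_of_nonneg_left (hrow j) (hcoef j)
        _ = 2 * δ * D i := by
            rw [hD i, Finset.mul_sum]
            refine Finset.sum_congr rfl fun j _ => ?_
            have := (hDpos j).ne'
            field_simp
    have hmean : av w Finset.univ f x ≤ 2 * δ * D i := by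
      unfold av
      simp only [Finset.piecewise_univ, hf, diffDeg_eq]
      rw [ex_sum]
      simp only [ex_const_mul, ex_cnt]
      refine le_trans (le_of_eq ?_) hcw
      simp only [hc, Finset.sum_mul]
      rw [Finset.sum_comm]
      refine Finset.sum_congr rfl fun j _ => ?_
      simp only [mul_assoc, ← Finset.mul_sum, ite_mul, one_mul, zero_mul]
      rw [Finset.sum_ite_mem, Finset.univ_inter]
    have hDD₀ : η * D₀ ≤ η * D i := mul_le_mul_of_nonneg_left (hDD i) hη.le
    have h64 : 64 * ℓ ^ 2 ≤ D₀ := hD₀.trans (mul_le_of_le_one_left hD₀pos.le hη1)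
    have hbern := pr_ge_av_add_le_of_bits hw Finset.univ x f c (fun e _ z => by
        simp only [Finset.piecewise_univ, hf, hc, diffDeg_eq]
        rw [← Finset.sum_sub_distrib]
        refine (Finset.abs_sum_le_sum_abs _ _).trans (Finset.sum_le_sum fun j _ => ?_)
        rw [← mul_sub, abs_mul, abs_of_nonneg (hcoef j)]
        exact mul_le_mul_of_nonneg_left (cnt_update_sub_le (row j) z e) (hcoef j))
      (cm := 2 / D₀) (V := 4 * δ * D i / D₀) (u := η * D i / ℓ ^ 2 / 2) (K := 2 * ℓ)
      (fun e _ => hcm e)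
      (by
        calc ∑ e, c e ^ 2 * w e ≤ ∑ e, 2 / D₀ * (c e * w e) := by
              refine Finset.sum_le_sum fun e _ => ?_
              have := mul_le_mul_of_nonneg_right (hcm e) (mul_nonneg (hc0 e) (hw e).1)
              linarith [this, show c e ^ 2 * w e = c e * (c e * w e) by ring]
          _ ≤ 2 / D₀ * (2 * δ * D i) := by
              rw [← Finset.mul_sum]; gcongr
          _ = 4 * δ * D i / D₀ := by ring)
      (by positivity) (by positivity)
      (by
        have e1 : 4 * (2 * ℓ) * (4 * δ * D i / D₀) = (4 * δ * ℓ ^ 2) * (8 * D i / (ℓ * D₀)) := by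
          field_simp
          ring
        have e2 : (η * D i / ℓ ^ 2 / 2) ^ 2 = η * (η * D i * D i / (4 * ℓ ^ 4)) := by
          field_simp
          ring
        rw [e1, e2]
        refine mul_le_mul hδη ?_ (by positivity) hη.le
        rw [div_le_div_iff₀ (by positivity) (by positivity)]
        have h1 : 64 * ℓ ^ 2 * (ℓ ^ 2) ≤ η * D i * D₀ :=
          mul_le_mul (hD₀.trans hDD₀) (by nlinarith) (by positivity) (by positivity)
        have h2 : 0 ≤ D i * ℓ := by positivity
        have h3 : 64 * ℓ ^ 2 * (ℓ ^ 2) * (D i * ℓ) ≤ η * D i * D₀ * (D i * ℓ) :=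
          mul_le_mul_of_nonneg_right h1 h2
        have h4 : 0 ≤ D i * ℓ ^ 4 * (ℓ - 1) := mul_nonneg (by positivity) (by linarith)
        have h5 : 0 ≤ D i * ℓ ^ 4 := by positivity
        nlinarith)
      (by
        rw [le_div_iff₀ (by positivity), le_div_iff₀ (by positivity)]
        have e1 : 4 * (2 * ℓ) * (2 / D₀) * 2 * ℓ ^ 2 = 32 * ℓ * ℓ ^ 2 / D₀ := by ring
        rw [e1, div_le_iff₀ hD₀pos]
        have h1 : 64 * ℓ ^ 2 * (64 * ℓ ^ 2) ≤ η * D i * D₀ :=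
          mul_le_mul (hD₀.trans hDD₀) h64 (by positivity) (by positivity)
        have h2 : ℓ * ℓ ^ 2 ≤ ℓ ^ 2 * ℓ ^ 2 := by
          apply mul_le_mul_of_nonneg_right _ (by positivity); nlinarith
        have h3 : 0 ≤ ℓ ^ 2 * ℓ ^ 2 := by positivity
        linarith)
    refine (pr_mono hw _ x fun y hy => ?_).trans hbern
    have hy' : η * D i / ℓ ^ 2 ≤ f (Finset.univ.piecewise y x) := hy
    change av w Finset.univ f x + η * D i / ℓ ^ 2 / 2 ≤ f _
    have : 2 * δ * D i ≤ η * D i / ℓ ^ 2 / 2 := by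
      rw [le_div_iff₀ (by positivity), le_div_iff₀ (by positivity)]
      have := mul_le_mul_of_nonneg_right hδη hDi.le
      linarith
    linarith
  have hsub := pr_mono hw Finset.univ x (A := {d | ¬ FewDifferences p D η ℓ d})
    (B := ⋃ i ∈ Finset.univ, ({d | η * D i / ℓ ≤ diffDeg d i} ∪ {d | η * D i / ℓ ^ 2 ≤
      ∑ j ∈ Finset.univ.erase i, p s(i, j) / D j * diffDeg d j})) (fun y hy => by
      generalize Finset.univ.piecewise y x = z at *
      by_contra hc
      refine hy ⟨fun i => not_le.1 fun h => hc ?_, fun i => not_le.1 fun h => hc ?_⟩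
      · exact Set.mem_biUnion (Finset.mem_coe.2 (Finset.mem_univ i)) (Or.inl h)
      · exact Set.mem_biUnion (Finset.mem_coe.2 (Finset.mem_univ i)) (Or.inr h))
  refine hsub.trans ((pr_biUnion_le hw _ _ _ x).trans ((Finset.sum_le_sum fun i _ =>
    (pr_union_le hw _ _ _ x).trans (add_le_add (hA i) (hB i))).trans ?_))
  rw [Finset.sum_const, Finset.card_univ, Fintype.card_fin, nsmul_eq_mul, hexp]
  refine le_of_eq ?_
  field_simp
  norm_num

/-- The conditional probability of an edge in the first graph, given whether the graphs differ
there. -/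
noncomputable def condProb (p ε : Sym2 (Fin n) → ℝ) (d : Sym2 (Fin n) → Bool)
    (e : Sym2 (Fin n)) : ℝ :=
  if d e then 1 / 2 else p e * (1 - ε e) / (1 - 2 * p e * ε e)

lemma condProb_bounds {p ε a δ : ℝ} (hp : 0 ≤ p) (hp1 : p ≤ 1 - 2 * a) (hε : 0 ≤ ε)
    (hεδ : ε ≤ δ) (hδa : δ ≤ a) (ha : 0 < a) (hδ : δ ≤ 1 / 4) :
    p / 2 ≤ p * (1 - ε) / (1 - 2 * p * ε) ∧ p * (1 - ε) / (1 - 2 * p * ε) ≤ 2 * p ∧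
      a ≤ 1 - p * (1 - ε) / (1 - 2 * p * ε) := by
  have h1 : p * ε ≤ ε := by nlinarith
  have h0 : 0 ≤ p * ε := by positivity
  have hden : 0 < 1 - 2 * p * ε := by nlinarith
  refine ⟨?_, ?_, ?_⟩
  · rw [le_div_iff₀ hden]; nlinarith [mul_nonneg hp h0]
  · rw [div_le_iff₀ hden]; nlinarith
  · rw [le_sub_comm, div_le_iff₀ hden]; nlinarith

/-- Conditioning changes the probabilities by at most a factor 2, except on the differing edges,
where they become `1 / 2` however small they were. The latter are few at each vertex. -/
theorem typical_of_fewDifferences {p ε : Sym2 (Fin n) → ℝ} {D : Fin n → ℝ} {a θ ℓ δ D₀ : ℝ}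
    {d : Sym2 (Fin n) → Bool} {side : Fin n → Bool}
    (hp : ∀ e, 0 ≤ p e) (hp1 : ∀ e, p e ≤ 1 - 2 * a) (hε : ∀ e, 0 ≤ ε e) (hεδ : ∀ e, ε e ≤ δ)
    (hδa : δ ≤ a) (ha : 0 < a) (ha2 : a ≤ 1 / 2) (hδ : δ ≤ 1 / 4) (hℓ : 1 ≤ ℓ)
    (hθ : 0 < θ) (hθ1 : θ ≤ 1) (hD₀ : 8 ≤ D₀)
    (hD : ∀ i, D i = ∑ j ∈ Finset.univ.erase i, p s(i, j)) (hDD : ∀ i, D₀ ≤ D i)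
    (hside : ∀ j, D j / 2 ≤ ∑ l with side l ≠ side j, p s(j, l))
    (hd : FewDifferences p D (θ ^ 2 / 8) ℓ d) : Typical (condProb p ε d) d D side a θ ℓ D₀ := by
  have hb := fun e => condProb_bounds (hp e) (hp1 e) (hε e) (hεδ e) hδa ha hδ
  have hple : ∀ e, p e ≤ 1 := fun e => by linarith [hp1 e]
  have hDpos : ∀ i, 0 < D i := fun i => by linarith [hDD i]
  have hθ2 : θ ^ 2 ≤ 1 := pow_le_one₀ hθ.le hθ1
  have hθ2pos : 0 < θ ^ 2 := by positivity
  have hlow : ∀ e, p e / 2 ≤ condProb p ε d e := by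
    intro e; unfold condProb; split_ifs
    · linarith [hple e]
    · exact (hb e).1
  have hnn : ∀ e, 0 ≤ condProb p ε d e := fun e => by linarith [hlow e, hp e]
  have hup : ∀ e, condProb p ε d e ≤ 2 * p e + (if d e = true then 1 / 2 else 0) := by
    intro e; unfold condProb; split_ifs
    · linarith [hp e]
    · linarith [(hb e).2.1]
  have hdiff : ∀ i, ∑ j ∈ Finset.univ.erase i, (if d s(i, j) = true then (1 : ℝ) / 2 else 0) =
      diffDeg d i / 2 := by
    intro i
    rw [← Finset.sum_filter, Finset.sum_const, nsmul_eq_mul, diffDeg]; ring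
  have hdle : ∀ i, diffDeg d i ≤ D i / 8 := by
    intro i
    refine (hd.diff_lt i).le.trans ?_
    rw [div_le_iff₀ (by linarith)]
    have := mul_le_mul_of_nonneg_right hθ2 (hDpos i).le
    nlinarith [hDpos i]
  refine ⟨hnn, ?_, ?_, hDD, ?_, ?_, ?_, ?_, ?_, ?_⟩
  · intro e; unfold condProb; split_ifs
    · linarith
    · exact (hb e).2.2
  · intro e he; simp [condProb, he]
  · intro i
    rw [hD]
    refine (Finset.sum_le_sum fun j _ => hple _).trans ((sum_erase_const_le i zero_le_one).trans ?_)
    rw [mul_one]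
  · intro i
    refine (Finset.sum_le_sum fun j _ => hup _).trans ?_
    rw [Finset.sum_add_distrib, hdiff, ← Finset.mul_sum, ← hD]
    linarith [hdle i, hDpos i]
  · intro i
    rw [hD, Finset.sum_div]
    exact Finset.sum_le_sum fun j _ => hlow _
  · intro i j
    rw [sum_cross]
    -- From the crossing weight `D j / 2`, excluding `i` costs at most 1 and the differing edges at
    -- most `D j / 8`. The factor 2 then leaves `D j / 8`, as `D j ≥ 8`.
    have h1 : ∑ l with side l ≠ side j, p s(j, l) ≤
        2 * (∑ l with side l ≠ side j ∧ l ≠ i ∧ d s(j, l) = false, condProb p ε d s(j, l)) +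
          (1 + diffDeg d j) := by
      have e1 : diffDeg d j = ∑ l, if l ≠ j ∧ d s(j, l) = true then (1 : ℝ) else 0 := by
        unfold diffDeg
        rw [Finset.card_filter, ← Finset.filter_ne', Finset.sum_filter]
        push_cast
        refine Finset.sum_congr rfl fun l _ => ?_
        by_cases h : l = j <;> simp [h]
      have e2 : (1 : ℝ) = ∑ l, if l = i then (1 : ℝ) else 0 := by simp
      rw [e1]
      conv_rhs => rw [e2]
      rw [Finset.sum_filter, Finset.sum_filter, Finset.mul_sum, ← Finset.sum_add_distrib,
        ← Finset.sum_add_distrib]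
      refine Finset.sum_le_sum fun l _ => ?_
      have hl := hlow s(j, l)
      have hpl := hple s(j, l)
      have hp0 := hp s(j, l)
      have hlj : side l ≠ side j → l ≠ j := fun h h' => h (h' ▸ rfl)
      by_cases h1 : side l ≠ side j
      · have h2 := hlj h1
        by_cases h3 : l = i
        · subst h3
          simp only [h1, ne_eq, not_true_eq_false, false_and, and_false, if_true, if_false,
            not_false_eq_true, h2, true_and]
          split_ifs <;> linarith
        · cases h4 : d s(j, l)
          · simp only [h1, h2, h3, ne_eq, not_false_eq_true, and_self, if_true, if_false,
              Bool.false_eq_true, and_false]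
            linarith
          · simp only [h1, h2, h3, ne_eq, not_false_eq_true, and_self, if_true, if_false,
              Bool.true_eq_false, and_false]
            linarith
      · simp only [h1, if_false, false_and]
        positivity
    linarith [hside j, hdle j, hDD j]
  · intro i
    refine (hd.diff_lt i).le.trans ?_
    have := hDpos i
    gcongr
    linarith
  · intro i
    have hterm : ∀ j ∈ Finset.univ.erase i, condProb p ε d s(i, j) * (diffDeg d j / D j) ≤
        2 * (p s(i, j) / D j * diffDeg d j) +
          (if d s(i, j) = true then (1 : ℝ) / 2 else 0) * (θ ^ 2 / 8 / ℓ) := by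
      intro j _
      have h1 : 0 ≤ diffDeg d j / D j := div_nonneg (diffDeg_nonneg _ _) (hDpos j).le
      have h2 : diffDeg d j / D j ≤ θ ^ 2 / 8 / ℓ := by
        rw [div_le_iff₀ (hDpos j)]
        refine (hd.diff_lt j).le.trans_eq ?_
        ring
      have h3 : 0 ≤ (if d s(i, j) = true then (1 : ℝ) / 2 else 0) := by split_ifs <;> norm_num
      calc condProb p ε d s(i, j) * (diffDeg d j / D j)
          ≤ (2 * p s(i, j) + (if d s(i, j) = true then 1 / 2 else 0)) * (diffDeg d j / D j) :=
            mul_le_mul_of_nonneg_right (hup _) h1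
        _ = 2 * (p s(i, j) / D j * diffDeg d j) +
            (if d s(i, j) = true then (1 : ℝ) / 2 else 0) * (diffDeg d j / D j) := by ring
        _ ≤ _ := by gcongr
    refine (Finset.sum_le_sum hterm).trans ?_
    rw [Finset.sum_add_distrib, ← Finset.mul_sum, ← Finset.sum_mul, hdiff]
    have h1 := (hd.sum_diff_lt i).le
    have h2 := (hd.diff_lt i).le
    have h3 : diffDeg d i / 2 * (θ ^ 2 / 8 / ℓ) ≤
        θ ^ 2 / 8 * D i / ℓ / 2 * (θ ^ 2 / 8 / ℓ) := by gcongr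
    have h4 : θ ^ 2 / 8 * D i / ℓ / 2 * (θ ^ 2 / 8 / ℓ) = θ ^ 2 * (θ ^ 2 * D i / ℓ ^ 2) / 128 := by
      field_simp; ring
    have h5 : θ ^ 2 / 8 * D i / ℓ ^ 2 = θ ^ 2 * D i / ℓ ^ 2 / 8 := by ring
    have h6 : 0 ≤ θ ^ 2 * D i / ℓ ^ 2 := by have := hDpos i; positivity
    have h7 : θ ^ 2 * (θ ^ 2 * D i / ℓ ^ 2) ≤ θ ^ 2 * D i / ℓ ^ 2 :=
      mul_le_of_le_one_left h6 hθ2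
    rw [h5] at h1
    linarith

end

end DegreeProfile

/-! ### From the probability space to independent bits. -/

namespace DegreeProfile

open BitAvg

variable {n : ℕ}

/-- The edges of a symmetric matrix. -/
def edges (M : Matrix (Fin n) (Fin n) ℕ) (h : M.IsSymm) : Sym2 (Fin n) → Bool :=
  Sym2.lift ⟨fun i j => decide (M i j = 1), fun i j =>
    congrArg (fun m : ℕ => decide (m = 1)) (h.apply j i)⟩

lemma edges_mk {M : Matrix (Fin n) (Fin n) ℕ} (h : M.IsSymm) (i j : Fin n) :
    edges M h s(i, j) = decide (M i j = 1) := rfl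

lemma adj_edges {M : Matrix (Fin n) (Fin n) ℕ} (h : M.IsSymm) (h01 : ∀ i j, M i j = 0 ∨ M i j = 1)
    (hd : ∀ i, M i i ≠ 1) : adj (edges M h) = M := by
  ext i j
  simp only [adj, Matrix.of_apply, edges_mk, decide_eq_true_eq]
  by_cases hij : i = j
  · subst hij
    rw [if_neg (by simp)]
    exact ((h01 i i).resolve_right (hd i)).symm
  · rcases h01 i j with h | h <;> simp [hij, h]

lemma switch_eq_iff {d z z' : Sym2 (Fin n) → Bool} :
    z' = switch d z ↔ d = switch z' z := by
  constructor <;> rintro rfl <;> ext e <;> simp [switch]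

section

variable {Ω : Type*} [MeasurableSpace Ω] {P : Measure Ω} [IsProbabilityMeasure P]

/-- The joint law of two bits with equal marginals. -/
lemma real_bits_eq {X Y : Ω → ℕ} (hX : Measurable X) (hY : Measurable Y)
    (hX01 : ∀ ω, X ω = 0 ∨ X ω = 1) (hY01 : ∀ ω, Y ω = 0 ∨ Y ω = 1) {p c : ℝ}
    (h1 : P.real {ω | X ω = 1} = p) (h10 : P.real {ω | X ω = 1 ∧ Y ω = 0} = c)
    (h01 : P.real {ω | X ω = 0 ∧ Y ω = 1} = c) (b b' : Bool) :
    P.real {ω | decide (X ω = 1) = b ∧ decide (Y ω = 1) = b'} =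
      if xor b b' then c else if b then p - c else 1 - p - c := by
  have mX : ∀ k, MeasurableSet {ω | X ω = k} := fun k => hX (measurableSet_singleton k)
  have mY : ∀ k, MeasurableSet {ω | Y ω = k} := fun k => hY (measurableSet_singleton k)
  have e11 : P.real {ω | X ω = 1 ∧ Y ω = 1} = p - c := by
    have h := measureReal_inter_add_sdiff (μ := P) (s := {ω | X ω = 1}) (mY 0)
    have e : {ω | X ω = 1} \ {ω | Y ω = 0} = {ω | X ω = 1 ∧ Y ω = 1} := by
      ext ω
      have := hY01 ω
      change (X ω = 1 ∧ ¬ Y ω = 0) ↔ (X ω = 1 ∧ Y ω = 1)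
      omega
    have e' : {ω | X ω = 1} ∩ {ω | Y ω = 0} = {ω | X ω = 1 ∧ Y ω = 0} := rfl
    rw [e, e', h1, h10] at h
    linarith
  have e00 : P.real {ω | X ω = 0 ∧ Y ω = 0} = 1 - p - c := by
    have h := measureReal_inter_add_sdiff (μ := P) (s := {ω | X ω = 0}) (mY 1)
    have e : {ω | X ω = 0} \ {ω | Y ω = 1} = {ω | X ω = 0 ∧ Y ω = 0} := by
      ext ω
      have := hY01 ω
      change (X ω = 0 ∧ ¬ Y ω = 1) ↔ (X ω = 0 ∧ Y ω = 0)
      omega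
    have e' : {ω | X ω = 0} ∩ {ω | Y ω = 1} = {ω | X ω = 0 ∧ Y ω = 1} := rfl
    have h0 : P.real {ω | X ω = 0} = 1 - p := by
      have h' := probReal_compl_eq_one_sub (μ := P) (mX 1)
      rw [h1] at h'
      rw [← h']
      congr 1
      ext ω
      have := hX01 ω
      change X ω = 0 ↔ ¬ X ω = 1
      omega
    rw [e, e', h0, h01] at h
    linarith
  have conv : ∀ Z : Ω → ℕ, (∀ ω, Z ω = 0 ∨ Z ω = 1) → ∀ ω, ¬ Z ω = 1 ↔ Z ω = 0 := by
    intro Z hZ ω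
    have := hZ ω
    omega
  cases b <;> cases b' <;>
    simp only [decide_eq_true_eq, decide_eq_false_iff_not, conv X hX01, conv Y hY01,
      Bool.xor_false, Bool.xor_true, Bool.not_true, Bool.not_false, if_true, if_false,
      Bool.false_eq_true] <;> assumption

variable {G H : Ω → Matrix (Fin n) (Fin n) ℕ}

/-- The joint law of the two graphs, in terms of the edges on which they differ. -/
lemma real_edges_eq (hGm : ∀ i j, Measurable fun ω => G ω i j)
    (hHm : ∀ i j, Measurable fun ω => H ω i j)
    (hG : ∀ ω i j, G ω i j = 0 ∨ G ω i j = 1) (hH : ∀ ω i j, H ω i j = 0 ∨ H ω i j = 1)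
    (hGs : ∀ ω, (G ω).IsSymm) (hHs : ∀ ω, (H ω).IsSymm)
    (hind : iIndepFun (fun (e : {e : Fin n × Fin n // e.1 ≤ e.2}) ω =>
      (G ω e.1.1 e.1.2, H ω e.1.1 e.1.2)) P) (p ε : Sym2 (Fin n) → ℝ)
    (h1 : ∀ i j, i ≤ j → P.real {ω | G ω i j = 1} = p s(i, j))
    (h10 : ∀ i j, i ≤ j → P.real {ω | G ω i j = 1 ∧ H ω i j = 0} = p s(i, j) * ε s(i, j))
    (h01 : ∀ i j, i ≤ j → P.real {ω | G ω i j = 0 ∧ H ω i j = 1} = p s(i, j) * ε s(i, j))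
    (hne : ∀ e, 1 - 2 * p e * ε e ≠ 0) (d z : Sym2 (Fin n) → Bool) :
    P.real {ω | edges (G ω) (hGs ω) = z ∧ edges (H ω) (hHs ω) = switch d z} =
      wt (fun e => 2 * p e * ε e) d * wt (condProb p ε d) z := by
  -- Independence is given over ordered pairs `i ≤ j`; sorting identifies these with unordered
  -- pairs.
  have hind' := hind.precomp (Sym2.sortEquiv (α := Fin n)).injective
  set A : Sym2 (Fin n) → Set (ℕ × ℕ) := fun e =>
    {m | decide (m.1 = 1) = z e ∧ decide (m.2 = 1) = switch d z e} with hA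
  have h := hind'.measure_inter_preimage_eq_mul Finset.univ (sets := A)
    (fun e _ => MeasurableSet.of_discrete)
  have key : ∀ e : Sym2 (Fin n), ∃ i j : Fin n, i ≤ j ∧ e = s(i, j) ∧
      ((Sym2.sortEquiv e : {e : Fin n × Fin n // e.1 ≤ e.2}) : Fin n × Fin n) = (i, j) := by
    intro e
    refine ⟨_, _, (Sym2.sortEquiv e).2, ?_, rfl⟩
    exact (Sym2.sortEquiv.symm_apply_apply e).symm
  have hset : {ω | edges (G ω) (hGs ω) = z ∧ edges (H ω) (hHs ω) = switch d z} =
      ⋂ e ∈ (Finset.univ : Finset (Sym2 (Fin n))), (fun ω =>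
        (G ω (Sym2.sortEquiv e).1.1 (Sym2.sortEquiv e).1.2,
          H ω (Sym2.sortEquiv e).1.1 (Sym2.sortEquiv e).1.2)) ⁻¹' A e := by
    ext ω
    simp only [Finset.mem_univ, Set.iInter_true, Set.mem_iInter]
    change (edges (G ω) (hGs ω) = z ∧ edges (H ω) (hHs ω) = switch d z) ↔ ∀ e,
      (decide (G ω (Sym2.sortEquiv e).1.1 (Sym2.sortEquiv e).1.2 = 1) = z e ∧
        decide (H ω (Sym2.sortEquiv e).1.1 (Sym2.sortEquiv e).1.2 = 1) = switch d z e)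
    rw [funext_iff, funext_iff, ← forall_and]
    refine forall_congr' fun e => ?_
    obtain ⟨i, j, -, he, hs⟩ := key e
    rw [hs]
    subst he
    rfl
  unfold wt
  rw [hset, measureReal_def, h, ENNReal.toReal_prod, ← Finset.prod_mul_distrib]
  refine Finset.prod_congr rfl fun e _ => ?_
  obtain ⟨i, j, hij, he, hs⟩ := key e
  have hlaw := real_bits_eq (hGm i j) (hHm i j) (fun ω => hG ω i j) (fun ω => hH ω i j)
    (h1 i j hij) (h10 i j hij) (h01 i j hij) (z e) (switch d z e)
  rw [← he] at hlaw
  have e2 : (P ((fun ω => (G ω (Sym2.sortEquiv e).1.1 (Sym2.sortEquiv e).1.2,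
      H ω (Sym2.sortEquiv e).1.1 (Sym2.sortEquiv e).1.2)) ⁻¹' A e)).toReal =
      P.real {ω | decide (G ω i j = 1) = z e ∧ decide (H ω i j = 1) = switch d z e} := by
    rw [hs]; rfl
  refine e2.trans (hlaw.trans ?_)
  have hr := mul_div_cancel₀ (p e * (1 - ε e)) (hne e)
  rw [mul_comm, div_mul_eq_mul_div, mul_div_assoc] at hr
  unfold switch condProb
  cases d e <;> cases z e <;>
    simp only [Bool.xor_false, Bool.xor_true, Bool.xor_self, Bool.not_true, Bool.not_false,
      if_true, if_false, Bool.false_eq_true]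
  · linear_combination hr
  · linear_combination -hr
  · ring
  · ring

/-- The probability of a mismatch is the average over `d` of its conditional probability. For a
typical `d` this is at most `18 / n`, otherwise it is bounded by 1; the atypical `d` cost `2 / n`.
The two last hypotheses are those of `pr_not_fewDifferences_le` with `η = θ ^ 2 / 8`. -/
theorem real_mismatch_le (hn : 1 ≤ n) {α dmin δ a s θ ℓ L : ℝ}
    (hcorr : EdgeCorrelated P G H α dmin δ) (hα : α = 2 * a) (hδpos : 0 < δ) (hδa : δ ≤ a)
    (hδ : δ ≤ 1 / 4) (hR : Regime a s θ ℓ L dmin) (hℓ : ℓ = Real.log n)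
    (hδθ : 32 * δ * ℓ ^ 2 ≤ θ ^ 2) (hdθ : 512 * ℓ ^ 2 ≤ θ ^ 2 * dmin) :
    P.real {ω | mismatch L (G ω) (H ω)} ≤ 20 / n := by
  obtain ⟨hGm, hHm, hG, hH, hGs, hHs, hind, p, ε, hp, hps, hp0, hpG, hε, hεs, hε0, hpε, hpd⟩ :=
    hcorr
  set p' : Sym2 (Fin n) → ℝ := Sym2.lift ⟨p, hps⟩ with hp'
  set ε' : Sym2 (Fin n) → ℝ := Sym2.lift ⟨ε, hεs⟩ with hε'
  have ha := hR.a_pos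
  have bp : ∀ e, 0 ≤ p' e ∧ p' e ≤ 1 - 2 * a := fun e => by
    induction e using Sym2.ind with
    | _ i j => exact hα ▸ hp i j
  have bε : ∀ e, 0 ≤ ε' e ∧ ε' e ≤ δ := fun e => by
    induction e using Sym2.ind with
    | _ i j => exact hε i j
  have bpe : ∀ e, 0 ≤ p' e * ε' e ∧ p' e * ε' e ≤ δ * p' e := fun e =>
    ⟨mul_nonneg (bp e).1 (bε e).1, by nlinarith [(bp e).1, (bε e).2]⟩
  have bp1 : ∀ e, p' e ≤ 1 := fun e => by linarith [(bp e).2]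
  set w : Sym2 (Fin n) → ℝ := fun e => 2 * p' e * ε' e with hwdef
  have hw : IsProb w := fun e => ⟨by simp only [hwdef]; linarith [(bpe e).1], by
    have := (bpe e).2
    have := bp1 e
    have := (bp e).1
    simp only [hwdef]; nlinarith⟩
  have hne : ∀ e, 1 - 2 * p' e * ε' e ≠ 0 := fun e => by
    have := (bpe e).2
    have := bp1 e
    have := (bp e).1
    nlinarith
  have hlaw := real_edges_eq hGm hHm hG hH hGs hHs hind p' ε' (fun i j hij => (hpG i j hij).1)
    (fun i j hij => (hpε i j hij).1) (fun i j hij => (hpε i j hij).2) hne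
  set D : Fin n → ℝ := fun i => ∑ j ∈ Finset.univ.erase i, p' s(i, j) with hDdef
  have hDp : ∀ i, D i = ∑ j, p i j := by
    intro i
    rw [← Finset.sum_erase_add _ _ (Finset.mem_univ i), hp0, add_zero]
    rfl
  have hDD : ∀ i, dmin ≤ D i := fun i => (hDp i).symm ▸ hpd i
  obtain ⟨side, hside⟩ := exists_cut p hps hp0
  have hside' : ∀ j, D j / 2 ≤ ∑ l with side l ≠ side j, p' s(j, l) := fun j =>
    (hDp j).symm ▸ hside j
  have hθ2 : θ ^ 2 ≤ 1 := pow_le_one₀ hR.θ_pos.le hR.θ_le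
  have hθ2pos : 0 < θ ^ 2 := pow_pos hR.θ_pos 2
  set x₀ : Sym2 (Fin n) → Bool := fun _ => false with hx₀
  have hfew := pr_not_fewDifferences_le (η := θ ^ 2 / 8) (ℓ := ℓ) (δ := δ) (D₀ := dmin) (D := D) hw
    (fun e => (bp e).1) bp1 (fun e => by have := (bpe e).2; simp only [hwdef]; linarith)
    (by linarith) (by linarith) hR.one_le_ℓ hδpos (by linarith) (by linarith)
    (fun i => rfl) hDD hn hℓ x₀
  set B : (Sym2 (Fin n) → Bool) → Set (Sym2 (Fin n) → Bool) := fun d =>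
    {z | mismatch L (adj z) (adj (switch d z))} with hB
  have hcond : ∀ d, pr (condProb p' ε' d) Finset.univ (B d) x₀ ≤
      18 / n + ({d | ¬ FewDifferences p' D (θ ^ 2 / 8) ℓ d} : Set _).indicator 1 d := by
    intro d
    have h18 : (0 : ℝ) ≤ 18 / n := by positivity
    by_cases hd : FewDifferences p' D (θ ^ 2 / 8) ℓ d
    · have hT := typical_of_fewDifferences (side := side) (fun e => (bp e).1) (fun e => (bp e).2)
        (fun e => (bε e).1) (fun e => (bε e).2) hδa ha hR.a_le hδ hR.one_le_ℓ hR.θ_pos hR.θ_le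
        (by linarith [hR.le_D]) (fun i => rfl) hDD hside' hd
      refine (pr_mismatch_le hT hR hn hℓ x₀).trans (le_add_of_nonneg_right ?_)
      exact indicator_one_nonneg _ _
    · rw [Set.indicator_of_mem (show d ∈ {d | ¬ FewDifferences p' D (θ ^ 2 / 8) ℓ d} from hd)]
      have hq : IsProb (condProb p' ε' d) := by
        intro e
        have hb := condProb_bounds (bp e).1 (bp e).2 (bε e).1 (bε e).2 hδa ha hδ
        unfold condProb
        split_ifs
        · norm_num
        · exact ⟨by linarith [(bp e).1], by linarith⟩
      refine (pr_le_one hq _ _ _).trans ?_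
      simpa using h18
  classical
  -- The diagonal entries vanish only almost surely, while `adj` discards the diagonal; this null
  -- set accounts for the difference.
  set N : Set Ω := ⋃ i ∈ (Finset.univ : Finset (Fin n)), ({ω | G ω i i = 1} ∪ {ω | H ω i i = 1})
    with hN
  have hN0 : P.real N ≤ 0 := by
    refine (measureReal_biUnion_finset_le _ _).trans (Finset.sum_nonpos fun i _ => ?_)
    refine (measureReal_union_le _ _).trans ?_
    rw [(hpG i i le_rfl).1, (hpG i i le_rfl).2, hp0]; norm_num
  set I : Finset ((Sym2 (Fin n) → Bool) × (Sym2 (Fin n) → Bool)) :=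
    Finset.univ.filter fun y => y.2 ∈ B y.1 with hI
  have hsub : {ω | mismatch L (G ω) (H ω)} ⊆ N ∪ ⋃ y ∈ I,
      {ω | edges (G ω) (hGs ω) = y.2 ∧ edges (H ω) (hHs ω) = switch y.1 y.2} := by
    intro ω hω
    by_cases hωN : ω ∈ N
    · exact Or.inl hωN
    refine Or.inr ?_
    have hd : ∀ i, G ω i i ≠ 1 ∧ H ω i i ≠ 1 := by
      intro i
      rw [← not_or]
      exact fun h => hωN (Set.mem_biUnion (Finset.mem_coe.2 (Finset.mem_univ i)) h)
    have eG := adj_edges (hGs ω) (hG ω) fun i => (hd i).1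
    have eH := adj_edges (hHs ω) (hH ω) fun i => (hd i).2
    have hsw : edges (H ω) (hHs ω) =
        switch (switch (edges (H ω) (hHs ω)) (edges (G ω) (hGs ω))) (edges (G ω) (hGs ω)) :=
      switch_eq_iff.2 rfl
    refine Set.mem_biUnion (x := (switch (edges (H ω) (hHs ω)) (edges (G ω) (hGs ω)),
      edges (G ω) (hGs ω))) (Finset.mem_coe.2 (Finset.mem_filter.2 ⟨Finset.mem_univ _, ?_⟩))
      ⟨rfl, hsw⟩
    change mismatch L (adj (edges (G ω) (hGs ω))) (adj (switch (switch (edges (H ω) (hHs ω))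
      (edges (G ω) (hGs ω))) (edges (G ω) (hGs ω))))
    rw [← hsw, eG, eH]
    exact hω
  calc P.real {ω | mismatch L (G ω) (H ω)}
      ≤ P.real N + ∑ y ∈ I, P.real {ω | edges (G ω) (hGs ω) = y.2 ∧
          edges (H ω) (hHs ω) = switch y.1 y.2} :=
        (measureReal_mono hsub).trans ((measureReal_union_le _ _).trans
          (add_le_add_right (measureReal_biUnion_finset_le _ _) _))
    _ ≤ ∑ y ∈ I, wt w y.1 * wt (condProb p' ε' y.1) y.2 := by
        rw [Finset.sum_congr rfl fun y _ => hlaw y.1 y.2]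
        linarith
    _ = ex w (fun d => pr (condProb p' ε' d) Finset.univ (B d) x₀) := by
        rw [hI, Finset.sum_filter, Fintype.sum_prod_type]
        unfold pr av ex
        refine Finset.sum_congr rfl fun d _ => ?_
        rw [Finset.mul_sum]
        refine Finset.sum_congr rfl fun z _ => ?_
        beta_reduce
        rw [Finset.piecewise_univ]
        by_cases hz : z ∈ B d
        · rw [if_pos hz, Set.indicator_of_mem hz]; simp
        · rw [if_neg hz, Set.indicator_of_notMem hz]; simp
    _ ≤ ex w (fun d => 18 / n + ({d | ¬ FewDifferences p' D (θ ^ 2 / 8) ℓ d} : Set _).indicator 1 d) :=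
        ex_mono hw hcond
    _ = 18 / n + pr w Finset.univ {d | ¬ FewDifferences p' D (θ ^ 2 / 8) ℓ d} x₀ := by
        rw [ex_add, ex_const]
        unfold pr av
        simp only [Finset.piecewise_univ]
    _ ≤ 18 / n + 2 / n := by gcongr
    _ = 20 / n := by ring

end

end DegreeProfile

/-! ### Relabelling and the choice of constants. -/

namespace DegreeProfile

variable {n : ℕ}

lemma sigDist_perm (L : ℝ) (G H : Matrix (Fin n) (Fin n) ℕ) (π : Equiv.Perm (Fin n))
    (i k : Fin n) :
    sigDist L G (Matrix.of fun i j => H (π⁻¹ i) (π⁻¹ j)) i k = sigDist L G H i (π⁻¹ k) := by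
  have hdeg : ∀ j, deg (Matrix.of fun i j => H (π⁻¹ i) (π⁻¹ j)) j = deg H (π⁻¹ j) := fun j =>
    Equiv.sum_comp π⁻¹ fun l => H (π⁻¹ j) l
  have hball : ∀ t, ∑ j, ball L (Matrix.of fun i j => H (π⁻¹ i) (π⁻¹ j)) k j t =
      ∑ j, ball L H (π⁻¹ k) j t := by
    intro t
    rw [← Equiv.sum_comp π⁻¹ fun j => ball L H (π⁻¹ k) j t]
    refine Finset.sum_congr rfl fun j _ => ?_
    unfold ball
    rw [hdeg]
    rfl
  unfold sigDist
  simp only [hball]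

/-- Relabelling the second graph permutes the distances, so if every vertex is strictly closest to
itself then all permutations are recovered simultaneously. The event for all `π` thus costs nothing
extra. -/
lemma graphMatching_perm {L : ℝ} {G H : Matrix (Fin n) (Fin n) ℕ} (h : ¬ mismatch L G H)
    (π : Equiv.Perm (Fin n)) :
    graphMatching L G (Matrix.of fun i j => H (π⁻¹ i) (π⁻¹ j)) = some π := by
  have hlt : ∀ i k, k ≠ i → sigDist L G H i i < sigDist L G H i k := fun i k hk =>
    not_le.1 fun hle => h ⟨i, k, hk, hle⟩
  have hiff : ∀ i k, (∀ l, sigDist L G (Matrix.of fun i j => H (π⁻¹ i) (π⁻¹ j)) i k ≤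
      sigDist L G (Matrix.of fun i j => H (π⁻¹ i) (π⁻¹ j)) i l) ↔ k = π i := by
    intro i k
    simp only [sigDist_perm]
    constructor
    · intro hk
      by_contra hne
      refine (hlt i (π⁻¹ k) fun h => hne ?_).not_ge ?_
      · rw [← h]; simp
      · simpa using hk (π i)
    · rintro rfl l
      rw [show π⁻¹ (π i) = i from π.symm_apply_apply i]
      by_cases hl : π⁻¹ l = i
      · rw [hl]
      · exact (hlt i _ hl).le
  have hex : ∀ i, ∃! k, ∀ l, sigDist L G (Matrix.of fun i j => H (π⁻¹ i) (π⁻¹ j)) i k ≤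
      sigDist L G (Matrix.of fun i j => H (π⁻¹ i) (π⁻¹ j)) i l := fun i =>
    ⟨π i, (hiff i _).2 rfl, fun k hk => (hiff i k).1 hk⟩
  have hπ : (fun i => (hex i).choose) = π := funext fun i => (hiff i _).1 (hex i).choose_spec.1
  unfold graphMatching
  rw [dif_pos hex]
  have hb : Function.Bijective fun i => (hex i).choose := hπ ▸ π.bijective
  change (if hb : Function.Bijective fun i => (hex i).choose then
    some (Equiv.ofBijective _ hb) else none) = some π
  rw [dif_pos hb]
  exact congrArg some (Equiv.ext fun i => congrFun hπ i)

/-- As `c₃ * ℓ ≥ 4000`, an error of 1 in `L` is harmless: `L` lies between half and twice `c₃ * ℓ`.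
Every condition then reduces to one on the constants. -/
lemma regime_of {a s θ c₁ c₃ ℓ L : ℝ} (ha : 0 < a) (ha2 : a ≤ 1 / 2) (hspos : 0 < s)
    (hs1 : s ≤ 1) (hs : 250000 * s ≤ a ^ 2) (hθpos : 0 < θ) (hθ1 : θ ≤ 1)
    (hc₃s : s ^ 2 * c₃ = 4000) (hc₃big : 4000 ≤ c₃) (hθc : 20000 * c₃ * θ = s ^ 2 * a ^ 2)
    (k0 : 16896 ≤ c₁) (k1 : 256 * c₃ ^ 2 ≤ c₁) (k2 : 64 ≤ θ * c₁) (k3 : 1152 * c₃ ≤ a * s * c₁)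
    (k4 : 4640 * c₃ ≤ a ^ 2 * c₁) (hℓ : 1 ≤ ℓ) (hL : |L - c₃ * ℓ| ≤ 1) :
    Regime a s θ ℓ L (c₁ * ℓ ^ 2) := by
  have ha1 : a ^ 2 ≤ 1 := by nlinarith
  have hsa : s ^ 2 * a ^ 2 ≤ s ^ 2 := mul_le_of_le_one_right (by positivity) ha1
  have hc₃pos : 0 < c₃ := by linarith
  have hc₁pos : 0 < c₁ := by linarith
  have hθsq' : θ ^ 2 ≤ θ := by nlinarith
  obtain ⟨hL1, hL2⟩ := abs_le.1 hL
  have hcℓ : 4000 ≤ c₃ * ℓ := by nlinarith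
  have hLlow : c₃ * ℓ / 2 ≤ L := by linarith
  have hLup : L ≤ 2 * (c₃ * ℓ) := by linarith
  have hL0 : 0 < L := by linarith
  have hℓ0 : 0 < ℓ := by linarith
  have hℓ2 : ℓ ≤ ℓ ^ 2 := by nlinarith
  have hℓ2' : 1 ≤ ℓ ^ 2 := by linarith
  have hbase : c₁ ≤ c₁ * ℓ ^ 2 := le_mul_of_one_le_right hc₁pos.le hℓ2'
  refine ⟨ha, ha2, hspos, hs1, hθpos, hθ1, hℓ, by linarith, ?_, ?_, ?_, by linarith, ?_, ?_, ?_,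
    ?_, ?_, hs⟩
  · have h := mul_le_mul_of_nonneg_left hLlow (sq_nonneg s)
    have e : s ^ 2 * (c₃ * ℓ / 2) = 2000 * ℓ := by linear_combination ℓ / 2 * hc₃s
    linarith
  · calc 5184 * θ ^ 2 * L ≤ 5184 * θ * (2 * (c₃ * ℓ)) := by gcongr
      _ = 10368 * (c₃ * θ) * ℓ := by ring
      _ ≤ (s ^ 2 * a ^ 2) * ℓ := by
        refine mul_le_mul_of_nonneg_right ?_ hℓ0.le
        have : 0 < c₃ * θ := by positivity
        linarith
      _ = _ := by ring
  · calc 50 * θ * L ≤ 50 * θ * (2 * (c₃ * ℓ)) := by gcongr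
      _ = 100 * (c₃ * θ) * ℓ := by ring
      _ ≤ s ^ 2 * ℓ := by
        refine mul_le_mul_of_nonneg_right ?_ hℓ0.le
        have : 0 < c₃ * θ := by positivity
        linarith
  · calc 64 * L ^ 2 ≤ 64 * (2 * (c₃ * ℓ)) ^ 2 := by gcongr
      _ = 256 * c₃ ^ 2 * ℓ ^ 2 := by ring
      _ ≤ c₁ * ℓ ^ 2 := by
        refine mul_le_mul_of_nonneg_right ?_ (sq_nonneg ℓ)
        linarith
  · calc 512 * ℓ ≤ 512 * ℓ ^ 2 := by linarith
      _ ≤ c₁ * ℓ ^ 2 := mul_le_mul_of_nonneg_right (by linarith) (sq_nonneg ℓ)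
  · calc 64 * ℓ ^ 2 ≤ θ * c₁ * ℓ ^ 2 := mul_le_mul_of_nonneg_right k2 (sq_nonneg ℓ)
      _ = _ := by ring
  · calc 576 * ℓ * L ≤ 576 * ℓ * (2 * (c₃ * ℓ)) := by gcongr
      _ = 1152 * c₃ * ℓ ^ 2 := by ring
      _ ≤ a * s * c₁ * ℓ ^ 2 := mul_le_mul_of_nonneg_right k3 (sq_nonneg ℓ)
      _ = _ := by ring
  · calc 145 * 16 * L ≤ 145 * 16 * (2 * (c₃ * ℓ)) := by gcongr
      _ = 4640 * c₃ * ℓ := by ring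
      _ ≤ 4640 * c₃ * ℓ ^ 2 := by gcongr
      _ ≤ a ^ 2 * c₁ * ℓ ^ 2 := mul_le_mul_of_nonneg_right k4 (sq_nonneg ℓ)
      _ = _ := by ring

/-- The constants are chosen in the order `s`, `c₃`, `θ`, and last `c₁` and `c₂`: the gap `s`
depends on `a`, the number of bins must beat `1 / s ^ 2`, the noise level `θ` must be small relative
to both, and the degrees large relative to everything. -/
lemma exists_regime {a : ℝ} (ha : 0 < a) (ha2 : a ≤ 1 / 2) :
    ∃ c₁ c₂ c₃ s θ : ℝ, 0 < c₁ ∧ 0 < c₂ ∧ 0 < c₃ ∧ 32 * c₂ ≤ θ ^ 2 ∧ c₂ ≤ a ∧ c₂ ≤ 1 / 4 ∧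
      512 ≤ θ ^ 2 * c₁ ∧ ∀ ℓ L : ℝ, 1 ≤ ℓ → |L - c₃ * ℓ| ≤ 1 → Regime a s θ ℓ L (c₁ * ℓ ^ 2) := by
  set s : ℝ := a ^ 2 / 250000 with hs
  have ha1 : a ^ 2 ≤ 1 := by nlinarith
  have hspos : 0 < s := by positivity
  have hs1 : s ≤ 1 := by rw [hs]; linarith
  set c₃ : ℝ := 4000 / s ^ 2 with hc₃
  have hc₃s : s ^ 2 * c₃ = 4000 := by rw [hc₃]; field_simp
  have hs21 : s ^ 2 ≤ 1 := pow_le_one₀ hspos.le hs1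
  have hc₃pos : 0 < c₃ := by positivity
  have hc₃big : 4000 ≤ c₃ := by nlinarith
  set θ : ℝ := s ^ 2 * a ^ 2 / (20000 * c₃) with hθ
  have hθpos : 0 < θ := by positivity
  have hθc : 20000 * c₃ * θ = s ^ 2 * a ^ 2 := by rw [hθ]; field_simp
  have hsa : s ^ 2 * a ^ 2 ≤ s ^ 2 := mul_le_of_le_one_right (by positivity) ha1
  have hθ1 : θ ≤ 1 := by
    rw [hθ, div_le_one (by positivity)]
    linarith
  set c₁ : ℝ := 16896 + 256 * c₃ ^ 2 + 64 / θ + 1152 * c₃ / (a * s) + 4640 * c₃ / a ^ 2 +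
    512 / θ ^ 2 with hc₁
  have p1 : 0 < c₃ ^ 2 := by positivity
  have p2 : 0 < 64 / θ := by positivity
  have p3 : 0 < 1152 * c₃ / (a * s) := by positivity
  have p4 : 0 < 4640 * c₃ / a ^ 2 := by positivity
  have p5 : 0 < 512 / θ ^ 2 := by positivity
  have hc₁pos : 0 < c₁ := by positivity
  have k2 : 64 ≤ θ * c₁ := by
    rw [← div_le_iff₀' hθpos]; linarith
  have k3 : 1152 * c₃ ≤ a * s * c₁ := by
    rw [← div_le_iff₀' (by positivity)]; linarith
  have k4 : 4640 * c₃ ≤ a ^ 2 * c₁ := by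
    rw [← div_le_iff₀' (by positivity)]; linarith
  have k5 : 512 ≤ θ ^ 2 * c₁ := by
    rw [← div_le_iff₀' (by positivity)]; linarith
  have hθsq : θ ^ 2 ≤ 1 := pow_le_one₀ hθpos.le hθ1
  refine ⟨c₁, θ ^ 2 * a / 32, c₃, s, θ, hc₁pos, by positivity, hc₃pos, ?_, ?_, ?_, k5, ?_⟩
  · have : θ ^ 2 * a ≤ θ ^ 2 := mul_le_of_le_one_right (by positivity) (by linarith)
    linarith
  · have : θ ^ 2 * a ≤ a := mul_le_of_le_one_left ha.le hθsq
    linarith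
  · have : θ ^ 2 * a ≤ a := mul_le_of_le_one_left ha.le hθsq
    linarith
  exact fun ℓ L hℓ hL => regime_of ha ha2 hspos hs1 (by rw [hs]; linarith) hθpos hθ1 hc₃s hc₃big
    hθc (by linarith) (by linarith) k2 k3 k4 hℓ hL

end DegreeProfile

theorem theorem1 (α : ℝ) (hα₀ : 0 < α) (hα₁ : α < 1) :
    ∃ c₁ c₂ c₃ C : ℝ, 0 < c₁ ∧ 0 < c₂ ∧ 0 < c₃ ∧ 0 < C ∧
      ∀ n : ℕ, 2 ≤ n → ∀ L : ℝ, |L - c₃ * Real.log n| ≤ 1 →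
        ∀ (Ω : Type*) [MeasurableSpace Ω] (P : Measure Ω) [IsProbabilityMeasure P]
          (G H : Ω → Matrix (Fin n) (Fin n) ℕ),
          DegreeProfile.EdgeCorrelated P G H α
            (c₁ * Real.log n ^ 2) (c₂ * (Real.log n ^ 2)⁻¹) →
          1 - C / n ≤ P.real {ω | ∀ π : Equiv.Perm (Fin n),
            DegreeProfile.graphMatching L (G ω)
              (Matrix.of fun i j => H ω (π⁻¹ i) (π⁻¹ j)) = some π} := by
  obtain ⟨c₁, c₂, c₃, s, θ, hc₁, hc₂, hc₃, h32, hc₂a, hc₂4, h512, hreg⟩ :=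
    DegreeProfile.exists_regime (a := α / 2) (by linarith) (by linarith)
  refine ⟨c₁, c₂, c₃, 20, hc₁, hc₂, hc₃, by norm_num, ?_⟩
  intro n hn L hL Ω _ P _ G H hcorr
  have hn0 : (0 : ℝ) < n := by exact_mod_cast (by omega : 0 < n)
  rcases hn.eq_or_lt with rfl | hn3
  -- For `n = 2` the bound is vacuous since `20 / 2 > 1`; from `n = 3` on, `log n ≥ 1`.
  · refine le_trans ?_ measureReal_nonneg
    norm_num
  have hlog : 1 ≤ Real.log n := by
    rw [Real.le_log_iff_exp_le hn0]
    have : (3 : ℝ) ≤ n := by exact_mod_cast hn3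
    linarith [Real.exp_one_lt_three]
  have hlog2 : 1 ≤ Real.log n ^ 2 := one_le_pow₀ hlog
  have hδle : c₂ * (Real.log n ^ 2)⁻¹ ≤ c₂ :=
    mul_le_of_le_one_right hc₂.le (inv_le_one_of_one_le₀ hlog2)
  have hmis := DegreeProfile.real_mismatch_le (by omega) hcorr (a := α / 2) (by ring)
    (by positivity) (hδle.trans hc₂a) (hδle.trans hc₂4) (hreg _ L hlog hL) rfl
    (by
      have e : 32 * (c₂ * (Real.log n ^ 2)⁻¹) * Real.log n ^ 2 = 32 * c₂ := by field_simp
      rw [e]; exact h32)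
    (by
      have := mul_le_mul_of_nonneg_right h512 (sq_nonneg (Real.log n))
      linarith)
  have hunion : P.real Set.univ ≤ P.real {ω | ∀ π : Equiv.Perm (Fin n),
      DegreeProfile.graphMatching L (G ω) (Matrix.of fun i j => H ω (π⁻¹ i) (π⁻¹ j)) = some π} +
      P.real {ω | DegreeProfile.mismatch L (G ω) (H ω)} := by
    refine (measureReal_mono fun ω _ => ?_).trans (measureReal_union_le _ _)
    by_cases h : DegreeProfile.mismatch L (G ω) (H ω)
    · exact Or.inr h
    · exact Or.inl fun π => DegreeProfile.graphMatching_perm h π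
  rw [probReal_univ] at hunion
  linarith
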